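/- **Setting.** Let $\mathbb{T}$ be a (many-sorted, relational) geometric theory: formulae are built from atomic formulae $(x_1,\dots,x_k)\in R$ and equations by finite conjunctions, set-indexed disjunctions and $\exists$; the axioms are sequents $\phi\vdash_{\vec x}\psi$; $\mathbb{T}$-provability is derivability in geometric logic. Let $P[\mathbb{T}]$ be the propositional geometric theory with basic propositions $[n\sim^X m]$ ($X$ a sort, $n,m\in\mathbb{N}$) and $[(n_1,\dots,n_k)\in R]$ ($R\subseteq X^1\times\dots\times X^k$ a relation symbol, $n_i\in\mathbb{N}$), and with axioms saying that each $\sim^X$ is symmetric and transitive, that $[\vec n\in R]\wedge\bigwedge_i[n_i\sim^{X^i}m_i]\vdash[\vec m\in R]$ and $[\vec n\in R]\vdash\bigwedge_i[n_i\sim^{X^i}n_i]$, and that $\bigwedge_i[n_i\sim^{X^i}n_i]\wedge\phi_{\vec n}\vdash\psi_{\vec n}$ for each axiom $\phi\vdash_{x_1:X^1,\dots,x_k:X^k}\psi$ of $\mathbb{T}$ and all $\vec n\in\mathbb{N}^k$. Here $\phi_{\vec n}$ arises from $\phi$ by replacing the free variables by $\vec n$, atomic formulae by the corresponding basic propositions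 ($x=_Xy$ by $[x\sim^Xy]$), and $\exists x{:}X.\,\chi$ by $\bigvee_{n\in\mathbb{N}}[n\sim^Xn]\wedge\chi(n)$. Let $\mathbb{T}_{\cong}$ be the geometric theory of isomorphisms of $\mathbb{T}$-models: two copies of $\mathbb{T}$ (subscripts $1,2$) and relation symbols $\alpha^X\subseteq X_1\times X_2$, with axioms saying that each $\alpha^X$ is the graph of a bijection and that $\alpha$ preserves and reflects every relation symbol of $\mathbb{T}$. Let $G_0$ and $G_1$ be the locales classifying $P[\mathbb{T}]$ and $P[\mathbb{T}_{\cong}]$, and let $s,t\colon G_1\rightrightarrows G_0$ be the locale morphisms whose frame homomorphisms $s^*,t^*$ send each basic proposition to its first, respectively second, copy. Let $q\colon G_0\to\pi_0(G^{\mathbb{T}})$ be the coequaliser of $s$ and $t$ in the category of locales. Let $\mathbf{Set}[\mathbb{T}]$ be the classifying topos of $\mathbb{T}$ (sheaves on the syntactic site of $\mathbb{T}$). **Statement.** 1. $\pi_0(G^{\mathbb{T}})$ is the localic reflection of $\mathbf{Set}[\mathbb{T}]$: there is a geometric morphism $p\colon\mathbf{Set}[\mathbb{T}]\to\mathrm{Sh}(\pi_0(G^{\mathbb{T}}))$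 such that for every locale $L$ every geometric morphism $f\colon\mathbf{Set}[\mathbb{T}]\to\mathrm{Sh}(L)$ is isomorphic to $\mathrm{Sh}(g)\circ p$ for a unique locale morphism $g\colon\pi_0(G^{\mathbb{T}})\to L$. 2. $s^*$ has a left adjoint $s_!$, and $s_!t^*$ is a closure operator on $\mathcal{O}G_0$. For every finite set $J$ of basic propositions, $$s_!t^*\Bigl(\bigwedge_{a\in J}a\Bigr)=\bigvee_{y}\ \bigwedge_{a\in J}a[y],$$ where $y$ runs over the families of functions $y_X\colon\mathbb{N}\to\mathbb{N}$ indexed by the sorts $X$, and $a[y]$ is obtained from $a$ by replacing each number $n$ in a place of sort $X$ by $y_X(n)$. Moreover $q^*$ is an order isomorphism from $\mathcal{O}\pi_0(G^{\mathbb{T}})$ onto the set of fixed points of $s_!t^*$. 3. $\mathcal{O}\pi_0(G^{\mathbb{T}})$ is isomorphic to the frame of sentences of $\mathbb{T}$ (formulae without free variables, modulo $\mathbb{T}$-provable equivalence, ordered by $\mathbb{T}$-provability). The isomorphism $\theta$ from the frame of sentences to $\mathcal{O}\pi_0(G^{\mathbb{T}})$ can be chosen so that $q^*(\theta[\phi])\in\mathcal{O}G_0$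 is the element given by the translation of $\phi$, for every sentence $\phi$. 4. $\mathcal{O}\pi_0(G^{\mathbb{T}})$ is isomorphic to the frame of subterminal objects of $\mathbf{Set}[\mathbb{T}]$, by an isomorphism under which $\theta[\phi]$ corresponds to the subsheaf of $1$ that is inhabited at an object $\{\vec x.\,\chi\}$ of the syntactic category exactly when $\chi\vdash_{\vec x}\phi$ is provable in $\mathbb{T}$. -/

import Mathlib

universe u v

namespace GeometricLogic

open CategoryTheory

/-- A (relational, many-sorted) first-order signature. A relation symbol with `arity R = 0` is a
basic proposition. -/
structure Signature where
  Srt : Type u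
  Rel : Type u
  arity : Rel → ℕ
  dom : (R : Rel) → Fin (arity R) → Srt

/-- `Var Γ X` is the type of variables of sort `X` in the context `Γ`
(a finite list of sorts, most recently declared variable first). -/
inductive Var {S : Type u} : List S → S → Type u
  | zero {Γ : List S} {X : S} : Var (X :: Γ) X
  | succ {Γ : List S} {X Y : S} : Var Γ X → Var (Y :: Γ) X

/-- Sort-preserving maps of variables, i.e. substitutions (the only terms are variables). -/
abbrev Ren {S : Type u} (Γ Δ : List S) : Type u := ∀ X : S, Var Γ X → Var Δ X

namespace Var

variable {S : Type u}

/-- The variables of the first block of a concatenated context. -/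
def inl {Γ : List S} (Δ : List S) {X : S} : Var Γ X → Var (Γ ++ Δ) X
  | zero => zero
  | succ v => succ (inl Δ v)

/-- The variables of the second block of a concatenated context. -/
def inr {Δ : List S} : (Γ : List S) → {X : S} → Var Δ X → Var (Γ ++ Δ) X
  | [], _, v => v
  | _ :: Γ, _, v => succ (inr Γ v)

/-- The image of a variable when a function is applied to all sorts. -/
def map {S' : Type u} (f : S → S') {Γ : List S} {X : S} : Var Γ X → Var (Γ.map f) (f X)
  | zero => zero
  | succ v => succ (map f v)

@[elab_as_elim]
theorem append_cases {Γ Δ : List S} {X : S} {P : Var (Γ ++ Δ) X → Prop} (v : Var (Γ ++ Δ) X)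
    (hl : ∀ v : Var Γ X, P (v.inl Δ)) (hr : ∀ v : Var Δ X, P (v.inr Γ)) : P v := by
  induction Γ with
  | nil => exact hr v
  | cons Y Γ ih =>
    cases v with
    | zero => exact hl .zero
    | succ v => exact ih (P := fun v => P (.succ v)) v (fun v => hl (.succ v)) hr

end Var

namespace Ren

variable {S : Type u}

/-- The substitution on a context `X :: Γ` given by a variable and a substitution on `Γ`. -/
def cons {Γ Ξ : List S} {X : S} (v : Var Ξ X) (r : Ren Γ Ξ) : Ren (X :: Γ) Ξ
  | _, .zero => v
  | _, .succ w => r _ w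

/-- Extension of a substitution under a binder. -/
def lift {Γ Δ : List S} (r : Ren Γ Δ) (Y : S) : Ren (Y :: Γ) (Y :: Δ) :=
  cons .zero fun _ v => .succ (r _ v)

/-- The substitution on a concatenated context given by `a` on the first and `b` on the second
block. -/
def copair {Δ Ξ : List S} : {Γ : List S} → Ren Γ Ξ → Ren Δ Ξ → Ren (Γ ++ Δ) Ξ
  | [], _, b => b
  | _ :: _, a, b => cons (a _ .zero) (copair (fun _ w => a _ (.succ w)) b)

theorem copair_inl {Γ Δ Ξ : List S} (a : Ren Γ Ξ) (b : Ren Δ Ξ) {X : S} (v : Var Γ X) :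
    copair a b X (v.inl Δ) = a X v := by
  induction v with
  | zero => rfl
  | succ v ih => exact ih _

theorem copair_inr {Γ Δ Ξ : List S} (a : Ren Γ Ξ) (b : Ren Δ Ξ) {X : S} (v : Var Δ X) :
    copair a b X (v.inr Γ) = b X v := by
  induction Γ with
  | nil => rfl
  | cons Y Γ ih => exact ih _

theorem append_ext {Γ Δ Ξ : List S} {r s : Ren (Γ ++ Δ) Ξ}
    (hl : ∀ X (v : Var Γ X), r X (v.inl Δ) = s X (v.inl Δ))
    (hr : ∀ X (v : Var Δ X), r X (v.inr Γ) = s X (v.inr Γ)) : r = s := by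
  funext X v
  induction v using Var.append_cases with
  | hl v => exact hl X v
  | hr v => exact hr X v

theorem copair_comp {Γ Δ Ξ Θ : List S} (a : Ren Γ Ξ) (b : Ren Δ Ξ) (r : Ren Ξ Θ) :
    (fun X v => r X (copair a b X v)) =
      copair (fun X v => r X (a X v)) (fun X v => r X (b X v)) :=
  append_ext (fun X v => by simp only [copair_inl]) (fun X v => by simp only [copair_inr])

theorem lift_comp {Γ Δ Ξ : List S} (r : Ren Γ Δ) (s : Ren Δ Ξ) (Y : S) :
    (fun X v => s.lift Y X (r.lift Y X v)) = lift (fun X v => s X (r X v)) Y := by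
  funext X v; cases v <;> rfl

theorem lift_id {Γ : List S} (Y : S) : lift (fun X (v : Var Γ X) => v) Y = fun _ v => v := by
  funext X v; cases v <;> rfl

/-- Extension of a substitution under a block of binders. -/
def liftBlock {Γ Ξ : List S} (r : Ren Γ Ξ) : (Δ : List S) → Ren (Δ ++ Γ) (Δ ++ Ξ)
  | [] => r
  | Y :: Δ => lift (liftBlock r Δ) Y

theorem liftBlock_eq {Γ Ξ : List S} (r : Ren Γ Ξ) (Δ : List S) :
    liftBlock r Δ = copair (fun _ v => v.inl Ξ) (fun X v => (r X v).inr Δ) := by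
  refine append_ext (fun X v => ?_) (fun X v => ?_)
  · rw [copair_inl]
    induction v with
    | zero => rfl
    | succ v ih => exact congrArg Var.succ ih
  · rw [copair_inr]
    induction Δ with
    | nil => rfl
    | cons Y Δ ih => exact congrArg Var.succ ih

end Ren

/-- Geometric formulae in a context: finite conjunctions, (small) disjunctions, equality,
relation symbols and existential quantification. -/
inductive Formula (A : Signature.{u}) : List A.Srt → Type (u + 1)
  | top {Γ : List A.Srt} : Formula A Γ
  | and {Γ : List A.Srt} (φ ψ : Formula A Γ) : Formula A Γ
  | sup {Γ : List A.Srt} (ι : Type u) (φ : ι → Formula A Γ) : Formula A Γ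
  | eq {Γ : List A.Srt} {X : A.Srt} (x y : Var Γ X) : Formula A Γ
  | rel {Γ : List A.Srt} (R : A.Rel) (x : ∀ i, Var Γ (A.dom R i)) : Formula A Γ
  | ex {Γ : List A.Srt} (X : A.Srt) (φ : Formula A (X :: Γ)) : Formula A Γ

namespace Formula

variable {A : Signature.{u}}

/-- Substitution of variables for variables. -/
def rename : {Γ Δ : List A.Srt} → Formula A Γ → Ren Γ Δ → Formula A Δ
  | _, _, top, _ => top
  | _, _, and φ ψ, r => and (φ.rename r) (ψ.rename r)
  | _, _, sup ι φ, r => sup ι fun i => (φ i).rename r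
  | _, _, eq x y, r => eq (r _ x) (r _ y)
  | _, _, rel R x, r => rel R fun i => r _ (x i)
  | _, _, ex X φ, r => ex X (φ.rename (r.lift X))

/-- The conjunction of the equations `a v = b v`, for `v` running over the variables of `Δ`. -/
def eqs {Γ : List A.Srt} : {Δ : List A.Srt} → Ren Δ Γ → Ren Δ Γ → Formula A Γ
  | [], _, _ => top
  | _ :: _, a, b =>
    and (eq (a _ .zero) (b _ .zero)) (eqs (fun _ v => a _ (.succ v)) (fun _ v => b _ (.succ v)))

/-- Finite conjunctions. -/
def conj {Γ : List A.Srt} : {k : ℕ} → (Fin k → Formula A Γ) → Formula A Γ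
  | 0, _ => top
  | _ + 1, φ => and (φ 0) (conj fun i => φ i.succ)

/-- Existential quantification over a block of variables. -/
def exs {Γ : List A.Srt} : (Δ : List A.Srt) → Formula A (Δ ++ Γ) → Formula A Γ
  | [], φ => φ
  | X :: Δ, φ => exs Δ (ex X φ)

theorem rename_rename {Γ Δ Ξ : List A.Srt} (φ : Formula A Γ) (r : Ren Γ Δ) (s : Ren Δ Ξ) :
    (φ.rename r).rename s = φ.rename fun X v => s X (r X v) := by
  induction φ generalizing Δ Ξ with
  | top => rfl
  | and φ ψ h₁ h₂ => simp only [rename, h₁, h₂]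
  | sup ι φ h => simp only [rename, h]
  | eq x y => rfl
  | rel R x => rfl
  | ex X φ h => simp only [rename, h, Ren.lift_comp]

theorem rename_id {Γ : List A.Srt} (φ : Formula A Γ) : φ.rename (fun _ v => v) = φ := by
  induction φ with
  | top => rfl
  | and φ ψ h₁ h₂ => simp only [rename, h₁, h₂]
  | sup ι φ h => simp only [rename, h]
  | eq x y => rfl
  | rel R x => rfl
  | ex X φ h => simp only [rename, Ren.lift_id, h]

theorem rename_exs {Γ Ξ : List A.Srt} (Δ : List A.Srt) (φ : Formula A (Δ ++ Γ)) (r : Ren Γ Ξ) :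
    (exs Δ φ).rename r = exs Δ (φ.rename (r.liftBlock Δ)) := by
  induction Δ with
  | nil => rfl
  | cons X Δ ih => exact ih _

end Formula

/-- A sequent `φ ⊢_Γ ψ`. -/
structure Sequent (A : Signature.{u}) where
  ctx : List A.Srt
  lhs : Formula A ctx
  rhs : Formula A ctx

/-- A geometric theory: a signature and a set of axioms. -/
structure Theory where
  sig : Signature.{u}
  axioms : Set (Sequent sig)

open Formula

/-- `Provable T φ ψ` says that the sequent `φ ⊢_Γ ψ` is derivable from the axioms of `T` in
geometric logic. Derivations never drop variables from a context, so that sorts may be empty. -/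
inductive Provable (T : Theory.{u}) :
    {Γ : List T.sig.Srt} → Formula T.sig Γ → Formula T.sig Γ → Prop
  | ax {σ : Sequent T.sig} (h : σ ∈ T.axioms) : Provable T σ.lhs σ.rhs
  | refl {Γ : List T.sig.Srt} (φ : Formula T.sig Γ) : Provable T φ φ
  | cut {Γ : List T.sig.Srt} {φ ψ χ : Formula T.sig Γ} :
      Provable T φ ψ → Provable T ψ χ → Provable T φ χ
  | subst {Γ Δ : List T.sig.Srt} {φ ψ : Formula T.sig Γ} (r : Ren Γ Δ) :
      Provable T φ ψ → Provable T (φ.rename r) (ψ.rename r)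
  | eq_refl {Γ : List T.sig.Srt} {X : T.sig.Srt} (x : Var Γ X) : Provable T top (eq x x)
  | eq_subst {Γ Δ : List T.sig.Srt} (φ : Formula T.sig Γ) (a b : Ren Γ Δ) :
      Provable T (and (eqs a b) (φ.rename a)) (φ.rename b)
  | top_intro {Γ : List T.sig.Srt} (φ : Formula T.sig Γ) : Provable T φ top
  | and_left {Γ : List T.sig.Srt} (φ ψ : Formula T.sig Γ) : Provable T (and φ ψ) φ
  | and_right {Γ : List T.sig.Srt} (φ ψ : Formula T.sig Γ) : Provable T (and φ ψ) ψ
  | and_intro {Γ : List T.sig.Srt} {φ ψ χ : Formula T.sig Γ} :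
      Provable T φ ψ → Provable T φ χ → Provable T φ (and ψ χ)
  | sup_intro {Γ : List T.sig.Srt} {ι : Type u} (φ : ι → Formula T.sig Γ) (i : ι) :
      Provable T (φ i) (sup ι φ)
  | sup_elim {Γ : List T.sig.Srt} {ι : Type u} {φ : ι → Formula T.sig Γ} {ψ : Formula T.sig Γ} :
      (∀ i, Provable T (φ i) ψ) → Provable T (sup ι φ) ψ
  | ex_intro {Γ : List T.sig.Srt} {X : T.sig.Srt} {φ : Formula T.sig (X :: Γ)}
      {ψ : Formula T.sig Γ} :
      Provable T (ex X φ) ψ → Provable T φ (ψ.rename fun _ v => .succ v)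
  | ex_elim {Γ : List T.sig.Srt} {X : T.sig.Srt} {φ : Formula T.sig (X :: Γ)}
      {ψ : Formula T.sig Γ} :
      Provable T φ (ψ.rename fun _ v => .succ v) → Provable T (ex X φ) ψ
  | distrib {Γ : List T.sig.Srt} {ι : Type u} (φ : Formula T.sig Γ) (ψ : ι → Formula T.sig Γ) :
      Provable T (and φ (sup ι ψ)) (sup ι fun i => and φ (ψ i))
  | frobenius {Γ : List T.sig.Srt} {X : T.sig.Srt} (φ : Formula T.sig Γ)
      (ψ : Formula T.sig (X :: Γ)) :
      Provable T (and φ (ex X ψ)) (ex X (and (φ.rename fun _ v => .succ v) ψ))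

namespace Provable

variable {T : Theory.{u}} {Γ Δ Ξ : List T.sig.Srt}

theorem and_mono {φ φ' ψ ψ' : Formula T.sig Γ} (h : Provable T φ φ') (h' : Provable T ψ ψ') :
    Provable T (and φ ψ) (and φ' ψ') :=
  and_intro (cut (and_left _ _) h) (cut (and_right _ _) h')

theorem exs_adj {φ : Formula T.sig (Δ ++ Γ)} {ψ : Formula T.sig Γ} :
    Provable T (exs Δ φ) ψ ↔ Provable T φ (ψ.rename fun _ v => v.inr Δ) := by
  induction Δ with
  | nil =>
    have : (ψ.rename fun _ v => v.inr []) = ψ := rename_id ψ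
    rw [this]; exact Iff.rfl
  | cons X Δ ih =>
    have : (ψ.rename fun _ v => v.inr (X :: Δ)) =
        (ψ.rename fun _ v => v.inr Δ).rename fun _ v => .succ v :=
      (by rw [rename_rename]; rfl)
    rw [this]
    exact ih.trans ⟨ex_intro, ex_elim⟩

theorem exs_mono {φ ψ : Formula T.sig (Δ ++ Γ)} (h : Provable T φ ψ) :
    Provable T (exs Δ φ) (exs Δ ψ) :=
  exs_adj.2 (cut h (exs_adj.1 (refl _)))

theorem exs_frobenius (φ : Formula T.sig Γ) (ψ : Formula T.sig (Δ ++ Γ)) :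
    Provable T (and φ (exs Δ ψ)) (exs Δ (and (φ.rename fun _ v => v.inr Δ) ψ)) := by
  induction Δ with
  | nil =>
    have : (φ.rename fun _ v => v.inr []) = φ := rename_id φ
    rw [this]; exact refl _
  | cons X Δ ih =>
    have : (φ.rename fun _ v => v.inr (X :: Δ)) =
        (φ.rename fun _ v => v.inr Δ).rename fun _ v => .succ v :=
      (by rw [rename_rename]; rfl)
    rw [this]
    exact cut (ih _) (exs_mono (frobenius _ _))

theorem exs_of {φ : Formula T.sig (Δ ++ Γ)} {χ : Formula T.sig Ξ} {r : Ren Γ Ξ} (b : Ren Δ Ξ)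
    (h : Provable T χ (φ.rename (Ren.copair b r))) : Provable T χ ((exs Δ φ).rename r) := by
  have h1 := subst (Ren.copair b r) (exs_adj.1 (refl (T := T) (exs Δ φ)))
  rw [rename_rename] at h1
  simp only [Ren.copair_inr] at h1
  exact cut h h1

theorem of_exs {φ : Formula T.sig (Δ ++ Γ)} {χ ψ : Formula T.sig Ξ} {r : Ren Γ Ξ}
    (h : Provable T χ ((exs Δ φ).rename r))
    (h' : Provable T (and (χ.rename fun _ v => v.inr Δ)
        (φ.rename (Ren.copair (fun _ v => v.inl Ξ) (fun _ v => (r _ v).inr Δ))))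
      (ψ.rename fun _ v => v.inr Δ)) : Provable T χ ψ := by
  rw [rename_exs, Ren.liftBlock_eq] at h
  exact cut (and_intro (refl _) h) (cut (exs_frobenius _ _) (exs_adj.2 h'))

theorem eqs_iff {χ : Formula T.sig Γ} {a b : Ren Δ Γ} :
    Provable T χ (eqs a b) ↔ ∀ X (v : Var Δ X), Provable T χ (eq (a X v) (b X v)) := by
  induction Δ with
  | nil => exact ⟨fun _ X v => (nomatch v), fun _ => top_intro _⟩
  | cons Y Δ ih =>
    constructor
    · intro h X v
      cases v with
      | zero => exact cut h (and_left _ _)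
      | succ v => exact ih.1 (cut h (and_right _ _)) X v
    · intro h
      exact and_intro (h _ .zero) (ih.2 fun X v => h X (.succ v))

theorem eq_rfl (χ : Formula T.sig Γ) {X : T.sig.Srt} (x : Var Γ X) : Provable T χ (eq x x) :=
  cut (top_intro _) (eq_refl _)

theorem replace {χ : Formula T.sig Γ} {φ : Formula T.sig Δ} {a b : Ren Δ Γ}
    (h : ∀ X (v : Var Δ X), Provable T χ (eq (a X v) (b X v))) (h' : Provable T χ (φ.rename a)) :
    Provable T χ (φ.rename b) :=
  cut (and_intro (eqs_iff.2 h) h') (eq_subst _ _ _)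

theorem replace_at {χ : Formula T.sig Ξ} {φ : Formula T.sig (Γ ++ Δ)} {a a' : Ren Γ Ξ}
    {b b' : Ren Δ Ξ} (h : ∀ X (v : Var Γ X), Provable T χ (eq (a X v) (a' X v)))
    (h' : ∀ X (v : Var Δ X), Provable T χ (eq (b X v) (b' X v)))
    (hφ : Provable T χ (φ.rename (Ren.copair a b))) :
    Provable T χ (φ.rename (Ren.copair a' b')) := by
  refine replace (fun X v => ?_) hφ
  induction v using Var.append_cases with
  | hl v => rw [Ren.copair_inl, Ren.copair_inl]; exact h X v
  | hr v => rw [Ren.copair_inr, Ren.copair_inr]; exact h' X v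

theorem eq_symm {χ : Formula T.sig Γ} {X : T.sig.Srt} {x y : Var Γ X}
    (h : Provable T χ (eq x y)) : Provable T χ (eq y x) := by
  refine replace (Δ := [X, X]) (φ := eq .zero (.succ .zero))
    (a := Ren.cons x (Ren.cons x (fun _ v => nomatch v)))
    (b := Ren.cons y (Ren.cons x (fun _ v => nomatch v))) ?_ (eq_rfl χ x)
  intro Y v
  match v with
  | .zero => exact h
  | .succ .zero => exact eq_rfl χ x

theorem eq_trans {χ : Formula T.sig Γ} {X : T.sig.Srt} {x y z : Var Γ X}
    (h : Provable T χ (eq x y)) (h' : Provable T χ (eq y z)) : Provable T χ (eq x z) := by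
  refine replace (Δ := [X, X]) (φ := eq .zero (.succ .zero))
    (a := Ren.cons x (Ren.cons y (fun _ v => nomatch v)))
    (b := Ren.cons x (Ren.cons z (fun _ v => nomatch v))) ?_ h
  intro Y v
  match v with
  | .zero => exact eq_rfl χ x
  | .succ .zero => exact h'

end Provable

open Provable

/-- An object `{x⃗ . φ}` of the syntactic category: a formula in context. -/
structure SynCat (T : Theory.{u}) where
  ctx : List T.sig.Srt
  formula : Formula T.sig ctx

namespace SynCat

variable {T : Theory.{u}}

/-- `θ(y⃗, x⃗)` is `T`-provably a functional relation from `{x⃗ . φ}` to `{y⃗ . ψ}`. -/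
structure IsFunctional (B C : SynCat T) (θ : Formula T.sig (C.ctx ++ B.ctx)) : Prop where
  dom : Provable T θ (B.formula.rename fun _ v => v.inr C.ctx)
  cod : Provable T θ (C.formula.rename fun _ v => v.inl B.ctx)
  total : Provable T B.formula (exs C.ctx θ)
  single : ∀ X (v : Var C.ctx X), Provable T
    (and (θ.rename (Ren.copair (fun _ w => w.inl (C.ctx ++ B.ctx))
            (fun _ w => (w.inr C.ctx).inr C.ctx)))
         (θ.rename (Ren.copair (fun _ w => (w.inl B.ctx).inr C.ctx)
            (fun _ w => (w.inr C.ctx).inr C.ctx))))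
    (eq (v.inl (C.ctx ++ B.ctx)) ((v.inl B.ctx).inr C.ctx))

/-- The type of `T`-provably functional formulae. -/
abbrev Func (B C : SynCat T) := {θ : Formula T.sig (C.ctx ++ B.ctx) // IsFunctional B C θ}

/-- `T`-provable equivalence of functional formulae. -/
instance funcSetoid (B C : SynCat T) : Setoid (Func B C) where
  r θ θ' := Provable T θ.1 θ'.1 ∧ Provable T θ'.1 θ.1
  iseqv := ⟨fun _ => ⟨refl _, refl _⟩, fun h => ⟨h.2, h.1⟩,
    fun h h' => ⟨cut h.1 h'.1, cut h'.2 h.2⟩⟩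

section

variable {B C D E : SynCat T} {Ξ : List T.sig.Srt} {χ : Formula T.sig Ξ}

theorem IsFunctional.dom_at {θ : Formula T.sig (C.ctx ++ B.ctx)} (h : IsFunctional B C θ)
    {b : Ren C.ctx Ξ} {a : Ren B.ctx Ξ} (h' : Provable T χ (θ.rename (Ren.copair b a))) :
    Provable T χ (B.formula.rename a) := by
  have := subst (Ren.copair b a) h.dom
  rw [rename_rename] at this
  simp only [Ren.copair_inr] at this
  exact cut h' this

theorem IsFunctional.cod_at {θ : Formula T.sig (C.ctx ++ B.ctx)} (h : IsFunctional B C θ)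
    {b : Ren C.ctx Ξ} {a : Ren B.ctx Ξ} (h' : Provable T χ (θ.rename (Ren.copair b a))) :
    Provable T χ (C.formula.rename b) := by
  have := subst (Ren.copair b a) h.cod
  rw [rename_rename] at this
  simp only [Ren.copair_inl] at this
  exact cut h' this

theorem IsFunctional.total_at {θ : Formula T.sig (C.ctx ++ B.ctx)} (h : IsFunctional B C θ)
    {a : Ren B.ctx Ξ} (h' : Provable T χ (B.formula.rename a)) :
    Provable T χ ((exs C.ctx θ).rename a) :=
  cut h' (subst a h.total)

theorem IsFunctional.single_at {θ : Formula T.sig (C.ctx ++ B.ctx)} (h : IsFunctional B C θ)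
    {b b' : Ren C.ctx Ξ} {a : Ren B.ctx Ξ} (h₁ : Provable T χ (θ.rename (Ren.copair b a)))
    (h₂ : Provable T χ (θ.rename (Ren.copair b' a))) (X : T.sig.Srt) (v : Var C.ctx X) :
    Provable T χ (eq (b X v) (b' X v)) := by
  have := subst (Ren.copair b (Ren.copair b' a)) (h.single X v)
  simp only [Formula.rename, rename_rename, Ren.copair_comp, Ren.copair_inl, Ren.copair_inr]
    at this
  exact cut (and_intro h₁ h₂) this

end

/-- The formula `φ(y⃗) ∧ y⃗ = x⃗`. -/
def idForm (B : SynCat T) : Formula T.sig (B.ctx ++ B.ctx) :=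
  and (B.formula.rename fun _ v => v.inl B.ctx)
    (eqs (fun _ v => v.inl B.ctx) (fun _ v => v.inr B.ctx))

/-- The formula `∃ y⃗, θ(y⃗, x⃗) ∧ θ'(z⃗, y⃗)`. -/
def compForm {B C D : SynCat T} (θ : Formula T.sig (C.ctx ++ B.ctx))
    (θ' : Formula T.sig (D.ctx ++ C.ctx)) : Formula T.sig (D.ctx ++ B.ctx) :=
  exs C.ctx (and
    (θ.rename (Ren.copair (fun _ v => v.inl (D.ctx ++ B.ctx))
      (fun _ v => (v.inr D.ctx).inr C.ctx)))
    (θ'.rename (Ren.copair (fun _ v => (v.inl B.ctx).inr C.ctx)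
      (fun _ v => v.inl (D.ctx ++ B.ctx)))))

section

variable {B C D E : SynCat T} {Ξ : List T.sig.Srt} {χ : Formula T.sig Ξ}

theorem rename_eqs {Γ Δ Ξ : List T.sig.Srt} (a b : Ren Δ Γ) (r : Ren Γ Ξ) :
    (eqs a b : Formula T.sig Γ).rename r =
      eqs (fun X v => r X (a X v)) (fun X v => r X (b X v)) := by
  induction Δ with
  | nil => rfl
  | cons X Δ ih => exact congrArg (Formula.and _) (ih _ _)

theorem idForm_at {b a : Ren B.ctx Ξ} :
    Provable T χ ((idForm B).rename (Ren.copair b a)) ↔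
      Provable T χ (B.formula.rename b) ∧ ∀ X v, Provable T χ (eq (b X v) (a X v)) := by
  have : (idForm B).rename (Ren.copair b a) = and (B.formula.rename b) (eqs b a) := by
    simp only [idForm, Formula.rename, rename_rename, rename_eqs, Ren.copair_inl, Ren.copair_inr]
  rw [this]
  exact ⟨fun h => ⟨cut h (and_left _ _), eqs_iff.1 (cut h (and_right _ _))⟩,
    fun h => and_intro h.1 (eqs_iff.2 h.2)⟩

theorem comp_intro {θ : Formula T.sig (C.ctx ++ B.ctx)} {θ' : Formula T.sig (D.ctx ++ C.ctx)}
    {a : Ren B.ctx Ξ} (b : Ren C.ctx Ξ) {c : Ren D.ctx Ξ}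
    (h : Provable T χ (θ.rename (Ren.copair b a)))
    (h' : Provable T χ (θ'.rename (Ren.copair c b))) :
    Provable T χ ((compForm θ θ').rename (Ren.copair c a)) := by
  refine exs_of b ?_
  simp only [Formula.rename, rename_rename, Ren.copair_comp, Ren.copair_inl, Ren.copair_inr]
  exact and_intro h h'

theorem comp_elim {θ : Formula T.sig (C.ctx ++ B.ctx)} {θ' : Formula T.sig (D.ctx ++ C.ctx)}
    {a : Ren B.ctx Ξ} {c : Ren D.ctx Ξ} {ψ : Formula T.sig Ξ}
    (h : Provable T χ ((compForm θ θ').rename (Ren.copair c a)))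
    (h' : ∀ χ' : Formula T.sig (C.ctx ++ Ξ),
      (∀ {ξ : Formula T.sig Ξ}, Provable T χ ξ →
        Provable T χ' (ξ.rename fun _ v => v.inr C.ctx)) →
      Provable T χ' (θ.rename (Ren.copair (fun _ v => v.inl Ξ) fun _ v => (a _ v).inr C.ctx)) →
      Provable T χ' (θ'.rename (Ren.copair (fun _ v => (c _ v).inr C.ctx) fun _ v => v.inl Ξ)) →
      Provable T χ' (ψ.rename fun _ v => v.inr C.ctx)) : Provable T χ ψ := by
  refine of_exs h ?_
  simp only [Formula.rename, rename_rename, Ren.copair_comp, Ren.copair_inl, Ren.copair_inr]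
  exact h' _ (fun hξ => cut (and_left _ _) (subst _ hξ))
    (cut (and_right _ _) (and_left _ _)) (cut (and_right _ _) (and_right _ _))

theorem total_elim {θ : Formula T.sig (C.ctx ++ B.ctx)} (hθ : IsFunctional B C θ)
    {a : Ren B.ctx Ξ} {ψ : Formula T.sig Ξ} (h : Provable T χ (B.formula.rename a))
    (h' : ∀ χ' : Formula T.sig (C.ctx ++ Ξ),
      (∀ {ξ : Formula T.sig Ξ}, Provable T χ ξ →
        Provable T χ' (ξ.rename fun _ v => v.inr C.ctx)) →
      Provable T χ' (θ.rename (Ren.copair (fun _ v => v.inl Ξ) fun _ v => (a _ v).inr C.ctx)) →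
      Provable T χ' (ψ.rename fun _ v => v.inr C.ctx)) : Provable T χ ψ :=
  of_exs (hθ.total_at h)
    (h' _ (fun hξ => cut (and_left _ _) (subst _ hξ)) (and_right _ _))

theorem rename_at {Γ Δ Ξ Θ : List T.sig.Srt} (θ : Formula T.sig (Γ ++ Δ)) (a : Ren Γ Ξ)
    (b : Ren Δ Ξ) (r : Ren Ξ Θ) : (θ.rename (Ren.copair a b)).rename r =
      θ.rename (Ren.copair (fun X v => r X (a X v)) (fun X v => r X (b X v))) := by
  rw [rename_rename, Ren.copair_comp]

theorem rename_generic {Γ Δ : List T.sig.Srt} (θ : Formula T.sig (Γ ++ Δ)) :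
    θ.rename (Ren.copair (fun _ v => v.inl Δ) fun _ v => v.inr Γ) = θ := by
  have : (Ren.copair (fun _ v => v.inl Δ) fun _ v => v.inr Γ : Ren (Γ ++ Δ) (Γ ++ Δ)) =
      fun _ v => v :=
    Ren.append_ext (fun X v => by rw [Ren.copair_inl]) (fun X v => by rw [Ren.copair_inr])
  rw [this, rename_id]

theorem generic {Γ Δ : List T.sig.Srt} (θ : Formula T.sig (Γ ++ Δ)) :
    Provable T θ (θ.rename (Ren.copair (fun _ v => v.inl Δ) fun _ v => v.inr Γ)) := by
  rw [rename_generic]; exact refl _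

theorem le_of_generic {Γ Δ : List T.sig.Srt} {θ θ' : Formula T.sig (Γ ++ Δ)}
    (h : Provable T θ (θ'.rename (Ren.copair (fun _ v => v.inl Δ) fun _ v => v.inr Γ))) :
    Provable T θ θ' := by
  rwa [rename_generic] at h

theorem isFunctional_id (B : SynCat T) : IsFunctional B B (idForm B) where
  dom := replace (eqs_iff.1 (and_right _ _)) (and_left _ _)
  cod := and_left _ _
  total := by
    have := exs_of (T := T) (χ := B.formula) (φ := idForm B) (r := fun _ v => v)
      (fun _ v => v) (idForm_at.2 ⟨by rw [rename_id]; exact refl _, fun X v => eq_rfl _ _⟩)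
    rwa [rename_id] at this
  single X v :=
    eq_trans ((idForm_at.1 (and_left _ _)).2 X v)
      (eq_symm ((idForm_at.1 (and_right _ _)).2 X v))

theorem isFunctional_comp {θ : Formula T.sig (C.ctx ++ B.ctx)}
    {θ' : Formula T.sig (D.ctx ++ C.ctx)} (h : IsFunctional B C θ) (h' : IsFunctional C D θ') :
    IsFunctional B D (compForm θ θ') where
  dom := comp_elim (generic _) fun χ' up h₁ h₂ => by
    have := h.dom_at h₁
    rwa [rename_rename]
  cod := comp_elim (generic _) fun χ' up h₁ h₂ => by
    have := h'.cod_at h₂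
    rwa [rename_rename]
  total := by
    have : Provable T B.formula ((exs D.ctx (compForm θ θ')).rename fun _ v => v) := by
      refine total_elim h (a := fun _ v => v) (by rw [rename_id]; exact refl _)
        fun χ' up h₁ => total_elim h' (a := fun _ v => v.inl B.ctx) (h.cod_at h₁)
        fun χ'' up' h₂ => ?_
      rw [rename_rename, rename_rename]
      refine exs_of (fun _ v => v.inl _) (comp_intro (fun _ v => (v.inl B.ctx).inr D.ctx) ?_ h₂)
      have := up' h₁
      rwa [rename_at] at this
    rwa [rename_id] at this
  single X v := by
    refine comp_elim (and_left _ _) fun χ' up h₁ h₂ => ?_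
    have h₀ := up (and_right _ _)
    rw [rename_at] at h₀
    refine comp_elim h₀ fun χ'' up' h₃ h₄ => ?_
    have h₁' := up' h₁
    have h₂' := up' h₂
    rw [rename_at] at h₁' h₂'
    exact h'.single_at h₂'
      (replace_at (fun _ _ => eq_rfl _ _) (fun X v => eq_symm (h.single_at h₁' h₃ X v)) h₄) X v

theorem IsFunctional.le_symm {θ θ' : Formula T.sig (C.ctx ++ B.ctx)} (h : IsFunctional B C θ)
    (h' : IsFunctional B C θ') (hle : Provable T θ θ') : Provable T θ' θ := by
  refine le_of_generic (total_elim h (h'.dom_at (generic _)) fun χ' up h₁ => ?_)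
  have h₂ := up (generic θ')
  rw [rename_at] at h₂ ⊢
  exact replace_at (h'.single_at (cut h₁ (subst _ hle)) h₂) (fun _ _ => eq_rfl _ _) h₁

theorem comp_mono {θ₁ θ₂ : Formula T.sig (C.ctx ++ B.ctx)} {θ₁' θ₂' : Formula T.sig (D.ctx ++ C.ctx)}
    (h : Provable T θ₁ θ₂) (h' : Provable T θ₁' θ₂') :
    Provable T (compForm θ₁ θ₁') (compForm θ₂ θ₂') :=
  exs_mono (and_mono (subst _ h) (subst _ h'))

theorem id_comp_le (θ : Formula T.sig (C.ctx ++ B.ctx)) :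
    Provable T (compForm (idForm B) θ) θ := by
  refine le_of_generic (comp_elim (generic _) fun χ' up h₁ h₂ => ?_)
  rw [rename_at]
  exact replace_at (fun _ _ => eq_rfl _ _) (idForm_at.1 h₁).2 h₂

theorem comp_id_le (θ : Formula T.sig (C.ctx ++ B.ctx)) :
    Provable T (compForm θ (idForm C)) θ := by
  refine le_of_generic (comp_elim (generic _) fun χ' up h₁ h₂ => ?_)
  rw [rename_at]
  exact replace_at (fun X v => eq_symm ((idForm_at.1 h₂).2 X v)) (fun _ _ => eq_rfl _ _) h₁

theorem comp_assoc_le (θ : Formula T.sig (C.ctx ++ B.ctx)) (θ' : Formula T.sig (D.ctx ++ C.ctx))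
    (θ'' : Formula T.sig (E.ctx ++ D.ctx)) :
    Provable T (compForm (compForm θ θ') θ'') (compForm θ (compForm θ' θ'')) := by
  refine le_of_generic (comp_elim (generic _) fun χ' up h₁ h₂ => comp_elim h₁
    fun χ'' up' h₃ h₄ => ?_)
  have h₂' := up' h₂
  rw [rename_at] at h₂'
  rw [rename_at, rename_at]
  exact comp_intro _ h₃ (comp_intro _ h₄ h₂')

end

/-- Morphisms: `T`-provable equivalence classes of `T`-provably functional formulae. -/
instance : Category.{u + 1} (SynCat T) where
  Hom B C := Quotient (funcSetoid B C)
  id B := ⟦⟨idForm B, isFunctional_id B⟩⟧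
  comp {B C D} f g := Quotient.map₂ (sa := funcSetoid B C) (sb := funcSetoid C D)
    (sc := funcSetoid B D)
    (fun θ θ' => (⟨compForm θ.1 θ'.1, isFunctional_comp θ.2 θ'.2⟩ : Func B D))
    (fun _ _ h _ _ h' => ⟨comp_mono h.1 h'.1, comp_mono h.2 h'.2⟩) f g
  id_comp {B C} f := by
    induction f using Quotient.inductionOn with | _ θ
    exact Quotient.sound ⟨id_comp_le _,
      (isFunctional_comp (isFunctional_id B) θ.2).le_symm θ.2 (id_comp_le _)⟩
  comp_id {B C} f := by
    induction f using Quotient.inductionOn with | _ θ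
    exact Quotient.sound ⟨comp_id_le _,
      (isFunctional_comp θ.2 (isFunctional_id C)).le_symm θ.2 (comp_id_le _)⟩
  assoc {B C D E} f g h := by
    induction f using Quotient.inductionOn with | _ θ
    induction g using Quotient.inductionOn with | _ θ'
    induction h using Quotient.inductionOn with | _ θ''
    exact Quotient.sound ⟨comp_assoc_le _ _ _,
      (isFunctional_comp (isFunctional_comp θ.2 θ'.2) θ''.2).le_symm
        (isFunctional_comp θ.2 (isFunctional_comp θ'.2 θ''.2)) (comp_assoc_le _ _ _)⟩

/-- The morphism represented by a functional formula. -/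
def Func.hom {B C : SynCat T} (θ : Func B C) : B ⟶ C :=
  Quotient.mk (funcSetoid B C) θ

theorem Func.hom_comp_eq {B C C' D : SynCat T} (θ : Func B C) (θ' : Func C D) (γ : Func B C')
    (γ' : Func C' D) (h : Provable T (compForm θ.1 θ'.1) (compForm γ.1 γ'.1)) :
    θ.hom ≫ θ'.hom = γ.hom ≫ γ'.hom :=
  Quotient.sound ⟨h, (isFunctional_comp θ.2 θ'.2).le_symm (isFunctional_comp γ.2 γ'.2) h⟩

/-- The formula `∃ x⃗, θ(y⃗, x⃗)`: the image of a functional relation. -/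
def image {B C : SynCat T} (θ : Func B C) : Formula T.sig C.ctx :=
  exs B.ctx (θ.1.rename (Ren.copair (fun _ v => v.inr B.ctx) (fun _ v => v.inl C.ctx)))

/-- The family of morphisms represented by the functional formulae `θ i` is covering:
the target is provably the union of the images. -/
def IsCovering {B : SynCat T} {I : Type u} {A : I → SynCat T} (θ : ∀ i, Func (A i) B) : Prop :=
  Provable T B.formula (sup I fun i => image (θ i))

section

variable {B C D E : SynCat T} {Ξ : List T.sig.Srt} {χ : Formula T.sig Ξ}

theorem image_intro {θ : Func B C} (a : Ren B.ctx Ξ) {b : Ren C.ctx Ξ}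
    (h : Provable T χ (θ.1.rename (Ren.copair b a))) : Provable T χ ((image θ).rename b) := by
  refine exs_of a ?_
  simp only [rename_rename, Ren.copair_comp, Ren.copair_inl, Ren.copair_inr]
  exact h

theorem image_elim {θ : Func B C} {b : Ren C.ctx Ξ} {ψ : Formula T.sig Ξ}
    (h : Provable T χ ((image θ).rename b))
    (h' : ∀ χ' : Formula T.sig (B.ctx ++ Ξ),
      (∀ {ξ : Formula T.sig Ξ}, Provable T χ ξ →
        Provable T χ' (ξ.rename fun _ v => v.inr B.ctx)) →
      Provable T χ' (θ.1.rename (Ren.copair (fun _ v => (b _ v).inr B.ctx) fun _ v => v.inl Ξ)) →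
      Provable T χ' (ψ.rename fun _ v => v.inr B.ctx)) : Provable T χ ψ := by
  refine of_exs h ?_
  simp only [rename_rename, Ren.copair_comp, Ren.copair_inl, Ren.copair_inr]
  exact h' _ (fun hξ => cut (and_left _ _) (subst _ hξ)) (and_right _ _)

theorem sup_cases {I : Type u} {φ : I → Formula T.sig Ξ} {ψ : Formula T.sig Ξ}
    (h : Provable T χ (sup I φ))
    (h' : ∀ (i : I) (χ' : Formula T.sig Ξ), Provable T χ' χ → Provable T χ' (φ i) →
      Provable T χ' ψ) : Provable T χ ψ :=
  cut (and_intro (refl _) h) (cut (distrib _ _)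
    (sup_elim fun i => h' i _ (and_left _ _) (and_right _ _)))

theorem IsCovering.cases {I : Type u} {A : I → SynCat T} {θ : ∀ i, Func (A i) B}
    (hθ : IsCovering θ) {b : Ren B.ctx Ξ} {ψ : Formula T.sig Ξ}
    (h : Provable T χ (B.formula.rename b))
    (h' : ∀ (i : I) (χ' : Formula T.sig ((A i).ctx ++ Ξ)),
      (∀ {ξ : Formula T.sig Ξ}, Provable T χ ξ →
        Provable T χ' (ξ.rename fun _ v => v.inr (A i).ctx)) →
      Provable T χ' ((θ i).1.rename
        (Ren.copair (fun _ v => (b _ v).inr (A i).ctx) fun _ v => v.inl Ξ)) →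
      Provable T χ' (ψ.rename fun _ v => v.inr (A i).ctx)) : Provable T χ ψ :=
  sup_cases (cut h (subst b hθ)) fun i _ h₁ h₂ => image_elim h₂ fun χ₂ up h₃ =>
    h' i χ₂ (fun hξ => up (cut h₁ hξ)) h₃

/-- The functional formula `φ(x⃗) ∧ y⃗ = r(x⃗)` given by a substitution `r`. -/
def substForm (B : SynCat T) {Γ : List T.sig.Srt} (r : Ren Γ B.ctx) :
    Formula T.sig (Γ ++ B.ctx) :=
  and (B.formula.rename fun _ v => v.inr Γ)
    (eqs (fun _ v => v.inl B.ctx) (fun _ v => (r _ v).inr Γ))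

theorem substForm_at {Γ : List T.sig.Srt} {r : Ren Γ B.ctx} {b : Ren Γ Ξ} {a : Ren B.ctx Ξ} :
    Provable T χ ((substForm B r).rename (Ren.copair b a)) ↔
      Provable T χ (B.formula.rename a) ∧
        ∀ X v, Provable T χ (eq (b X v) (a X (r X v))) := by
  have : (substForm B r).rename (Ren.copair b a) =
      and (B.formula.rename a) (eqs b fun X v => a X (r X v)) := by
    simp only [substForm, Formula.rename, rename_rename, rename_eqs, Ren.copair_inl,
      Ren.copair_inr]
  rw [this]
  exact ⟨fun h => ⟨cut h (and_left _ _), eqs_iff.1 (cut h (and_right _ _))⟩,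
    fun h => and_intro h.1 (eqs_iff.2 h.2)⟩

theorem isFunctional_subst (r : Ren C.ctx B.ctx)
    (h : Provable T B.formula (C.formula.rename r)) : IsFunctional B C (substForm B r) where
  dom := and_left _ _
  cod := by
    have h₁ := subst (T := T) (fun _ v => Var.inr C.ctx v) h
    rw [rename_rename] at h₁
    exact replace (fun X v => eq_symm (eqs_iff.1 (and_right _ _) X v)) (cut (and_left _ _) h₁)
  total := by
    have := exs_of (T := T) (χ := B.formula) (φ := substForm B r) (r := fun _ v => v) r
      (substForm_at.2 ⟨by rw [rename_id]; exact refl _, fun X v => eq_rfl _ _⟩)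
    rwa [rename_id] at this
  single X v :=
    eq_trans ((substForm_at.1 (and_left _ _)).2 X v)
      (eq_symm ((substForm_at.1 (and_right _ _)).2 X v))

/-- The fibre product of two functional formulae with the same target. -/
abbrev fibreProd (θ : Func C B) (γ : Func D B) : SynCat T where
  ctx := C.ctx ++ D.ctx
  formula := exs B.ctx (and
    (θ.1.rename (Ren.copair (fun _ v => v.inl _) fun _ v => (v.inl D.ctx).inr B.ctx))
    (γ.1.rename (Ren.copair (fun _ v => v.inl _) fun _ v => (v.inr C.ctx).inr B.ctx)))

theorem fibreProd_intro {θ : Func C B} {γ : Func D B} {c : Ren C.ctx Ξ} {d : Ren D.ctx Ξ}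
    (b : Ren B.ctx Ξ) (h : Provable T χ (θ.1.rename (Ren.copair b c)))
    (h' : Provable T χ (γ.1.rename (Ren.copair b d))) :
    Provable T χ ((fibreProd θ γ).formula.rename (Ren.copair c d)) := by
  refine exs_of b ?_
  simp only [Formula.rename, rename_rename, Ren.copair_comp, Ren.copair_inl, Ren.copair_inr]
  exact and_intro h h'

theorem fibreProd_elim {θ : Func C B} {γ : Func D B} {p : Ren (fibreProd θ γ).ctx Ξ}
    {ψ : Formula T.sig Ξ} (h : Provable T χ ((fibreProd θ γ).formula.rename p))
    (h' : ∀ χ' : Formula T.sig (B.ctx ++ Ξ),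
      (∀ {ξ : Formula T.sig Ξ}, Provable T χ ξ →
        Provable T χ' (ξ.rename fun _ v => v.inr B.ctx)) →
      Provable T χ' (θ.1.rename (Ren.copair (fun _ v => v.inl Ξ)
        fun _ v => (p _ (v.inl D.ctx)).inr B.ctx)) →
      Provable T χ' (γ.1.rename (Ren.copair (fun _ v => v.inl Ξ)
        fun _ v => (p _ (v.inr C.ctx)).inr B.ctx)) →
      Provable T χ' (ψ.rename fun _ v => v.inr B.ctx)) : Provable T χ ψ := by
  refine of_exs h ?_
  simp only [Formula.rename, rename_rename, Ren.copair_comp, Ren.copair_inl, Ren.copair_inr]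
  exact h' _ (fun hξ => cut (and_left _ _) (subst _ hξ))
    (cut (and_right _ _) (and_left _ _)) (cut (and_right _ _) (and_right _ _))

theorem fibreProd_fst (θ : Func C B) (γ : Func D B) :
    Provable T (fibreProd θ γ).formula (C.formula.rename fun _ v => v.inl D.ctx) :=
  fibreProd_elim (p := fun _ v => v) (by rw [rename_id]; exact refl _) fun χ' up h₁ h₂ => by
    have := θ.2.dom_at h₁
    rwa [rename_rename]

theorem fibreProd_snd (θ : Func C B) (γ : Func D B) :
    Provable T (fibreProd θ γ).formula (D.formula.rename fun _ v => v.inr C.ctx) :=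
  fibreProd_elim (p := fun _ v => v) (by rw [rename_id]; exact refl _) fun χ' up h₁ h₂ => by
    have := γ.2.dom_at h₂
    rwa [rename_rename]

theorem fibreProd_comm (θ : Func C B) (γ : Func D B) :
    Provable T (compForm (C := D) (substForm (fibreProd θ γ) fun _ v => v.inr C.ctx) γ.1)
      (compForm (C := C) (substForm (fibreProd θ γ) fun _ v => v.inl D.ctx) θ.1) := by
  refine le_of_generic (comp_elim (generic _) fun χ' up h₁ h₂ => ?_)
  rw [rename_at]
  have h₃ := substForm_at.1 h₁
  refine fibreProd_elim h₃.1 fun χ'' up' h₄ h₅ => ?_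
  rw [rename_at]
  have h₂' := up' h₂
  rw [rename_at] at h₂'
  have h₆ := up' h₃.1
  rw [rename_rename] at h₆
  have h₇ := replace_at (fun _ _ => eq_rfl _ _) (fun X v => up' (h₃.2 X v)) h₂'
  have h₈ := γ.2.single_at h₅ h₇
  exact comp_intro _ (substForm_at.2 ⟨h₆, fun _ _ => eq_rfl _ _⟩)
    (replace_at h₈ (fun _ _ => eq_rfl _ _) h₄)

end

/-- The syntactic topology: a sieve is covering if it contains a small covering family. -/
def topology (T : Theory.{u}) : GrothendieckTopology (SynCat T) where
  sieves B := {S | ∃ (I : Type u) (A : I → SynCat T) (θ : ∀ i, Func (A i) B),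
    (∀ i, S (θ i).hom) ∧ IsCovering θ}
  top_mem' B := by
    refine ⟨PUnit, fun _ => B, fun _ => ⟨idForm B, isFunctional_id B⟩, fun _ => trivial, ?_⟩
    refine cut ?_ (sup_intro _ PUnit.unit)
    rw [← rename_id (image _)]
    exact image_intro (fun _ v => v)
      (idForm_at.2 ⟨by rw [rename_id]; exact refl _, fun _ _ => eq_rfl _ _⟩)
  pullback_stable' B D S g := by
    rintro ⟨I, A, θ, hS, hθ⟩
    induction g using Quotient.inductionOn with | _ γ
    refine ⟨I, fun i => fibreProd (θ i) γ,
      fun i => ⟨_, isFunctional_subst _ (fibreProd_snd (θ i) γ)⟩, fun i => ?_, ?_⟩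
    · have e := Func.hom_comp_eq ⟨_, isFunctional_subst _ (fibreProd_snd (θ i) γ)⟩ γ
        ⟨_, isFunctional_subst _ (fibreProd_fst (θ i) γ)⟩ (θ i) (fibreProd_comm _ _)
      change S.arrows (_ ≫ γ.hom)
      rw [e]
      exact S.downward_closed (hS i) _
    · refine total_elim γ.2 (a := fun _ v => v) (by rw [rename_id]; exact refl _)
        fun χ' up h₁ => hθ.cases (γ.2.cod_at h₁) fun i χ'' up' h₂ => ?_
      have h₃ := up' h₁
      rw [rename_at] at h₃
      rw [rename_rename]
      refine cut ?_ (subst _ (sup_intro _ i))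
      have h₄ := fibreProd_intro _ h₂ h₃
      refine image_intro _ (substForm_at.2 ⟨h₄, fun X v => ?_⟩)
      rw [Ren.copair_inr]
      exact eq_rfl _ _
  transitive' := by
    rintro B S ⟨I, A, θ, hS, hθ⟩ R hR
    choose J A' θ' hS' hθ' using fun i => hR (hS i)
    refine ⟨Σ i, J i, fun k => A' k.1 k.2,
      fun k => ⟨_, isFunctional_comp (θ' k.1 k.2).2 (θ k.1).2⟩, fun k => hS' k.1 k.2, ?_⟩
    refine hθ.cases (b := fun _ v => v) (by rw [rename_id]; exact refl _)
      fun i χ' up h₁ => (hθ' i).cases ((θ i).2.dom_at h₁) fun j χ'' up' h₂ => ?_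
    have h₃ := up' h₁
    rw [rename_at] at h₃
    rw [rename_rename]
    refine cut ?_ (subst _ (sup_intro _ (⟨i, j⟩ : Σ i, J i)))
    exact image_intro _ (comp_intro _ h₂ h₃)

end SynCat

/-! ### Frames and locales -/

/-- The free frame on a set of generators: the down-sets of the free meet-semilattice
(finite sets of generators, ordered by reverse inclusion). -/
abbrev FreeFrame (G : Type u) : Type u := LowerSet (Finset G)ᵒᵈ

namespace FreeFrame

variable {G : Type u} {L : Type v} [Order.Frame L]

/-- The generators of the free frame. -/
def of (g : G) : FreeFrame G := LowerSet.Iic (OrderDual.toDual {g})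

/-- The extension of a map on generators to a frame homomorphism. -/
def lift (v : G → L) : FrameHom (FreeFrame G) L where
  toFun U := ⨆ s ∈ U, (OrderDual.ofDual s).inf v
  map_inf' U V := by
    classical
    refine le_antisymm (le_inf ?_ ?_) ?_
    · exact iSup₂_le fun s hs => le_iSup₂_of_le s hs.1 le_rfl
    · exact iSup₂_le fun s hs => le_iSup₂_of_le s hs.2 le_rfl
    · simp only [iSup_inf_eq, inf_iSup_eq]
      refine iSup₂_le fun s hs => iSup₂_le fun t ht => ?_
      refine le_iSup₂_of_le (OrderDual.toDual (OrderDual.ofDual s ∪ OrderDual.ofDual t)) ?_ ?_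
      · exact ⟨U.lower (show OrderDual.toDual _ ≤ t from Finset.subset_union_right) ht,
          V.lower (show OrderDual.toDual _ ≤ s from Finset.subset_union_left) hs⟩
      · simp [Finset.inf_union, inf_comm]
  map_top' := top_le_iff.1 (le_iSup₂_of_le (OrderDual.toDual ∅) trivial (by simp))
  map_sSup' S := by
    simp only [LowerSet.mem_sSup_iff, sSup_image]
    refine le_antisymm ?_ ?_
    · refine iSup₂_le fun s hs => ?_
      obtain ⟨U, hU, hs⟩ := hs
      exact le_iSup₂_of_le U hU (le_iSup₂_of_le s hs le_rfl)
    · exact iSup₂_le fun U hU => iSup₂_le fun s hs => le_iSup₂_of_le s ⟨U, hU, hs⟩ le_rfl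

theorem lift_of (v : G → L) (g : G) : lift v (of g) = v g := by
  refine le_antisymm (iSup₂_le fun s hs => ?_) ?_
  · exact Finset.inf_le (Finset.singleton_subset_iff.1 (show {g} ⊆ OrderDual.ofDual s from hs))
  · exact le_iSup₂_of_le (OrderDual.toDual {g}) (LowerSet.mem_Iic_iff.2 le_rfl) (by simp)

end FreeFrame

/-- A propositional geometric theory: basic propositions and axioms `a ⊢ b`, where `a` and `b`
are (equivalence classes of) propositional geometric formulae. -/
structure PropTheory where
  Atom : Type u
  ax : FreeFrame Atom → FreeFrame Atom → Prop

namespace PropTheory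

variable (P : PropTheory.{u})

/-- The quotient of the free frame by the relations `a ≤ b` for the axioms `a ⊢ b`, as the
sublocale of those `x` for which `b ≤ x` always (stably) implies `a ≤ x`. -/
def sublocale : Sublocale (FreeFrame P.Atom) where
  carrier := {x | ∀ a b, P.ax a b → b ⇨ x ≤ a ⇨ x}
  sInf_mem' s hs a b h := by
    rw [le_himp_iff]
    refine le_sInf fun x hx => ?_
    rw [← le_himp_iff]
    exact (himp_le_himp_left (sInf_le hx)).trans (hs hx a b h)
  himp_mem' c x hx a b h := by
    rw [himp_left_comm b, himp_left_comm a]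
    exact himp_le_himp_left (hx a b h)

/-- The frame presented by a propositional geometric theory. -/
abbrev Opens : Type u := P.sublocale

/-- The quotient map from the free frame. -/
def proj : FrameHom (FreeFrame P.Atom) P.Opens := P.sublocale.restrict

/-- The generators. -/
def gen (g : P.Atom) : P.Opens := P.proj (FreeFrame.of g)

variable {P}

theorem proj_le_iff {a : FreeFrame P.Atom} {x : P.Opens} : P.proj a ≤ x ↔ a ≤ x.1 :=
  P.sublocale.giRestrict.gc a x

theorem proj_val (x : P.Opens) : P.proj x.1 = x :=
  P.sublocale.giRestrict.l_u_eq x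

theorem proj_le_proj {a b : FreeFrame P.Atom} (h : P.ax a b) : P.proj a ≤ P.proj b := by
  rw [proj_le_iff]
  have h₁ : b ≤ (P.proj b).1 := proj_le_iff.1 le_rfl
  have h₂ := (P.proj b).2 a b h
  rw [himp_eq_top_iff.2 h₁, top_le_iff, himp_eq_top_iff] at h₂
  exact h₂

theorem freeLift_proj {L : Type v} [Order.Frame L] (v : P.Atom → L)
    (hv : ∀ a b, P.ax a b → FreeFrame.lift v a ≤ FreeFrame.lift v b) (a : FreeFrame P.Atom) :
    FreeFrame.lift v (P.proj a).1 = FreeFrame.lift v a := by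
  refine le_antisymm ?_ (OrderHomClass.mono _ (proj_le_iff.1 le_rfl))
  have h₁ : FreeFrame.lift v (sSup {c | FreeFrame.lift v c ≤ FreeFrame.lift v a}) ≤
      FreeFrame.lift v a := by
    rw [map_sSup]
    exact sSup_le (by rintro _ ⟨c, hc, rfl⟩; exact hc)
  have hmem : sSup {c | FreeFrame.lift v c ≤ FreeFrame.lift v a} ∈ P.sublocale := by
    intro b c h
    rw [le_himp_iff]
    refine le_sSup (le_trans ?_ h₁)
    calc _ ≤ FreeFrame.lift v ((c ⇨ _) ⊓ c) := by
          rw [map_inf, map_inf]; exact inf_le_inf_left _ (hv b c h)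
      _ ≤ _ := OrderHomClass.mono _ himp_inf_le
  have h₂ : P.proj a ≤ (⟨_, hmem⟩ : P.sublocale) := proj_le_iff.2 (le_sSup le_rfl)
  exact (OrderHomClass.mono (FreeFrame.lift v) (show (P.proj a).1 ≤ _ from h₂)).trans h₁

/-- The universal property of the presentation: a valuation of the basic propositions that
satisfies the axioms extends to a frame homomorphism. -/
def lift {L : Type v} [Order.Frame L] (v : P.Atom → L)
    (hv : ∀ a b, P.ax a b → FreeFrame.lift v a ≤ FreeFrame.lift v b) : FrameHom P.Opens L where
  toFun x := FreeFrame.lift v x.1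
  map_inf' x y := map_inf (FreeFrame.lift v) x.1 y.1
  map_top' := map_top (FreeFrame.lift v)
  map_sSup' s := by
    have : sSup s = P.proj (sSup (Subtype.val '' s)) := by
      rw [map_sSup, Set.image_image]
      simp only [proj_val, Set.image_id']
    rw [this, freeLift_proj v hv, map_sSup, Set.image_image]

theorem lift_gen {L : Type v} [Order.Frame L] (v : P.Atom → L)
    (hv : ∀ a b, P.ax a b → FreeFrame.lift v a ≤ FreeFrame.lift v b) (g : P.Atom) : lift v hv (P.gen g) = v g :=
  (freeLift_proj v hv _).trans (FreeFrame.lift_of v g)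

end PropTheory

/-! ### The propositional theory of presentations of models as subquotients of `ℕ` -/

/-- The basic propositions `[n ∼^X m]` and `[(n₁, …, n_k) ∈ R]`. -/
inductive Gen (A : Signature.{u}) : Type u
  | eq (X : A.Srt) (n m : ℕ) : Gen A
  | rel (R : A.Rel) (n : Fin (A.arity R) → ℕ) : Gen A

/-- Assignments of natural numbers to the variables of a context. -/
abbrev Env {S : Type u} (Γ : List S) : Type u := ∀ X : S, Var Γ X → ℕ

namespace Env

variable {S : Type u}

/-- The only assignment on the empty context. -/
def nil : Env ([] : List S) := fun _ v => nomatch v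

/-- Extension of an assignment. -/
def cons {Γ : List S} {X : S} (n : ℕ) (e : Env Γ) : Env (X :: Γ)
  | _, .zero => n
  | _, .succ v => e _ v

/-- The assignment obtained by applying a function to all sorts. -/
def map {S' : Type u} (f : S → S') : {Γ : List S} → Env Γ → Env (Γ.map f)
  | [], _ => nil
  | _ :: _, e => cons (e _ .zero) (map f fun _ v => e _ (.succ v))

theorem map_map {S' : Type u} (f : S → S') {Γ : List S} (e : Env Γ) {X : S} (v : Var Γ X) :
    map f e (f X) (v.map f) = e X v := by
  induction v with
  | zero => rfl
  | succ v ih => exact ih _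

end Env

section eval

variable {A : Signature.{u}} {L : Type v} [Order.Frame L]

/-- The interpretation of a formula, with natural numbers for its free variables, under a valuation
of the basic propositions. Quantifiers range over those `n` with `[n ∼ n]`. -/
def Formula.eval (I : Gen A → L) : {Γ : List A.Srt} → Formula A Γ → Env Γ → L
  | _, .top, _ => ⊤
  | _, .and φ ψ, e => φ.eval I e ⊓ ψ.eval I e
  | _, .sup _ φ, e => ⨆ i, (φ i).eval I e
  | _, .eq (X := X) x y, e => I (.eq X (e X x) (e X y))
  | _, .rel R x, e => I (.rel R fun i => e _ (x i))
  | _, .ex X φ, e => ⨆ n : ℕ, I (.eq X n n) ⊓ φ.eval I (e.cons n)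

/-- The finite meet of the `[n_x ∼ n_x]`, for `x` running over the variables of a context. -/
def Env.exist (I : Gen A → L) : {Γ : List A.Srt} → Env Γ → L
  | [], _ => ⊤
  | X :: _, e => I (.eq X (e X .zero) (e X .zero)) ⊓ exist I fun _ v => e _ (.succ v)

theorem Formula.map_eval {M : Type v} [Order.Frame M] (h : FrameHom L M) (I : Gen A → L)
    {Γ : List A.Srt} (φ : Formula A Γ) (e : Env Γ) :
    h (φ.eval I e) = φ.eval (fun g => h (I g)) e := by
  induction φ with
  | top => exact map_top h
  | and φ ψ h₁ h₂ => simp only [eval, map_inf, h₁, h₂]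
  | sup ι φ ih => simp only [eval, map_iSup, ih]
  | eq x y => rfl
  | rel R x => rfl
  | ex X φ ih => simp only [eval, map_iSup, map_inf, ih]

theorem Env.map_exist {M : Type v} [Order.Frame M] (h : FrameHom L M) (I : Gen A → L)
    {Γ : List A.Srt} (e : Env Γ) : h (e.exist I) = e.exist fun g => h (I g) := by
  induction Γ with
  | nil => exact map_top h
  | cons X Γ ih => simp only [exist, map_inf, ih]

end eval

/-- The axioms of `P[T]`. -/
inductive PAx (T : Theory.{u}) : FreeFrame (Gen T.sig) → FreeFrame (Gen T.sig) → Prop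
  | symm (X : T.sig.Srt) (n m : ℕ) :
      PAx T (FreeFrame.of (.eq X n m)) (FreeFrame.of (.eq X m n))
  | trans (X : T.sig.Srt) (n m l : ℕ) :
      PAx T (FreeFrame.of (.eq X n m) ⊓ FreeFrame.of (.eq X m l)) (FreeFrame.of (.eq X n l))
  | rel_congr (R : T.sig.Rel) (n m : Fin (T.sig.arity R) → ℕ) :
      PAx T (FreeFrame.of (.rel R n) ⊓
          Finset.univ.inf fun i => FreeFrame.of (.eq (T.sig.dom R i) (n i) (m i)))
        (FreeFrame.of (.rel R m))
  | rel_exist (R : T.sig.Rel) (n : Fin (T.sig.arity R) → ℕ) :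
      PAx T (FreeFrame.of (.rel R n))
        (Finset.univ.inf fun i => FreeFrame.of (.eq (T.sig.dom R i) (n i) (n i)))
  | axm {σ : Sequent T.sig} (h : σ ∈ T.axioms) (e : Env σ.ctx) :
      PAx T (e.exist FreeFrame.of ⊓ σ.lhs.eval FreeFrame.of e) (σ.rhs.eval FreeFrame.of e)

/-- The propositional geometric theory `P[T]`. -/
abbrev P (T : Theory.{u}) : PropTheory.{u} where
  Atom := Gen T.sig
  ax := PAx T

/-! ### The theory of isomorphisms -/

/-- Two copies (`false` and `true`, for the first and the second one) of a signature, together with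
relation symbols `α^X ⊆ X₁ × X₂`. -/
abbrev isoSig (A : Signature.{u}) : Signature.{u} where
  Srt := A.Srt × Bool
  Rel := (A.Rel × Bool) ⊕ A.Srt
  arity
    | .inl R => A.arity R.1
    | .inr _ => 2
  dom
    | .inl R => fun i => (A.dom R.1 i, R.2)
    | .inr X => ![(X, false), (X, true)]

section iso

variable {A : Signature.{u}}

/-- The `b`-th copy of a formula. -/
def Formula.copy (b : Bool) : {Γ : List A.Srt} → Formula A Γ →
    Formula (isoSig A) (Γ.map fun X => (X, b))
  | _, .top => .top
  | _, .and φ ψ => .and (φ.copy b) (ψ.copy b)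
  | _, .sup ι φ => .sup ι fun i => (φ i).copy b
  | _, .eq x y => .eq (x.map fun X => (X, b)) (y.map fun X => (X, b))
  | _, .rel R x => .rel (A := isoSig A) (.inl (R, b)) fun i => (x i).map fun X => (X, b)
  | _, .ex X φ => .ex (A := isoSig A) (X, b) (φ.copy b)

/-- The `b`-th copy of a sequent. -/
def Sequent.copy (b : Bool) (σ : Sequent A) : Sequent (isoSig A) where
  ctx := σ.ctx.map fun X => (X, b)
  lhs := σ.lhs.copy b
  rhs := σ.rhs.copy b

/-- The `b`-th copy of a basic proposition. -/
def Gen.copy (b : Bool) : Gen A → Gen (isoSig A)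
  | .eq X n m => .eq (A := isoSig A) (X, b) n m
  | .rel R n => .rel (A := isoSig A) (.inl (R, b)) n

/-- The atomic formula `(x, y) ∈ α^X`. -/
def alpha {Γ : List (isoSig A).Srt} {X : A.Srt} (x : Var Γ (X, false)) (y : Var Γ (X, true)) :
    Formula (isoSig A) Γ :=
  .rel (A := isoSig A) (.inr X) fun
    | (0 : Fin 2) => x
    | (1 : Fin 2) => y

/-- The context `x₁ : d 0, …, x_k : d (k - 1)`. -/
def ctxOf {S : Type u} : {k : ℕ} → (Fin k → S) → List S
  | 0, _ => []
  | _ + 1, d => d 0 :: ctxOf fun i => d i.succ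

/-- The `i`-th variable of the context `ctxOf d`. -/
def varOf {S : Type u} : {k : ℕ} → (d : Fin k → S) → (i : Fin k) → Var (ctxOf d) (d i)
  | _ + 1, d, i => Fin.cases (motive := fun i => Var (ctxOf d) (d i)) .zero
      (fun j => .succ (varOf (fun i => d i.succ) j)) i

/-- The context `x₁, …, x_k, y₁, …, y_k` with `x_i : X^i₁` and `y_i : X^i₂`, where
`R ⊆ X¹ × ⋯ × X^k`. -/
def relCtx (R : A.Rel) : List (isoSig A).Srt :=
  ctxOf (fun i => (A.dom R i, false)) ++ ctxOf fun i => (A.dom R i, true)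

/-- The variable `x_i` of `relCtx R`. -/
def relX (R : A.Rel) (i : Fin (A.arity R)) : Var (relCtx R) (A.dom R i, false) :=
  (varOf (fun i => (A.dom R i, false)) i).inl _

/-- The variable `y_i` of `relCtx R`. -/
def relY (R : A.Rel) (i : Fin (A.arity R)) : Var (relCtx R) (A.dom R i, true) :=
  (varOf (fun i => (A.dom R i, true)) i).inr _

/-- `⋀ᵢ (x_i, y_i) ∈ α ∧ (x₁, …, x_k) ∈ R₁`. -/
def relForm₁ (R : A.Rel) : Formula (isoSig A) (relCtx R) :=
  .and (.conj fun i => alpha (relX R i) (relY R i)) (.rel (A := isoSig A) (.inl (R, false)) (relX R))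

/-- `⋀ᵢ (x_i, y_i) ∈ α ∧ (y₁, …, y_k) ∈ R₂`. -/
def relForm₂ (R : A.Rel) : Formula (isoSig A) (relCtx R) :=
  .and (.conj fun i => alpha (relX R i) (relY R i)) (.rel (A := isoSig A) (.inl (R, true)) (relY R))

/-- The context `x, x' : X₁, y, y' : X₂`. -/
abbrev bijCtx (X : A.Srt) : List (isoSig A).Srt := [(X, false), (X, false), (X, true), (X, true)]

/-- `(x, y) ∈ α ∧ (x', y') ∈ α ∧ x = x'`. -/
def bijForm₁ (X : A.Srt) : Formula (isoSig A) (bijCtx X) :=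
  .and (alpha .zero (.succ (.succ .zero))) (.and (alpha (.succ .zero) (.succ (.succ (.succ .zero))))
    (.eq .zero (.succ .zero)))

/-- `(x, y) ∈ α ∧ (x', y') ∈ α ∧ y = y'`. -/
def bijForm₂ (X : A.Srt) : Formula (isoSig A) (bijCtx X) :=
  .and (alpha .zero (.succ (.succ .zero))) (.and (alpha (.succ .zero) (.succ (.succ (.succ .zero))))
    (.eq (.succ (.succ .zero)) (.succ (.succ (.succ .zero)))))

end iso

/-- The axioms of the theory of isomorphisms of models of `T`. -/
inductive IsoAx (T : Theory.{u}) : Sequent (isoSig T.sig) → Prop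
  | copy (b : Bool) {σ : Sequent T.sig} (h : σ ∈ T.axioms) : IsoAx T (σ.copy b)
  | bij₁ (X : T.sig.Srt) : IsoAx T ⟨bijCtx X, bijForm₁ X, bijForm₂ X⟩
  | bij₂ (X : T.sig.Srt) : IsoAx T ⟨bijCtx X, bijForm₂ X, bijForm₁ X⟩
  | surj (X : T.sig.Srt) : IsoAx T ⟨[(X, true)], .top,
      .ex (A := isoSig T.sig) (X, false) (alpha .zero (.succ .zero))⟩
  | total (X : T.sig.Srt) : IsoAx T ⟨[(X, false)], .top,
      .ex (A := isoSig T.sig) (X, true) (alpha (.succ .zero) .zero)⟩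
  | rel₁ (R : T.sig.Rel) : IsoAx T ⟨relCtx R, relForm₁ R, relForm₂ R⟩
  | rel₂ (R : T.sig.Rel) : IsoAx T ⟨relCtx R, relForm₂ R, relForm₁ R⟩

/-- The theory `T_≅` of isomorphisms of models of `T`. -/
abbrev isoTheory (T : Theory.{u}) : Theory.{u} where
  sig := isoSig T.sig
  axioms := {σ | IsoAx T σ}

theorem Formula.eval_copy {A : Signature.{u}} {L : Type v} [Order.Frame L]
    (I : Gen (isoSig A) → L) (b : Bool) {Γ : List A.Srt} (φ : Formula A Γ)
    (e : Env (Γ.map fun X => (X, b))) :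
    (φ.copy b).eval I e = φ.eval (fun g => I (g.copy b)) fun X v => e (X, b) (v.map _) := by
  induction φ with
  | top => rfl
  | and φ ψ h₁ h₂ => simp only [copy, eval, h₁, h₂]
  | sup ι φ ih => simp only [copy, eval, ih]
  | eq x y => rfl
  | rel R x => rfl
  | ex X φ ih =>
    simp only [copy, eval]
    refine iSup_congr fun n => congrArg₂ _ rfl ((ih _).trans (congrArg _ ?_))
    funext Y v
    cases v <;> rfl

theorem Env.exist_copy {A : Signature.{u}} {L : Type v} [Order.Frame L]
    (I : Gen (isoSig A) → L) (b : Bool) {Γ : List A.Srt} (e : Env (Γ.map fun X => (X, b))) :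
    Env.exist I e = Env.exist (fun g => I (g.copy b)) fun X v => e (X, b) (v.map _) := by
  induction Γ with
  | nil => rfl
  | cons X Γ ih => exact congrArg₂ _ rfl (ih _)

/-- The frame homomorphism `O(G₀) → O(G₁)` which sends each basic proposition to its `b`-th copy. -/
def copyHom (T : Theory.{u}) (b : Bool) : FrameHom (P T).Opens (P (isoTheory T)).Opens :=
  PropTheory.lift (fun g : Gen T.sig => (P (isoTheory T)).gen (g.copy b)) (by
    intro x y h
    have key : ∀ {x y : FreeFrame (Gen (isoSig T.sig))}, PAx (isoTheory T) x y →
        (P (isoTheory T)).proj x ≤ (P (isoTheory T)).proj y := fun h => PropTheory.proj_le_proj h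
    cases h with
    | symm X n m =>
      simp only [FreeFrame.lift_of]
      exact key (.symm (T := isoTheory T) (X, b) n m)
    | trans X n m l =>
      simp only [map_inf, FreeFrame.lift_of]
      have := key (.trans (T := isoTheory T) (X, b) n m l)
      rwa [map_inf] at this
    | rel_congr R n m =>
      simp only [map_inf, map_finset_inf, Function.comp_def, FreeFrame.lift_of]
      have := key (.rel_congr (T := isoTheory T) (.inl (R, b)) n m)
      rwa [map_inf, map_finset_inf] at this
    | rel_exist R n =>
      simp only [map_finset_inf, Function.comp_def, FreeFrame.lift_of]
      have := key (.rel_exist (T := isoTheory T) (.inl (R, b)) n)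
      rwa [map_finset_inf] at this
    | @axm σ hσ e =>
      have : (P (isoTheory T)).proj
          (Env.exist (A := isoSig T.sig) FreeFrame.of (e.map fun X => (X, b)) ⊓
            (σ.lhs.copy b).eval FreeFrame.of (e.map fun X => (X, b))) ≤
          (P (isoTheory T)).proj ((σ.rhs.copy b).eval FreeFrame.of (e.map fun X => (X, b))) :=
        key (.axm (T := isoTheory T) (.copy b hσ) (e.map fun X => (X, b)))
      rw [map_inf] at this ⊢
      have hp : ∀ {Γ : List (isoSig T.sig).Srt} (φ : Formula (isoSig T.sig) Γ) (e : Env Γ),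
          (P (isoTheory T)).proj (φ.eval FreeFrame.of e) = φ.eval (P (isoTheory T)).gen e :=
        fun φ e => Formula.map_eval (P (isoTheory T)).proj FreeFrame.of φ e
      have hq : ∀ {Γ : List (isoSig T.sig).Srt} (e : Env Γ),
          (P (isoTheory T)).proj (e.exist FreeFrame.of) = e.exist (P (isoTheory T)).gen :=
        fun e => Env.map_exist (P (isoTheory T)).proj FreeFrame.of e
      rw [hp, hp, hq] at this
      simp only [Formula.eval_copy, Env.exist_copy, Env.map_map] at this
      simpa only [Formula.map_eval, Env.map_exist, FreeFrame.lift_of] using this)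

theorem copyHom_gen (T : Theory.{u}) (b : Bool) (g : Gen T.sig) :
    copyHom T b ((P T).gen g) = (P (isoTheory T)).gen (g.copy b) :=
  PropTheory.lift_gen _ _ _

/-! ### The category of locales -/

/-- The locale morphism given by a frame homomorphism in the opposite direction. -/
def locHom {L M : Type u} [Order.Frame L] [Order.Frame M] (f : FrameHom L M) :
    Locale.of M ⟶ Locale.of L :=
  (Frm.ofHom f).op

/-- The frame homomorphism `f^*` of a locale morphism `f`. -/
def frameMap {X Y : Locale.{u}} (f : X ⟶ Y) : FrameHom Y X :=
  Frm.Hom.hom (Quiver.Hom.unop f)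

/-- The locale `G₀`, classifying `P[T]`. -/
abbrev G₀ (T : Theory.{u}) : Locale.{u} := Locale.of (P T).Opens

/-- The locale `G₁`, classifying `P[T_≅]`. -/
abbrev G₁ (T : Theory.{u}) : Locale.{u} := Locale.of (P (isoTheory T)).Opens

/-- The source map `s`. -/
def source (T : Theory.{u}) : G₁ T ⟶ G₀ T := locHom (copyHom T false)

/-- The target map `t`. -/
def target (T : Theory.{u}) : G₁ T ⟶ G₀ T := locHom (copyHom T true)

/-- The equaliser of two frame homomorphisms. -/
@[ext]
structure EqFrame {L M : Type u} [Order.Frame L] [Order.Frame M] (f g : FrameHom L M) where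
  val : L
  property : f val = g val

namespace EqFrame

variable {L M : Type u} [Order.Frame L] [Order.Frame M] (f g : FrameHom L M)

instance : PartialOrder (EqFrame f g) := PartialOrder.lift EqFrame.val fun _ _ => EqFrame.ext

instance : SupSet (EqFrame f g) where
  sSup s := ⟨sSup (EqFrame.val '' s), by
    rw [map_sSup, map_sSup, Set.image_image, Set.image_image]
    exact congrArg sSup (Set.image_congr fun x _ => x.property)⟩

instance : CompleteLattice (EqFrame f g) where
  __ := completeLatticeOfSup (EqFrame f g) fun s =>
    ⟨fun x hx => show x.1 ≤ sSup (EqFrame.val '' s) from le_sSup ⟨x, hx, rfl⟩,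
      fun y hy => show sSup (EqFrame.val '' s) ≤ y.1 from
        sSup_le (by rintro _ ⟨x, hx, rfl⟩; exact hy hx)⟩
  inf x y := ⟨x.1 ⊓ y.1, by rw [map_inf, map_inf, x.property, y.property]⟩
  inf_le_left x y := show x.1 ⊓ y.1 ≤ x.1 from inf_le_left
  inf_le_right x y := show x.1 ⊓ y.1 ≤ y.1 from inf_le_right
  le_inf x y z h h' := show x.1 ≤ y.1 ⊓ z.1 from le_inf h h'
  top := ⟨⊤, by rw [map_top, map_top]⟩
  le_top x := show x.1 ≤ ⊤ from le_top

instance : Order.Frame (EqFrame f g) :=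
  .ofMinimalAxioms
    { inf_sSup_le_iSup_inf := fun x s => by
        change x.1 ⊓ sSup (EqFrame.val '' s) ≤ (⨆ y ∈ s, x ⊓ y).1
        rw [inf_sSup_eq]
        refine iSup₂_le ?_
        rintro _ ⟨y, hy, rfl⟩
        exact show x ⊓ y ≤ ⨆ y ∈ s, x ⊓ y from le_iSup₂_of_le y hy le_rfl }

/-- The inclusion of the equaliser. -/
def incl : FrameHom (EqFrame f g) L where
  toFun := EqFrame.val
  map_inf' _ _ := rfl
  map_top' := rfl
  map_sSup' _ := rfl

/-- The universal property of the equaliser. -/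
def lift {K : Type u} [Order.Frame K] (k : FrameHom K L) (h : ∀ x, f (k x) = g (k x)) :
    FrameHom K (EqFrame f g) where
  toFun x := ⟨k x, h x⟩
  map_inf' x y := EqFrame.ext (map_inf k x y)
  map_top' := EqFrame.ext (map_top k)
  map_sSup' s := EqFrame.ext (by
    change k (sSup s) = sSup (EqFrame.val '' _)
    rw [map_sSup, Set.image_image])

end EqFrame

instance (T : Theory.{u}) : Limits.HasCoequalizer (source T) (target T) :=
  have w : source T ≫ locHom (EqFrame.incl (copyHom T false) (copyHom T true)) =
      target T ≫ locHom (EqFrame.incl (copyHom T false) (copyHom T true)) :=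
    Quiver.Hom.unop_inj (ConcreteCategory.hom_ext _ _ fun x => x.property)
  ⟨⟨⟨Limits.Cofork.ofπ _ w, Limits.Cofork.IsColimit.mk' _ fun c =>
    ⟨(Frm.ofHom (EqFrame.lift (copyHom T false) (copyHom T true) (frameMap c.π) fun x =>
        congrArg (fun f => frameMap f x) c.condition)).op, Quiver.Hom.unop_inj rfl, fun hm =>
      Quiver.Hom.unop_inj (ConcreteCategory.hom_ext _ _ fun x => EqFrame.ext
        (congrArg (fun f => frameMap f x) hm))⟩⟩⟩⟩

/-- The locale of isomorphism classes: the coequaliser of `s` and `t`. -/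
noncomputable def π₀ (T : Theory.{u}) : Locale.{u} := Limits.coequalizer (source T) (target T)

/-- The quotient map `G₀ ⟶ π₀`. -/
noncomputable def quot (T : Theory.{u}) : G₀ T ⟶ π₀ T :=
  Limits.coequalizer.π (source T) (target T)

/-- The candidate `s_! u = ⋀ {v | u ≤ s^* v}` for a left adjoint of `s^*`. -/
def sShriek (T : Theory.{u}) (u : G₁ T) : G₀ T := sInf {v : G₀ T | u ≤ frameMap (source T) v}

/-! ### Toposes -/

/-- The canonical topology on a frame: a sieve on `U` is covering if `U` is the join of its
members. -/
def frameTopology (L : Type u) [Order.Frame L] : GrothendieckTopology L where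
  sieves U := {S | U ≤ sSup {V | ∃ f : V ⟶ U, S f}}
  top_mem' U := le_sSup ⟨𝟙 U, trivial⟩
  pullback_stable' U V S f hS := by
    have h : V ≤ V ⊓ sSup {W | ∃ f : W ⟶ U, S f} := le_inf le_rfl (f.le.trans hS)
    refine h.trans ?_
    rw [inf_sSup_eq]
    refine iSup₂_le ?_
    rintro W ⟨g, hg⟩
    refine le_sSup ⟨homOfLE inf_le_left, ?_⟩
    have := S.downward_closed hg (homOfLE inf_le_right : V ⊓ W ⟶ W)
    exact this
  transitive' U S hS R hR := by
    refine le_trans hS (sSup_le ?_)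
    rintro V ⟨f, hf⟩
    refine (hR hf).trans (sSup_le ?_)
    rintro W ⟨g, hg⟩
    exact le_sSup ⟨g ≫ f, hg⟩

/-- The topos of sheaves on a locale. -/
abbrev Sh (X : Locale.{u}) := Sheaf (frameTopology X) (Type u)

theorem frameHom_isContinuous {L M : Type u} [Order.Frame L] [Order.Frame M] (f : FrameHom L M) :
    (OrderHomClass.mono f).functor.IsContinuous (frameTopology L) (frameTopology M) := by
  refine Functor.isContinuous_of_coverPreserving ⟨?_⟩ ⟨?_⟩
  · intro P Z U x hx Y₁ Y₂ W f₁ f₂ g₁ g₂ hg₁ hg₂ e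
    let I : L := Y₁ ⊓ Y₂
    let i₁ : I ⟶ Y₁ := homOfLE inf_le_left
    let i₂ : I ⟶ Y₂ := homOfLE inf_le_right
    let k : W ⟶ (OrderHomClass.mono f).functor.obj I :=
      homOfLE (show W ≤ f (Y₁ ⊓ Y₂) by rw [map_inf]; exact le_inf f₁.le f₂.le)
    have h := congrArg (P.obj.map k.op) (hx i₁ i₂ hg₁ hg₂ (Subsingleton.elim _ _))
    have e₁ : f₁ = k ≫ (OrderHomClass.mono f).functor.map i₁ := Subsingleton.elim _ _
    have e₂ : f₂ = k ≫ (OrderHomClass.mono f).functor.map i₂ := Subsingleton.elim _ _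
    rw [e₁, e₂, op_comp, op_comp, Functor.map_comp, Functor.map_comp]
    exact h
  · intro U S hS
    change f U ≤ _
    refine (OrderHomClass.mono f hS).trans ?_
    rw [map_sSup]
    refine sSup_le ?_
    rintro _ ⟨V, ⟨g, hg⟩, rfl⟩
    exact le_sSup ⟨_, Sieve.image_mem_functorPushforward _ _ hg⟩

/-- The direct image functor `Sh(X) ⥤ Sh(Y)` of a locale morphism. -/
def Sh.direct {X Y : Locale.{u}} (f : X ⟶ Y) : Sh X ⥤ Sh Y :=
  haveI := frameHom_isContinuous (frameMap f)
  (OrderHomClass.mono (frameMap f)).functor.sheafPushforwardContinuous (Type u)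
    (frameTopology Y) (frameTopology X)

/-- A geometric morphism `F → E`: a direct image functor with a finite-limit-preserving left
adjoint. -/
structure GeometricMorphism (F : Type*) [Category* F] (E : Type*) [Category* E] where
  direct : F ⥤ E
  inverse : E ⥤ F
  adj : inverse ⊣ direct
  lex : Limits.PreservesFiniteLimits inverse

/-- The classifying topos `Set[T]`: sheaves on the syntactic site of `T`. -/
abbrev ClassifyingTopos (T : Theory.{u}) := Sheaf (SynCat.topology T) (Type u)

/-! ### Sentences -/

/-- The sentences of `T`, i.e. the formulae without free variables. -/
def Sentence (T : Theory.{u}) : Type (u + 1) := Formula T.sig []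

/-- Sentences are ordered by `T`-provability. -/
instance (T : Theory.{u}) : Preorder (Sentence T) where
  le φ ψ := Provable T (Γ := []) φ ψ
  le_refl φ := Provable.refl φ
  le_trans _ _ _ := Provable.cut

/-- The `T`-provable equivalence classes of sentences, ordered by `T`-provability. -/
abbrev SentenceFrame (T : Theory.{u}) : Type (u + 1) := Antisymmetrization (Sentence T) (· ≤ ·)

/-- A sentence as an open of `G₀`. -/
def Sentence.toOpen {T : Theory.{u}} (φ : Sentence T) : G₀ T :=
  Formula.eval (P T).gen φ Env.nil

/-- A sentence, regarded as a formula in a larger context. -/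
def Sentence.weaken {T : Theory.{u}} (φ : Sentence T) (Γ : List T.sig.Srt) : Formula T.sig Γ :=
  Formula.rename (Γ := []) φ fun _ v => nomatch v

/-- The basic proposition obtained from `g` by replacing each natural number `n` in a place of
sort `X` by `y X n`. -/
def Gen.subst {A : Signature.{u}} (y : A.Srt → ℕ → ℕ) : Gen A → Gen A
  | .eq X n m => .eq X (y X n) (y X m)
  | .rel R n => .rel R fun i => y (A.dom R i) (n i)

end GeometricLogic

open GeometricLogic CategoryTheory CategoryTheory.Limits

namespace GeometricLogic

open Formula

/-! ### The frame presented by `P[T]`: basic relations and soundness -/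

section gen

variable (T : Theory.{u})

/-! All parts are read off from one lattice, that of the opens u of G₀ with s^* u = t^* u. A
coequaliser of locales is an equaliser of frames, so q^* identifies O(π₀) with it.

Closure operator. A family y of surjections ℕ → ℕ turns a presented model into another presentation,
in which n denotes what y n denoted before, together with an isomorphism between the two. This is a
frame homomorphism `isoHom y` from O(G₁) to O(G₀) that is left inverse to s^* and whose composite
with t^* substitutes y in every basic proposition. The left adjoint s_! is the join of all `isoHom
y` (`sectionJoin_gc`). The counit is the section equation. For the unit, a finite meet of basic
propositions of T_≅ mentions finitely many numbers of the second copy; their preimages under α exist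
locally, and a choice of them extends to a family of surjections (`inf_gen_le_copyHom_sectionJoin`).
Thus s_! t^* u is the join of the substitution instances of u along such families.

Sentences. For a finite meet of basic propositions that join is the value of the sentence obtained
by replacing numbers by variables and quantifying existentially. Since s_! t^* preserves joins,
every fixed point is the value of a sentence (`exists_sentence`). Conversely, isomorphisms preserve
truth (`eval_copy_le`), so values of sentences are invariant, and invariant opens are fixed by
adjointness.

Order of sentences. Inequality of values is provability: one direction is soundness
(`Provable.eval_le`), the other conservativity (`Sentence.le_of_toOpen_le`). For the latter, finite
sets of basic propositions act as conditions, realised by formulae in context whose variables are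
named by distinct numbers. The conditions all of whose realisations prove φ form an open `forcing φ`
of G₀ (`forcing_mem`) above the value of φ; testing it on the realisation φ itself recovers
provability.

Topos. Each object of the syntactic site covers its support, an object given by a sentence. Hence a
sheaf with at most one section is determined by the largest sentence on which it is inhabited, and
subterminal objects are elements of O(π₀). A geometric morphism f to Sh(L) has an inverse image that
sends opens V to subterminals, which gives a frame homomorphism from O(L) to O(π₀). By adjunction
and Yoneda the sections of f_* F over V are the sections of F over the sentence belonging to V
(`directEquiv`), so f factors through the reflection. Uniqueness is tested on subterminal sheaves.
-/

theorem gen_symm_le (X : T.sig.Srt) (n m : ℕ) :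
    (P T).gen (.eq X n m) ≤ (P T).gen (.eq X m n) :=
  PropTheory.proj_le_proj (PAx.symm (T := T) X n m)

theorem gen_symm (X : T.sig.Srt) (n m : ℕ) :
    (P T).gen (.eq X n m) = (P T).gen (.eq X m n) :=
  le_antisymm (gen_symm_le T X n m) (gen_symm_le T X m n)

theorem gen_trans (X : T.sig.Srt) (n m l : ℕ) :
    (P T).gen (.eq X n m) ⊓ (P T).gen (.eq X m l) ≤ (P T).gen (.eq X n l) := by
  have := PropTheory.proj_le_proj (P := P T) (PAx.trans (T := T) X n m l)
  rwa [map_inf] at this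

theorem gen_left (X : T.sig.Srt) (n m : ℕ) :
    (P T).gen (.eq X n m) ≤ (P T).gen (.eq X n n) :=
  le_trans (le_inf le_rfl (gen_symm_le T X n m)) (gen_trans T X n m n)

theorem gen_right (X : T.sig.Srt) (n m : ℕ) :
    (P T).gen (.eq X n m) ≤ (P T).gen (.eq X m m) :=
  (gen_symm_le T X n m).trans (gen_left T X m n)

theorem gen_rel_congr (R : T.sig.Rel) (n m : Fin (T.sig.arity R) → ℕ) {x : (P T).Opens}
    (h : x ≤ (P T).gen (.rel R n))
    (h' : ∀ i, x ≤ (P T).gen (.eq (T.sig.dom R i) (n i) (m i))) :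
    x ≤ (P T).gen (.rel R m) := by
  have := PropTheory.proj_le_proj (P := P T) (PAx.rel_congr (T := T) R n m)
  rw [map_inf, map_finset_inf] at this
  exact le_trans (le_inf h (Finset.le_inf fun i _ => h' i)) this

theorem gen_rel_exist (R : T.sig.Rel) (n : Fin (T.sig.arity R) → ℕ) (i : Fin (T.sig.arity R)) :
    (P T).gen (.rel R n) ≤ (P T).gen (.eq (T.sig.dom R i) (n i) (n i)) := by
  have := PropTheory.proj_le_proj (P := P T) (PAx.rel_exist (T := T) R n)
  rw [map_finset_inf] at this
  exact this.trans (Finset.inf_le (Finset.mem_univ i))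

variable {T}

theorem proj_eval {Γ : List T.sig.Srt} (φ : Formula T.sig Γ) (e : Env Γ) :
    (P T).proj (φ.eval FreeFrame.of e) = φ.eval (P T).gen e :=
  Formula.map_eval (P T).proj FreeFrame.of φ e

theorem gen_axm {σ : Sequent T.sig} (h : σ ∈ T.axioms) (e : Env σ.ctx) :
    e.exist (P T).gen ⊓ σ.lhs.eval (P T).gen e ≤ σ.rhs.eval (P T).gen e := by
  have h₁ : (P T).proj (e.exist FreeFrame.of) = e.exist (P T).gen :=
    Env.map_exist (P T).proj FreeFrame.of e
  have := PropTheory.proj_le_proj (P := P T) (PAx.axm h e)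
  rwa [map_inf, h₁, proj_eval, proj_eval] at this

end gen

/-! ### Assignments, substitution and soundness. -/

theorem Env.le_exist_iff {A : Signature.{u}} {L : Type v} [Order.Frame L] (I : Gen A → L)
    {Γ : List A.Srt} {e : Env Γ} {x : L} :
    x ≤ e.exist I ↔ ∀ X (v : Var Γ X), x ≤ I (.eq X (e X v) (e X v)) := by
  induction Γ with
  | nil => exact ⟨fun _ X v => (nomatch v), fun _ => le_top⟩
  | cons Y Γ ih =>
    constructor
    · intro h X v
      cases v with
      | zero => exact h.trans inf_le_left
      | succ v => exact ih.1 (h.trans inf_le_right) X v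
    · exact fun h => le_inf (h _ .zero) (ih.2 fun X v => h X (.succ v))

theorem Env.exist_le {A : Signature.{u}} {L : Type v} [Order.Frame L] (I : Gen A → L)
    {Γ : List A.Srt} (e : Env Γ) {X : A.Srt} (v : Var Γ X) :
    e.exist I ≤ I (.eq X (e X v) (e X v)) :=
  (Env.le_exist_iff I).1 le_rfl X v

/-- An assignment, restricted along a substitution. -/
def Env.comp {S : Type u} {Γ Δ : List S} (e : Env Δ) (r : Ren Γ Δ) : Env Γ :=
  fun X v => e X (r X v)

theorem Env.cons_comp_lift {S : Type u} {Γ Δ : List S} (e : Env Δ) (r : Ren Γ Δ) {X : S} (n : ℕ) :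
    Env.comp (e.cons n : Env (X :: Δ)) (r.lift X) = (e.comp r).cons n := by
  funext Y v
  cases v <;> rfl

theorem Formula.eval_rename {A : Signature.{u}} {L : Type v} [Order.Frame L] (I : Gen A → L)
    {Γ Δ : List A.Srt} (φ : Formula A Γ) (r : Ren Γ Δ) (e : Env Δ) :
    (φ.rename r).eval I e = φ.eval I (e.comp r) := by
  induction φ generalizing Δ with
  | top => rfl
  | and φ ψ h₁ h₂ => simp only [rename, eval, h₁, h₂]
  | sup ι φ h => simp only [rename, eval, h]
  | eq x y => rfl
  | rel R x => rfl
  | ex X φ h => simp only [rename, eval, h, Env.cons_comp_lift]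

theorem Formula.eval_eqs {A : Signature.{u}} {L : Type v} [Order.Frame L] (I : Gen A → L)
    {Γ Δ : List A.Srt} (a b : Ren Δ Γ) (e : Env Γ) {X : A.Srt} (v : Var Δ X) :
    (eqs a b).eval I e ≤ I (.eq X (e X (a X v)) (e X (b X v))) := by
  induction v with
  | zero => exact inf_le_left
  | succ v ih => exact inf_le_right.trans (ih _ _)

variable {T : Theory.{u}}

/-- The relations ∼ are congruences for all connectives. The inequality is stated at a stage `x` so
that the induction can shrink `x` to a single disjunct or to a single witness. -/
theorem Formula.eval_congr {Γ : List T.sig.Srt} (φ : Formula T.sig Γ) (e e' : Env Γ)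
    {x : (P T).Opens} (h : ∀ X v, x ≤ (P T).gen (.eq X (e X v) (e' X v)))
    (h' : x ≤ φ.eval (P T).gen e) : x ≤ φ.eval (P T).gen e' := by
  induction φ generalizing x with
  | top => exact le_top
  | and φ ψ h₁ h₂ =>
    exact le_inf (h₁ _ _ h (h'.trans inf_le_left)) (h₂ _ _ h (h'.trans inf_le_right))
  | sup ι φ ih =>
    refine (le_inf le_rfl h').trans ?_
    rw [Formula.eval, inf_iSup_eq]
    exact iSup_le fun i => le_iSup_of_le i
      (ih i _ _ (fun X v => inf_le_left.trans (h X v)) inf_le_right)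
  | eq a b =>
    refine (le_inf (le_inf ?_ h') (h _ b)).trans ((inf_le_inf_right _ (gen_trans T _ _ _ _)).trans
      (gen_trans T _ _ _ _))
    rw [gen_symm]; exact h _ a
  | rel R a => exact gen_rel_congr T R _ _ h' fun i => h _ (a i)
  | ex X φ ih =>
    refine (le_inf le_rfl h').trans ?_
    rw [Formula.eval, inf_iSup_eq]
    refine iSup_le fun n => le_iSup_of_le n (le_inf (inf_le_right.trans inf_le_left)
      (ih (e.cons n) _ (fun Y v => ?_) (inf_le_right.trans inf_le_right)))
    cases v with
    | zero => exact inf_le_right.trans inf_le_left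
    | succ v => exact inf_le_left.trans (h Y v)

/-- Soundness, by induction on derivations. The factor `e.exist` is needed because a number may
denote nothing: it yields reflexivity of equality and allows free variables to serve as witnesses.
-/
theorem Provable.eval_le {Γ : List T.sig.Srt} {φ ψ : Formula T.sig Γ} (h : Provable T φ ψ)
    (e : Env Γ) : e.exist (P T).gen ⊓ φ.eval (P T).gen e ≤ ψ.eval (P T).gen e := by
  induction h with
  | ax h => exact gen_axm h e
  | refl φ => exact inf_le_right
  | cut _ _ h₁ h₂ => exact (le_inf inf_le_left (h₁ e)).trans (h₂ e)
  | subst r _ ih =>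
    rw [eval_rename, eval_rename]
    exact (inf_le_inf_right _ ((Env.le_exist_iff _).2 fun X v => Env.exist_le _ e (r X v))).trans
      (ih _)
  | eq_refl x => exact inf_le_left.trans (Env.exist_le _ e x)
  | eq_subst φ a b =>
    rw [Formula.eval, eval_rename, eval_rename]
    exact eval_congr φ _ _ (fun X v => inf_le_right.trans (inf_le_left.trans
      (eval_eqs _ a b e v))) (inf_le_right.trans inf_le_right)
  | top_intro φ => exact le_top
  | and_left φ ψ => exact inf_le_right.trans inf_le_left
  | and_right φ ψ => exact inf_le_right.trans inf_le_right
  | and_intro _ _ h₁ h₂ => exact le_inf (h₁ e) (h₂ e)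
  | sup_intro φ i => exact inf_le_right.trans (le_iSup (fun i => (φ i).eval (P T).gen e) i)
  | sup_elim _ ih =>
    rw [Formula.eval, inf_iSup_eq]
    exact iSup_le fun i => ih i e
  | @ex_intro Γ X φ ψ _ ih =>
    rw [eval_rename]
    refine le_trans (le_inf (inf_le_left.trans inf_le_right) ?_) (ih (e.comp fun _ v => .succ v))
    -- The number assigned to the bound variable is the witness, and `e.exist` says that it denotes.
    refine le_iSup_of_le (e X .zero) (le_inf (inf_le_left.trans inf_le_left) ?_)
    refine inf_le_right.trans (le_of_eq (congrArg (φ.eval (P T).gen) ?_))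
    funext Y v
    cases v <;> rfl
  | @ex_elim Γ X φ ψ _ ih =>
    rw [Formula.eval, inf_iSup_eq]
    refine iSup_le fun n => le_trans ?_ ((ih (e.cons n)).trans (le_of_eq (eval_rename _ _ _ _)))
    exact le_inf (le_inf (inf_le_right.trans inf_le_left) inf_le_left)
      (inf_le_right.trans inf_le_right)
  | distrib φ ψ =>
    simp only [Formula.eval, inf_iSup_eq]
    exact iSup_mono fun i => inf_le_right
  | frobenius φ ψ =>
    simp only [Formula.eval, inf_iSup_eq, eval_rename]
    refine iSup_mono fun i => ?_
    exact le_inf (inf_le_right.trans (inf_le_right.trans inf_le_left))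
      (le_inf (inf_le_right.trans inf_le_left)
        (inf_le_right.trans (inf_le_right.trans inf_le_right)))

theorem Sentence.toOpen_mono {φ ψ : Sentence T} (h : φ ≤ ψ) : φ.toOpen ≤ ψ.toOpen := by
  have := Provable.eval_le (T := T) (Γ := []) h Env.nil
  rwa [show Env.exist (P T).gen (Env.nil : Env ([] : List T.sig.Srt)) = ⊤ from rfl,
    top_inf_eq] at this

end GeometricLogic

namespace GeometricLogic

open Formula Provable

/-! ### Conservativity of `P[T]` over `T` -/

namespace FreeFrame

variable {G : Type u}

theorem mem_of {g : G} {J : Finset G} : OrderDual.toDual J ∈ of g ↔ g ∈ J :=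
  Finset.singleton_subset_iff

theorem mem_of_subset {U : FreeFrame G} {J J' : Finset G} (h : J ⊆ J')
    (hJ : OrderDual.toDual J ∈ U) : OrderDual.toDual J' ∈ U :=
  U.lower (show OrderDual.toDual J' ≤ OrderDual.toDual J from h) hJ

theorem mem_finset_inf {ι : Type*} (s : Finset ι) (U : ι → FreeFrame G) {J : Finset G} :
    OrderDual.toDual J ∈ s.inf U ↔ ∀ i ∈ s, OrderDual.toDual J ∈ U i := by
  classical
  induction s using Finset.induction_on with
  | empty => exact ⟨fun _ _ h => absurd h (Finset.notMem_empty _), fun _ => trivial⟩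
  | insert i s _ ih =>
    rw [Finset.inf_insert, LowerSet.mem_inf_iff, ih, Finset.forall_mem_insert]

/-- Heyting implication among down-sets is read as in Kripke semantics, larger finite sets being
stronger conditions. This makes membership in the sublocale of `P[T]` a statement about single
conditions. -/
theorem himp_le_himp {a b x : FreeFrame G}
    (h : ∀ J : Finset G, OrderDual.toDual J ∈ a →
      (∀ J', J ⊆ J' → OrderDual.toDual J' ∈ b → OrderDual.toDual J' ∈ x) →
      OrderDual.toDual J ∈ x) : b ⇨ x ≤ a ⇨ x := by
  rw [le_himp_iff]
  rintro J ⟨hJ, ha⟩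
  exact h J ha fun J' hJJ' hb =>
    (himp_inf_le : (b ⇨ x) ⊓ b ≤ x) ⟨mem_of_subset hJJ' hJ, hb⟩

end FreeFrame

/-- Provides a fresh name for a bound variable. -/
theorem Env.exists_bound {S : Type u} {Γ : List S} (e : Env Γ) :
    ∃ N, ∀ X (v : Var Γ X), e X v < N := by
  induction Γ with
  | nil => exact ⟨0, fun X v => nomatch v⟩
  | cons Y Γ ih =>
    obtain ⟨N, hN⟩ := ih fun X v => e X (.succ v)
    refine ⟨max N (e _ .zero + 1), fun X v => ?_⟩
    cases v with
    | zero => exact lt_max_of_lt_right (Nat.lt_succ_self _)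
    | succ v => exact lt_max_of_lt_left (hN X v)

/-- An assignment naming distinct variables of the same sort by distinct numbers. -/
def Env.Injective {S : Type u} {Γ : List S} (e : Env Γ) : Prop :=
  ∀ X (v w : Var Γ X), e X v = e X w → v = w

theorem Env.Injective.cons {S : Type u} {Γ : List S} {e : Env Γ} (he : e.Injective) {X : S}
    {n : ℕ} (hn : ∀ v : Var Γ X, e X v ≠ n) : Env.Injective (e.cons n : Env (X :: Γ)) := by
  intro Y v w h
  cases v with
  | zero =>
    cases w with
    | zero => rfl
    | succ w => exact absurd h.symm (hn w)
  | succ v =>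
    cases w with
    | zero => exact absurd h (hn v)
    | succ w => exact congrArg _ (he _ _ _ h)

/-! ### Conditions and the formulae in context that realise them. -/

variable {T : Theory.{u}} {Γ Δ : List T.sig.Srt}

/-- The formula `χ` in the context `Γ`, with its variables named by `l`, forces the basic
proposition `g`. -/
def Forces (χ : Formula T.sig Γ) (l : Env Γ) : Gen T.sig → Prop
  | .eq X n m => ∃ x y : Var Γ X, l X x = n ∧ l X y = m ∧ Provable T χ (.eq x y)
  | .rel R n => ∃ x : ∀ i, Var Γ (T.sig.dom R i),
      (∀ i, l _ (x i) = n i) ∧ Provable T χ (.rel R x)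

theorem Forces.eq_intro {χ : Formula T.sig Γ} {l : Env Γ} {X : T.sig.Srt} {n m : ℕ} {x y : Var Γ X}
    (hx : l X x = n) (hy : l X y = m) (h : Provable T χ (.eq x y)) : Forces χ l (.eq X n m) :=
  ⟨x, y, hx, hy, h⟩

theorem Forces.rel_intro {χ : Formula T.sig Γ} {l : Env Γ} {R : T.sig.Rel}
    {n : Fin (T.sig.arity R) → ℕ} {x : ∀ i, Var Γ (T.sig.dom R i)} (hx : ∀ i, l _ (x i) = n i)
    (h : Provable T χ (.rel R x)) : Forces χ l (.rel R n) :=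
  ⟨x, hx, h⟩

theorem Forces.mono {χ χ' : Formula T.sig Γ} {l : Env Γ} {g : Gen T.sig} (h : Provable T χ' χ)
    (hg : Forces χ l g) : Forces χ' l g := by
  cases g with
  | eq X n m =>
    obtain ⟨x, y, hx, hy, hxy⟩ := hg
    exact ⟨x, y, hx, hy, cut h hxy⟩
  | rel R n =>
    obtain ⟨x, hx, hR⟩ := hg
    exact ⟨x, hx, cut h hR⟩

theorem Forces.rename {χ : Formula T.sig Γ} {l : Env Δ} (r : Ren Γ Δ) {g : Gen T.sig}
    (hg : Forces χ (l.comp r) g) : Forces (χ.rename r) l g := by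
  cases g with
  | eq Y n m =>
    obtain ⟨x, y, hx, hy, hxy⟩ := hg
    exact ⟨r _ x, r _ y, hx, hy, subst r hxy⟩
  | rel R n =>
    obtain ⟨x, hx, hR⟩ := hg
    exact ⟨fun i => r _ (x i), hx, subst r hR⟩

/-- An injective naming lets variables be recovered from their names, so that forcing a basic
proposition about them is the same as proving the atomic formula. -/
theorem Forces.eq_iff {χ : Formula T.sig Γ} {l : Env Γ} (hl : l.Injective) {X : T.sig.Srt}
    {x y : Var Γ X} : Forces χ l (.eq X (l X x) (l X y)) ↔ Provable T χ (.eq x y) := by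
  constructor
  · rintro ⟨x', y', hx, hy, h⟩
    rwa [hl _ _ _ hx, hl _ _ _ hy] at h
  · exact fun h => ⟨x, y, rfl, rfl, h⟩

theorem Forces.rel_iff {χ : Formula T.sig Γ} {l : Env Γ} (hl : l.Injective) {R : T.sig.Rel}
    {x : ∀ i, Var Γ (T.sig.dom R i)} :
    Forces χ l (.rel R fun i => l _ (x i)) ↔ Provable T χ (.rel R x) := by
  constructor
  · rintro ⟨x', hx, h⟩
    rwa [funext fun i => hl _ _ _ (hx i)] at h
  · exact fun h => ⟨x, fun _ => rfl, h⟩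

theorem Sentence.weaken_rename (φ : Sentence T) (r : Ren Γ Δ) :
    (φ.weaken Γ).rename r = φ.weaken Δ := by
  refine (rename_rename _ _ _).trans (congrArg (Formula.rename φ) ?_)
  funext X v
  exact nomatch v

theorem Sentence.weaken_nil (φ : Sentence T) : φ.weaken [] = φ := by
  refine Eq.trans (congrArg (Formula.rename φ) ?_) (rename_id φ)
  funext X v
  exact nomatch v

/-- The substitution on the context `ctxOf d` given by a tuple of variables. -/
def Ren.tuple {S : Type u} {Γ : List S} : {k : ℕ} → {d : Fin k → S} → (∀ i, Var Γ (d i)) →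
    Ren (ctxOf d) Γ
  | 0, _, _ => fun _ v => nomatch v
  | _ + 1, _, x => Ren.cons (x 0) (Ren.tuple fun i => x i.succ)

theorem Ren.tuple_varOf {S : Type u} {Γ : List S} {k : ℕ} {d : Fin k → S} (x : ∀ i, Var Γ (d i))
    (i : Fin k) : Ren.tuple x _ (varOf d i) = x i := by
  induction k with
  | zero => exact i.elim0
  | succ k ih =>
    induction i using Fin.cases with
    | zero => rfl
    | succ i => exact ih (fun i => x i.succ) i

theorem Ren.tuple_rel {S : Type u} {Γ : List S} {p : ∀ X : S, Var Γ X → Var Γ X → Prop} {k : ℕ}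
    {d : Fin k → S} {x y : ∀ i, Var Γ (d i)} (h : ∀ i, p _ (x i) (y i)) (X : S)
    (v : Var (ctxOf d) X) : p X (Ren.tuple x X v) (Ren.tuple y X v) := by
  induction k with
  | zero => exact nomatch v
  | succ k ih =>
    cases v with
    | zero => exact h 0
    | succ v => exact ih (fun i => h i.succ) v

/-- Each atomic formula is a substitution instance of `R` applied to the generic variables of its
own context, so the general replacement rule applies. -/
theorem Provable.rel_congr {χ : Formula T.sig Γ} {R : T.sig.Rel}
    {x y : ∀ i, Var Γ (T.sig.dom R i)} (h : Provable T χ (.rel R x))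
    (h' : ∀ i, Provable T χ (.eq (x i) (y i))) : Provable T χ (.rel R y) := by
  have h₁ : ∀ z : ∀ i, Var Γ (T.sig.dom R i),
      (Formula.rel R (varOf (T.sig.dom R)) : Formula T.sig _).rename (Ren.tuple z) = .rel R z :=
    fun z => congrArg (Formula.rel R) (funext fun i => Ren.tuple_varOf z i)
  rw [← h₁] at h ⊢
  exact replace (Ren.tuple_rel (p := fun X v w => Provable T χ (.eq v w)) h') h

/-- The finite sets of basic propositions that force the sentence `φ`. -/
def forcing (φ : Sentence T) : FreeFrame (Gen T.sig) where
  carrier := {s | ∀ (Γ : List T.sig.Srt) (l : Env Γ) (χ : Formula T.sig Γ), l.Injective →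
    (∀ g ∈ OrderDual.ofDual s, Forces χ l g) → Provable T χ (φ.weaken Γ)}
  lower' _ _ h hs Γ l χ hl hχ := hs Γ l χ hl fun g hg => hχ g (h hg)

/-- The easy half of a truth lemma: a condition in the value of ψ already contains the atoms and
witnesses from which ψ is derived, and χ proves them. -/
theorem provable_of_forces {χ : Formula T.sig Γ} {l : Env Γ} (hl : l.Injective)
    {J : Finset (Gen T.sig)} (hJ : ∀ g ∈ J, Forces χ l g) (ψ : Formula T.sig Δ) (r : Ren Δ Γ)
    (h : OrderDual.toDual J ∈ ψ.eval FreeFrame.of (l.comp r)) : Provable T χ (ψ.rename r) := by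
  induction ψ with
  | top => exact top_intro _
  | and φ ψ h₁ h₂ => exact and_intro (h₁ r h.1) (h₂ r h.2)
  | sup ι φ ih =>
    obtain ⟨i, hi⟩ := LowerSet.mem_iSup_iff.1 h
    exact cut (ih i r hi) (sup_intro (fun i => (φ i).rename r) i)
  | eq x y => exact (Forces.eq_iff hl).1 (hJ _ (FreeFrame.mem_of.1 h))
  | rel R x => exact (Forces.rel_iff hl).1 (hJ _ (FreeFrame.mem_of.1 h))
  | ex X φ ih =>
    obtain ⟨n, hn, hφ⟩ := LowerSet.mem_iSup_iff.1 h
    -- The forced proposition `[n ∼ n]` makes n the name of a variable x, which is the witness.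
    obtain ⟨x, -, rfl, -, -⟩ := hJ _ (FreeFrame.mem_of.1 hn)
    have := ih (Ren.cons x r) (by
      refine (congrArg (OrderDual.toDual J ∈ φ.eval FreeFrame.of ·) ?_).mp hφ
      funext Y v
      cases v <;> rfl)
    refine cut this ?_
    have h₁ := subst (Ren.cons x fun _ v => v) (ex_intro (Provable.refl (ex X (φ.rename (r.lift X)))))
    rw [rename_rename, rename_rename] at h₁
    refine (congrArg₂ (Provable T) ?_ ?_).mp h₁
    · refine congrArg (Formula.rename φ) ?_
      funext Y v
      cases v <;> rfl
    · exact rename_id _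

/-- The hard half of the truth lemma. A proof of ψ from χ need not put J into the value of ψ; this
holds only after splitting disjunctions and adding variables for existential quantifiers, and φ may
be proved after such a refinement. The map `s` with `l'.comp s = l` keeps the old names, and χ' is
required to prove the renamed χ so that earlier information stays available. -/
theorem provable_of_extensions (φ : Sentence T) (ψ : Formula T.sig Δ) {Γ : List T.sig.Srt}
    {χ : Formula T.sig Γ} {l : Env Γ} (hl : l.Injective) {J : Finset (Gen T.sig)}
    (hJ : ∀ g ∈ J, Forces χ l g) (r : Ren Δ Γ) (h : Provable T χ (ψ.rename r))
    (h' : ∀ (Γ' : List T.sig.Srt) (χ' : Formula T.sig Γ') (l' : Env Γ') (J' : Finset (Gen T.sig))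
      (s : Ren Γ Γ'), l'.Injective → l'.comp s = l → Provable T χ' (χ.rename s) → J ⊆ J' →
      (∀ g ∈ J', Forces χ' l' g) → OrderDual.toDual J' ∈ ψ.eval FreeFrame.of (l.comp r) →
      Provable T χ' (φ.weaken Γ')) : Provable T χ (φ.weaken Γ) := by
  classical
  have rfl' : Provable T χ (χ.rename fun _ v => v) := by rw [rename_id]; exact Provable.refl _
  induction ψ generalizing Γ J with
  | top => exact h' Γ χ l J (fun _ v => v) hl rfl rfl' subset_rfl hJ trivial
  | and ψ₁ ψ₂ ih₁ ih₂ =>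
    -- The second conjunct is treated at the stage reached by the first, where `hχ'` makes it
    -- available.
    refine ih₁ hl hJ r (cut h (and_left _ _)) (fun Γ' χ' l' J' s hl' hs hχ' hJJ' hJ' m => ?_) rfl'
    subst hs
    refine ih₂ hl' hJ' (fun X v => s X (r X v)) ?_
      (fun Γ'' χ'' l'' J'' s' hl'' hs' hχ'' hJJ'' hJ'' m' => ?_)
      (by rw [rename_id]; exact Provable.refl _)
    · rw [← rename_rename]
      exact cut hχ' (subst s (cut h (and_right _ _)))
    · subst hs'
      refine h' Γ'' χ'' l'' J'' (fun X v => s' X (s X v)) hl'' rfl ?_ (hJJ'.trans hJJ'') hJ''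
        ⟨FreeFrame.mem_of_subset hJJ'' m, m'⟩
      rw [← rename_rename]
      exact cut hχ'' (subst s' hχ')
  | sup ι ψ ih =>
    refine SynCat.sup_cases h fun i χ' h₁ h₂ => ih i hl (fun g hg => (hJ g hg).mono h₁) r h₂
      (fun Γ' χ'' l' J' s hl' hs hχ' hJJ' hJ' m => ?_) (by rw [rename_id]; exact Provable.refl _)
    exact h' Γ' χ'' l' J' s hl' hs (cut hχ' (subst s h₁)) hJJ' hJ'
      (LowerSet.mem_iSup_iff.2 ⟨i, m⟩)
  | @eq _ X x y =>
    -- The context and χ stay the same: χ proves the atom, so only the condition grows.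
    exact h' Γ χ l (insert (.eq X (l X (r X x)) (l X (r X y))) J) (fun _ v => v) hl rfl rfl'
      (Finset.subset_insert _ _)
      ((Finset.forall_mem_insert _ _ _).2 ⟨(Forces.eq_iff hl).2 h, hJ⟩)
      (FreeFrame.mem_of.2 (Finset.mem_insert_self _ _))
  | rel R x =>
    exact h' Γ χ l (insert (.rel R fun i => l _ (r _ (x i))) J) (fun _ v => v) hl rfl rfl'
      (Finset.subset_insert _ _)
      ((Finset.forall_mem_insert _ _ _).2 ⟨(Forces.rel_iff hl).2 h, hJ⟩)
      (FreeFrame.mem_of.2 (Finset.mem_insert_self _ _))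
  | ex X ψ ih =>
    -- N names the new variable. Adding `[N ∼ N]` to the condition is what makes N a witness in the
    -- value of the quantifier.
    obtain ⟨N, hN⟩ := l.exists_bound
    refine cut (and_intro (Provable.refl _) h) (cut (frobenius _ _) (ex_elim ?_))
    rw [Sentence.weaken_rename]
    refine ih (l := l.cons N) (hl.cons fun v => (hN X v).ne) (J := insert (.eq X N N) J)
      ((Finset.forall_mem_insert _ _ _).2 ⟨Forces.eq_intro rfl rfl (eq_rfl _ (.zero : Var (X :: Γ) X)), fun g hg =>
        (Forces.rename (l := l.cons N) (fun _ v => .succ v) (hJ g hg)).mono (and_left _ _)⟩)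
      (r.lift X) (and_right _ _)
      (fun Γ' χ' l' J' s hl' hs hχ' hJJ' hJ' m => ?_) (by rw [rename_id]; exact Provable.refl _)
    refine h' Γ' χ' l' J' (fun X v => s X (.succ v)) hl' ?_ ?_
      ((Finset.subset_insert _ _).trans hJJ') hJ'
      (LowerSet.mem_iSup_iff.2 ⟨N, FreeFrame.mem_of.2 (hJJ' (Finset.mem_insert_self _ _)), ?_⟩)
    · exact congrArg (fun e : Env (X :: Γ) => e.comp fun _ v => Var.succ v) hs
    · have := cut hχ' (subst s (and_left _ _))
      rwa [rename_rename] at this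
    · rwa [Env.cons_comp_lift] at m

theorem provable_of_forcing (φ : Sentence T) (ψ : Formula T.sig Δ) {Γ : List T.sig.Srt}
    {χ : Formula T.sig Γ} {l : Env Γ} (hl : l.Injective) {J : Finset (Gen T.sig)}
    (hJ : ∀ g ∈ J, Forces χ l g) (r : Ren Δ Γ) (h : Provable T χ (ψ.rename r))
    (h' : ∀ J', J ⊆ J' → OrderDual.toDual J' ∈ ψ.eval FreeFrame.of (l.comp r) →
      OrderDual.toDual J' ∈ forcing φ) : Provable T χ (φ.weaken Γ) :=
  provable_of_extensions φ ψ hl hJ r h fun _ _ _ J' _ hl' _ _ hJJ' hJ' m =>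
    h' J' hJJ' m _ _ _ hl' hJ'

/-- A number forced to denote is the name of a variable, so an assignment of such numbers comes from
a substitution. This turns an instance of an axiom of `T` at numbers into one at variables. -/
theorem forces_exist {χ : Formula T.sig Γ} {l : Env Γ} {J : Finset (Gen T.sig)}
    (hJ : ∀ g ∈ J, Forces χ l g) (e : Env Δ)
    (h : OrderDual.toDual J ∈ e.exist FreeFrame.of) : ∃ r : Ren Δ Γ, e = l.comp r := by
  have : ∀ X (v : Var Δ X), ∃ x : Var Γ X, l X x = e X v := by
    intro X v
    obtain ⟨x, -, hx, -, -⟩ := hJ _ (FreeFrame.mem_of.1 (Env.exist_le FreeFrame.of e v h))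
    exact ⟨x, hx⟩
  choose r hr using this
  exact ⟨r, funext fun X => funext fun v => (hr X v).symm⟩

/-- For the structural axioms, χ also forces the conclusion, which may therefore be added to J. For
an axiom of `T`, membership in the value of the left side gives a proof of it by
`provable_of_forces`, the axiom gives the right side, and `provable_of_forcing` returns to
conditions. -/
theorem forcing_mem (φ : Sentence T) : forcing φ ∈ (P T).sublocale := by
  classical
  intro a b hab
  refine FreeFrame.himp_le_himp fun J hJ h Γ l χ hl hχ => ?_
  cases hab with
  | symm X n m =>
    obtain ⟨x, y, rfl, rfl, hxy⟩ := hχ _ (FreeFrame.mem_of.1 hJ)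
    exact h (insert (.eq X (l X y) (l X x)) J) (Finset.subset_insert _ _)
      (FreeFrame.mem_of.2 (Finset.mem_insert_self _ _)) Γ l χ hl
      ((Finset.forall_mem_insert _ _ _).2 ⟨Forces.eq_intro rfl rfl (eq_symm hxy), hχ⟩)
  | trans X n m k =>
    obtain ⟨x, y, rfl, rfl, hxy⟩ := hχ _ (FreeFrame.mem_of.1 hJ.1)
    obtain ⟨y', z, hy, rfl, hyz⟩ := hχ _ (FreeFrame.mem_of.1 hJ.2)
    obtain rfl := hl _ _ _ hy
    exact h (insert (.eq X (l X x) (l X z)) J) (Finset.subset_insert _ _)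
      (FreeFrame.mem_of.2 (Finset.mem_insert_self _ _)) Γ l χ hl
      ((Finset.forall_mem_insert _ _ _).2 ⟨Forces.eq_intro rfl rfl (eq_trans hxy hyz), hχ⟩)
  | rel_congr R n m =>
    obtain ⟨x, hx, hR⟩ := hχ _ (FreeFrame.mem_of.1 hJ.1)
    have h₁ : ∀ i, ∃ y : Var Γ (T.sig.dom R i), l _ y = m i ∧ Provable T χ (.eq (x i) y) := by
      intro i
      obtain ⟨x', y, hx', hy, hxy⟩ :=
        hχ _ (FreeFrame.mem_of.1 ((FreeFrame.mem_finset_inf _ _).1 hJ.2 i (Finset.mem_univ i)))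
      obtain rfl := hl _ _ _ (hx'.trans (hx i).symm)
      exact ⟨y, hy, hxy⟩
    choose y hy hxy using h₁
    refine h (insert (.rel R m) J) (Finset.subset_insert _ _)
      (FreeFrame.mem_of.2 (Finset.mem_insert_self _ _)) Γ l χ hl
      ((Finset.forall_mem_insert _ _ _).2 ⟨Forces.rel_intro hy (Provable.rel_congr hR hxy), hχ⟩)
  | rel_exist R n =>
    obtain ⟨x, hx, hR⟩ := hχ _ (FreeFrame.mem_of.1 hJ)
    refine h (J ∪ Finset.univ.image fun i => .eq (T.sig.dom R i) (n i) (n i))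
      Finset.subset_union_left ((FreeFrame.mem_finset_inf _ _).2 fun i _ => FreeFrame.mem_of.2
        (Finset.mem_union_right _ (Finset.mem_image_of_mem _ (Finset.mem_univ i)))) Γ l χ hl ?_
    intro g hg
    rcases Finset.mem_union.1 hg with hg | hg
    · exact hχ g hg
    · obtain ⟨i, -, rfl⟩ := Finset.mem_image.1 hg
      exact ⟨x i, x i, hx i, hx i, eq_rfl _ _⟩
  | @axm σ hσ e =>
    obtain ⟨r, rfl⟩ := forces_exist hχ e hJ.1
    exact provable_of_forcing φ σ.rhs hl hχ r
      (cut (provable_of_forces hl hχ σ.lhs r hJ.2) (subst r (ax hσ))) h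

theorem Sentence.toOpen_le_forcing (φ : Sentence T) :
    φ.toOpen ≤ (⟨forcing φ, forcing_mem φ⟩ : (P T).Opens) := by
  refine (proj_eval (T := T) (Γ := []) φ Env.nil).symm.trans_le (PropTheory.proj_le_iff.2 ?_)
  intro J hJ Γ l χ hl hχ
  exact provable_of_forces (Δ := []) hl hχ φ _ ((congrArg
    (J ∈ Formula.eval (Γ := []) FreeFrame.of φ ·) (funext fun X => funext fun v => nomatch v)).mp hJ)

/-- Conservativity: the value of φ lies below `forcing ψ`, and this is tested on φ itself, regarded
as a realisation of the empty condition in the empty context. -/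
theorem Sentence.le_of_toOpen_le {φ ψ : Sentence T} (h : φ.toOpen ≤ ψ.toOpen) : φ ≤ ψ := by
  have h₁ := h.trans ψ.toOpen_le_forcing
  have h₂ := PropTheory.proj_le_iff.1 ((proj_eval (T := T) (Γ := []) φ Env.nil).trans_le h₁)
  have := provable_of_forcing (T := T) ψ (Δ := []) φ (Γ := []) (χ := φ) (l := Env.nil)
    (fun X v => nomatch v) (J := ∅) (fun g hg => absurd hg (Finset.notMem_empty g))
    (fun _ v => v) (by erw [rename_id]; exact Provable.refl _) fun J' _ hJ' => h₂ hJ'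
  rwa [Sentence.weaken_nil] at this

theorem Sentence.toOpen_le_iff {φ ψ : Sentence T} : φ.toOpen ≤ ψ.toOpen ↔ φ ≤ ψ :=
  ⟨Sentence.le_of_toOpen_le, Sentence.toOpen_mono⟩

end GeometricLogic

namespace GeometricLogic

open Formula Provable

/-! ### The theory of isomorphisms -/

namespace Env

variable {S : Type u}

/-- The assignment of the numbers `n i` to the variables of `ctxOf d`. -/
def tuple : {k : ℕ} → (d : Fin k → S) → (Fin k → ℕ) → Env (ctxOf d)
  | 0, _, _ => nil
  | _ + 1, d, n => cons (n 0) (tuple (fun i => d i.succ) fun i => n i.succ)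

theorem tuple_varOf {k : ℕ} (d : Fin k → S) (n : Fin k → ℕ) (i : Fin k) :
    tuple d n _ (varOf d i) = n i := by
  induction k with
  | zero => exact i.elim0
  | succ k ih =>
    induction i using Fin.cases with
    | zero => rfl
    | succ i => exact ih (fun i => d i.succ) (fun i => n i.succ) i

theorem tuple_forall {p : S → ℕ → Prop} {k : ℕ} {d : Fin k → S} {n : Fin k → ℕ}
    (h : ∀ i, p (d i) (n i)) (X : S) (v : Var (ctxOf d) X) : p X (tuple d n X v) := by
  induction k with
  | zero => exact nomatch v
  | succ k ih =>
    cases v with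
    | zero => exact h 0
    | succ v => exact ih (fun i => h i.succ) v

/-- The assignment on a concatenated context given by assignments on both blocks. -/
def append {Δ : List S} : {Γ : List S} → Env Γ → Env Δ → Env (Γ ++ Δ)
  | [], _, b => b
  | _ :: _, a, b => cons (a _ .zero) (append (fun _ w => a _ (.succ w)) b)

theorem append_inl {Γ Δ : List S} (a : Env Γ) (b : Env Δ) {X : S} (v : Var Γ X) :
    append a b X (v.inl Δ) = a X v := by
  induction v with
  | zero => rfl
  | succ v ih => exact ih _

theorem append_inr {Γ Δ : List S} (a : Env Γ) (b : Env Δ) {X : S} (v : Var Δ X) :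
    append a b X (v.inr Γ) = b X v := by
  induction Γ with
  | nil => rfl
  | cons Y Γ ih => exact ih _

end Env

section

variable {A : Signature.{u}} {L : Type v} [Order.Frame L]

theorem Formula.le_eval_conj (I : Gen A → L) {Γ : List A.Srt} {k : ℕ} {φ : Fin k → Formula A Γ}
    {e : Env Γ} {x : L} : x ≤ (conj φ).eval I e ↔ ∀ i, x ≤ (φ i).eval I e := by
  induction k with
  | zero => exact ⟨fun _ i => i.elim0, fun _ => le_top⟩
  | succ k ih =>
    rw [Fin.forall_fin_succ, ← ih (φ := fun i => φ i.succ)]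
    exact le_inf_iff

theorem Formula.eval_alpha (I : Gen (isoSig A) → L) {Γ : List (isoSig A).Srt} {X : A.Srt}
    (x : Var Γ (X, false)) (y : Var Γ (X, true)) (e : Env Γ) :
    (alpha x y).eval I e = I (.rel (A := isoSig A) (.inr X) ![e _ x, e _ y]) := by
  refine congrArg (fun n => I (.rel (A := isoSig A) (.inr X) n)) (funext fun i : Fin 2 => ?_)
  induction i using Fin.cases with
  | zero => rfl
  | succ i => rw [Subsingleton.elim i 0]; rfl

end

section iso

variable (T : Theory.{u})

/-- The basic proposition `[(n, m) ∈ α^X]`. -/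
abbrev alphaGen {A : Signature.{u}} (X : A.Srt) (n m : ℕ) : Gen (isoSig A) :=
  .rel (A := isoSig A) (.inr X) ![n, m]

theorem alphaGen_left (X : T.sig.Srt) (n m : ℕ) :
    (P (isoTheory T)).gen (alphaGen X n m) ≤
      (P (isoTheory T)).gen (.eq (A := isoSig T.sig) (X, false) n n) :=
  gen_rel_exist (isoTheory T) (.inr X) ![n, m] (0 : Fin 2)

theorem alphaGen_right (X : T.sig.Srt) (n m : ℕ) :
    (P (isoTheory T)).gen (alphaGen X n m) ≤
      (P (isoTheory T)).gen (.eq (A := isoSig T.sig) (X, true) m m) :=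
  gen_rel_exist (isoTheory T) (.inr X) ![n, m] (1 : Fin 2)

variable {T} {x : (P (isoTheory T)).Opens}

/-- The assignment of `n, n', m, m'` to the variables `x, x', y, y'`. -/
def bijEnv {A : Signature.{u}} (X : A.Srt) (n n' m m' : ℕ) : Env (bijCtx X) :=
  .cons n (.cons n' (.cons m (.cons m' .nil)))

theorem le_exist_bijEnv {X : T.sig.Srt} {n n' m m' : ℕ}
    (h : x ≤ (P (isoTheory T)).gen (alphaGen X n m))
    (h' : x ≤ (P (isoTheory T)).gen (alphaGen X n' m')) :
    x ≤ (bijEnv X n n' m m').exist (P (isoTheory T)).gen :=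
  le_inf (h.trans (alphaGen_left T X n m)) (le_inf (h'.trans (alphaGen_left T X n' m'))
    (le_inf (h.trans (alphaGen_right T X n m)) (le_inf (h'.trans (alphaGen_right T X n' m')) le_top)))

theorem le_gen_true_of_alpha {X : T.sig.Srt} {n n' m m' : ℕ}
    (h : x ≤ (P (isoTheory T)).gen (alphaGen X n m))
    (h' : x ≤ (P (isoTheory T)).gen (alphaGen X n' m'))
    (hn : x ≤ (P (isoTheory T)).gen (.eq (A := isoSig T.sig) (X, false) n n')) :
    x ≤ (P (isoTheory T)).gen (.eq (A := isoSig T.sig) (X, true) m m') := by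
  have := gen_axm (T := isoTheory T) (IsoAx.bij₁ X) (bijEnv X n n' m m')
  simp only [bijForm₁, bijForm₂, Formula.eval, Formula.eval_alpha] at this
  exact ((le_inf (le_exist_bijEnv h h') (le_inf h (le_inf h' hn))).trans this).trans
    (inf_le_right.trans inf_le_right)

theorem le_gen_false_of_alpha {X : T.sig.Srt} {n n' m m' : ℕ}
    (h : x ≤ (P (isoTheory T)).gen (alphaGen X n m))
    (h' : x ≤ (P (isoTheory T)).gen (alphaGen X n' m'))
    (hn : x ≤ (P (isoTheory T)).gen (.eq (A := isoSig T.sig) (X, true) m m')) :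
    x ≤ (P (isoTheory T)).gen (.eq (A := isoSig T.sig) (X, false) n n') := by
  have := gen_axm (T := isoTheory T) (IsoAx.bij₂ X) (bijEnv X n n' m m')
  simp only [bijForm₁, bijForm₂, Formula.eval, Formula.eval_alpha] at this
  exact ((le_inf (le_exist_bijEnv h h') (le_inf h (le_inf h' hn))).trans this).trans
    (inf_le_right.trans inf_le_right)

theorem gen_true_le_iSup_alpha (X : T.sig.Srt) (m : ℕ) :
    (P (isoTheory T)).gen (.eq (A := isoSig T.sig) (X, true) m m) ≤
      ⨆ n, (P (isoTheory T)).gen (alphaGen X n m) := by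
  have := gen_axm (T := isoTheory T) (IsoAx.surj X) (.cons m .nil)
  simp only [Formula.eval, Formula.eval_alpha] at this
  exact ((le_inf (le_inf le_rfl le_top) le_top).trans this).trans (iSup_mono fun n => inf_le_right)

theorem gen_false_le_iSup_alpha (X : T.sig.Srt) (n : ℕ) :
    (P (isoTheory T)).gen (.eq (A := isoSig T.sig) (X, false) n n) ≤
      ⨆ m, (P (isoTheory T)).gen (alphaGen X n m) := by
  have := gen_axm (T := isoTheory T) (IsoAx.total X) (.cons n .nil)
  simp only [Formula.eval, Formula.eval_alpha] at this
  exact ((le_inf (le_inf le_rfl le_top) le_top).trans this).trans (iSup_mono fun n => inf_le_right)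

/-- The assignment of `n i` to `x_i` and of `m i` to `y_i`. -/
def relEnv {A : Signature.{u}} (R : A.Rel) (n m : Fin (A.arity R) → ℕ) : Env (relCtx R) :=
  Env.append (Env.tuple _ n) (Env.tuple _ m)

theorem relEnv_relX {A : Signature.{u}} (R : A.Rel) (n m : Fin (A.arity R) → ℕ) (i) :
    relEnv R n m _ (relX R i) = n i :=
  (Env.append_inl _ _ _).trans (Env.tuple_varOf _ _ _)

theorem relEnv_relY {A : Signature.{u}} (R : A.Rel) (n m : Fin (A.arity R) → ℕ) (i) :
    relEnv R n m _ (relY R i) = m i :=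
  (Env.append_inr _ _ _).trans (Env.tuple_varOf _ _ _)

theorem le_exist_relEnv {R : T.sig.Rel} {n m : Fin (T.sig.arity R) → ℕ}
    (h : ∀ i, x ≤ (P (isoTheory T)).gen (alphaGen (T.sig.dom R i) (n i) (m i))) :
    x ≤ (relEnv R n m).exist (P (isoTheory T)).gen := by
  refine (Env.le_exist_iff _).2 fun X v => ?_
  induction v using Var.append_cases with
  | hl v =>
    rw [relEnv, Env.append_inl]
    exact Env.tuple_forall (p := fun X n => x ≤ (P (isoTheory T)).gen (.eq X n n))
      (fun i => (h i).trans (alphaGen_left T _ _ _)) X v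
  | hr v =>
    rw [relEnv, Env.append_inr]
    exact Env.tuple_forall (p := fun X n => x ≤ (P (isoTheory T)).gen (.eq X n n))
      (fun i => (h i).trans (alphaGen_right T _ _ _)) X v

theorem le_gen_rel_true_of_alpha {R : T.sig.Rel} {n m : Fin (T.sig.arity R) → ℕ}
    (h : ∀ i, x ≤ (P (isoTheory T)).gen (alphaGen (T.sig.dom R i) (n i) (m i)))
    (hn : x ≤ (P (isoTheory T)).gen (.rel (A := isoSig T.sig) (.inl (R, false)) n)) :
    x ≤ (P (isoTheory T)).gen (.rel (A := isoSig T.sig) (.inl (R, true)) m) := by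
  have := gen_axm (T := isoTheory T) (IsoAx.rel₁ R) (relEnv R n m)
  simp only [relForm₁, relForm₂, Formula.eval, relEnv_relX, relEnv_relY] at this
  refine ((le_inf (le_exist_relEnv h) (le_inf ((le_eval_conj _).2 fun i => ?_) hn)).trans
    this).trans inf_le_right
  rw [Formula.eval_alpha, relEnv_relX, relEnv_relY]
  exact h i

theorem le_gen_rel_false_of_alpha {R : T.sig.Rel} {n m : Fin (T.sig.arity R) → ℕ}
    (h : ∀ i, x ≤ (P (isoTheory T)).gen (alphaGen (T.sig.dom R i) (n i) (m i)))
    (hn : x ≤ (P (isoTheory T)).gen (.rel (A := isoSig T.sig) (.inl (R, true)) m)) :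
    x ≤ (P (isoTheory T)).gen (.rel (A := isoSig T.sig) (.inl (R, false)) n) := by
  have := gen_axm (T := isoTheory T) (IsoAx.rel₂ R) (relEnv R n m)
  simp only [relForm₁, relForm₂, Formula.eval, relEnv_relX, relEnv_relY] at this
  refine ((le_inf (le_exist_relEnv h) (le_inf ((le_eval_conj _).2 fun i => ?_) hn)).trans
    this).trans inf_le_right
  rw [Formula.eval_alpha, relEnv_relX, relEnv_relY]
  exact h i

/-- Isomorphisms preserve the truth of formulae. -/
theorem eval_copy_le {Γ : List T.sig.Srt} (φ : Formula T.sig Γ) (e e' : Env Γ)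
    (h : ∀ X v, x ≤ (P (isoTheory T)).gen (alphaGen X (e X v) (e' X v)))
    (hφ : x ≤ φ.eval (fun g => (P (isoTheory T)).gen (g.copy false)) e) :
    x ≤ φ.eval (fun g => (P (isoTheory T)).gen (g.copy true)) e' := by
  induction φ generalizing x with
  | top => exact le_top
  | and φ ψ h₁ h₂ =>
    exact le_inf (h₁ _ _ h (hφ.trans inf_le_left)) (h₂ _ _ h (hφ.trans inf_le_right))
  | sup ι φ ih =>
    refine (le_inf le_rfl hφ).trans ?_
    rw [Formula.eval, inf_iSup_eq]
    exact iSup_le fun i => le_iSup_of_le i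
      (ih i _ _ (fun X v => inf_le_left.trans (h X v)) inf_le_right)
  | eq a b => exact le_gen_true_of_alpha (h _ a) (h _ b) hφ
  | rel R a => exact le_gen_rel_true_of_alpha (fun i => h _ (a i)) hφ
  | ex X φ ih =>
    refine (le_inf le_rfl hφ).trans ?_
    rw [Formula.eval, inf_iSup_eq]
    refine iSup_le fun n => ?_
    -- Totality of α covers the current stage by pieces on which the witness n has an image m.
    refine (le_inf le_rfl ((inf_le_right.trans inf_le_left).trans
      (gen_false_le_iSup_alpha X n))).trans ?_
    rw [inf_iSup_eq]
    refine iSup_le fun m => le_iSup_of_le m (le_inf (inf_le_right.trans (alphaGen_right T X n m))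
      (ih (e.cons n) _ (fun Y v => ?_) (inf_le_left.trans (inf_le_right.trans inf_le_right))))
    cases v with
    | zero => exact inf_le_right
    | succ v => exact inf_le_left.trans (inf_le_left.trans (h Y v))

end iso

/-! ### Sections of the source map -/

section sections

variable {A : Signature.{u}} {L : Type v} [Order.Frame L]

/-- Surjectivity matters for the quantifiers only: a join over all y n is then a join over all
numbers. -/
theorem Formula.eval_subst (I : Gen A → L) {y : A.Srt → ℕ → ℕ} (hy : ∀ X, (y X).Surjective)
    {Γ : List A.Srt} (φ : Formula A Γ) (e : Env Γ) :
    φ.eval (fun g => I (g.subst y)) e = φ.eval I fun X v => y X (e X v) := by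
  induction φ with
  | top => rfl
  | and φ ψ h₁ h₂ => simp only [Formula.eval, h₁, h₂]
  | sup ι φ ih => simp only [Formula.eval, ih]
  | eq a b => rfl
  | rel R a => rfl
  | ex X φ ih =>
    simp only [Formula.eval, ih]
    refine Eq.trans (iSup_congr fun n => congrArg₂ _ rfl (congrArg _ ?_)) ((hy X).iSup_comp
      fun n => I (.eq X n n) ⊓ φ.eval I (Env.cons n fun X v => y X (e X v)))
    funext Y v
    cases v <;> rfl

theorem Env.exist_subst (I : Gen A → L) (y : A.Srt → ℕ → ℕ) {Γ : List A.Srt} (e : Env Γ) :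
    e.exist (fun g => I (g.subst y)) = Env.exist I fun X v => y X (e X v) := by
  induction Γ with
  | nil => rfl
  | cons X Γ ih => exact congrArg₂ _ rfl (ih _)

/-- The families of surjections `ℕ → ℕ` indexed by the sorts. -/
abbrev SurjFamily (A : Signature.{u}) : Type u := {y : A.Srt → ℕ → ℕ // ∀ X, (y X).Surjective}

/-- The identity for `false`, and `y` for `true`. -/
def SurjFamily.side (y : SurjFamily A) : Bool → SurjFamily A
  | false => ⟨fun _ n => n, fun _ => Function.surjective_id⟩
  | true => y

variable {T : Theory.{u}} (y : SurjFamily T.sig)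

/-- The isomorphism from a presented model to its pullback along `y`. -/
def isoVal : Gen (isoSig T.sig) → (P T).Opens
  | .eq (X, b) n m => (P T).gen (.eq X ((y.side b).1 X n) ((y.side b).1 X m))
  | .rel (.inl (R, b)) n => (P T).gen (.rel R fun i => (y.side b).1 (T.sig.dom R i) (n i))
  | .rel (.inr X) n => (P T).gen (.eq X (n (0 : Fin 2)) (y.1 X (n (1 : Fin 2))))

theorem isoVal_copy (b : Bool) (g : Gen T.sig) :
    isoVal y (g.copy b) = (P T).gen (g.subst (y.side b).1) := by
  cases g <;> rfl

theorem isoVal_alpha (X : T.sig.Srt) (n m : ℕ) :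
    isoVal y (alphaGen X n m) = (P T).gen (.eq X n (y.1 X m)) := rfl

/-- The pulled-back structure is a model because truth at an assignment `e` there is truth at `y ∘
e` in the given model. Since α relates n to m when n ∼ y m, a number m of the second copy has y m as
α-preimage, while an α-image of n is any m with y m = n. -/
theorem isoVal_axm {σ : Sequent (isoSig T.sig)} (h : IsoAx T σ) (e : Env σ.ctx) :
    e.exist (isoVal y) ⊓ σ.lhs.eval (isoVal y) e ≤ σ.rhs.eval (isoVal y) e := by
  cases h with
  | @copy b σ h =>
    have key : ∀ e : Env (σ.ctx.map fun X => (X, b)), Env.exist (A := isoSig T.sig) (isoVal y) e ⊓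
        (σ.lhs.copy b).eval (isoVal y) e ≤ (σ.rhs.copy b).eval (isoVal y) e := by
      intro e
      rw [Formula.eval_copy, Formula.eval_copy, Env.exist_copy]
      simp only [isoVal_copy]
      rw [Formula.eval_subst _ (y.side b).2, Formula.eval_subst _ (y.side b).2, Env.exist_subst]
      exact gen_axm h _
    exact key e
  | bij₁ X =>
    simp only [bijForm₁, bijForm₂, Formula.eval, Formula.eval_alpha, isoVal_alpha]
    refine inf_le_right.trans (le_inf inf_le_left (le_inf (inf_le_right.trans inf_le_left) ?_))
    refine le_trans (le_inf (le_inf ?_ (inf_le_right.trans inf_le_right))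
      (inf_le_right.trans inf_le_left)) ((inf_le_inf_right _ (gen_trans T _ _ _ _)).trans
        (gen_trans T _ _ _ _))
    rw [gen_symm]; exact inf_le_left
  | bij₂ X =>
    simp only [bijForm₁, bijForm₂, Formula.eval, Formula.eval_alpha, isoVal_alpha]
    refine inf_le_right.trans (le_inf inf_le_left (le_inf (inf_le_right.trans inf_le_left) ?_))
    refine le_trans (le_inf (le_inf inf_le_left (inf_le_right.trans inf_le_right))
      ((inf_le_right.trans inf_le_left).trans (gen_symm_le T _ _ _)))
      ((inf_le_inf_right _ (gen_trans T _ _ _ _)).trans (gen_trans T _ _ _ _))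
  | surj X =>
    simp only [Formula.eval, Formula.eval_alpha, isoVal_alpha]
    refine inf_le_left.trans (inf_le_left.trans (le_iSup_of_le (y.1 X (e _ .zero)) ?_))
    exact le_inf le_rfl le_rfl
  | total X =>
    simp only [Formula.eval, Formula.eval_alpha, isoVal_alpha]
    obtain ⟨m, hm⟩ := y.2 X (e _ .zero)
    refine inf_le_left.trans (inf_le_left.trans (le_iSup_of_le m ?_))
    refine le_inf (le_of_eq ?_) (le_of_eq ?_)
    · exact (congrArg (fun k => (P T).gen (.eq X k k)) hm).symm
    · exact (congrArg (fun k => (P T).gen (.eq X (e _ .zero) k)) hm).symm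
  | rel₁ R =>
    simp only [relForm₁, relForm₂, Formula.eval]
    refine inf_le_right.trans (le_inf inf_le_left (gen_rel_congr T R _ _ inf_le_right fun i => ?_))
    refine inf_le_left.trans (((le_eval_conj _).1 le_rfl i).trans ?_)
    rw [Formula.eval_alpha]
    exact le_rfl
  | rel₂ R =>
    simp only [relForm₁, relForm₂, Formula.eval]
    refine inf_le_right.trans (le_inf inf_le_left (gen_rel_congr T R _ _ inf_le_right fun i => ?_))
    refine inf_le_left.trans (((le_eval_conj _).1 le_rfl i).trans ?_)
    rw [Formula.eval_alpha]
    exact gen_symm_le T _ _ _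

/-- The frame homomorphism of the section of the source map given by `y`. -/
def isoHom : FrameHom (P (isoTheory T)).Opens (P T).Opens :=
  PropTheory.lift (isoVal y) (by
    intro a b h
    cases h with
    | symm X n m =>
      simp only [FreeFrame.lift_of]
      exact gen_symm_le T _ _ _
    | trans X n m l =>
      simp only [map_inf, FreeFrame.lift_of]
      exact gen_trans T _ _ _ _
    | rel_congr R n m =>
      simp only [map_inf, map_finset_inf, Function.comp_def, FreeFrame.lift_of]
      rcases R with ⟨R, b⟩ | X
      · exact gen_rel_congr T R _ _ inf_le_left fun i =>
          inf_le_right.trans (Finset.inf_le (Finset.mem_univ i))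
      -- For α, congruence is the chain m₀ ∼ n₀ ∼ y n₁ ∼ y m₁.
      · have h₀ := Finset.inf_le (f := fun i : Fin 2 => isoVal y
          (.eq ((isoSig T.sig).dom (.inr X) i) (n i) (m i))) (Finset.mem_univ (0 : Fin 2))
        have h₁ := Finset.inf_le (f := fun i : Fin 2 => isoVal y
          (.eq ((isoSig T.sig).dom (.inr X) i) (n i) (m i))) (Finset.mem_univ (1 : Fin 2))
        refine (le_inf (le_inf ?_ inf_le_left) (inf_le_right.trans h₁)).trans
          ((inf_le_inf_right _ (gen_trans T X _ _ _)).trans (gen_trans T X _ _ _))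
        exact (inf_le_right.trans h₀).trans (gen_symm_le T X _ _)
    | rel_exist R n =>
      simp only [map_finset_inf, Function.comp_def, FreeFrame.lift_of]
      refine Finset.le_inf fun i _ => ?_
      rcases R with ⟨R, b⟩ | X
      · exact gen_rel_exist T R _ i
      · change Fin 2 at i
        induction i using Fin.cases with
        | zero => exact gen_left T X _ _
        | succ i => rw [Subsingleton.elim i 0]; exact gen_right T X _ _
    | axm h e =>
      rw [map_inf, Formula.map_eval, Formula.map_eval, Env.map_exist]
      simp only [FreeFrame.lift_of]
      exact isoVal_axm y h e)

theorem isoHom_gen (g : Gen (isoSig T.sig)) :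
    isoHom y ((P (isoTheory T)).gen g) = isoVal y g :=
  PropTheory.lift_gen _ _ _

end sections

end GeometricLogic

namespace GeometricLogic

open Formula Provable

/-! ### The left adjoint of `s^*` -/

/-! ### Finite meets of generators as a base. -/

namespace FreeFrame

variable {G : Type u}

theorem eq_iSup (U : FreeFrame G) :
    U = ⨆ J : {J : Finset G // OrderDual.toDual J ∈ U}, J.1.inf of := by
  refine LowerSet.ext (Set.ext fun J => ?_)
  constructor
  · intro hJ
    exact LowerSet.mem_iSup_iff.2 ⟨⟨OrderDual.ofDual J, hJ⟩,
      (mem_finset_inf _ _).2 fun g hg => mem_of.2 hg⟩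
  · intro hJ
    obtain ⟨⟨K, hK⟩, hJ⟩ := LowerSet.mem_iSup_iff.1 hJ
    exact mem_of_subset (fun g hg => mem_of.1 ((mem_finset_inf (J := OrderDual.ofDual J) _ _).1
      hJ g hg)) hK

end FreeFrame

namespace PropTheory

variable {P : PropTheory.{u}}

/-- The finite meets of basic propositions form a base, so join-preserving maps need to be studied
on them only. -/
theorem eq_iSup (x : P.Opens) :
    x = ⨆ J : {J : Finset P.Atom // OrderDual.toDual J ∈ x.1}, J.1.inf P.gen := by
  have h := congrArg P.proj (FreeFrame.eq_iSup x.1)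
  rw [proj_val, map_iSup] at h
  simp only [map_finset_inf] at h
  exact h

theorem hom_ext {L : Type v} [Order.Frame L] {f g : FrameHom P.Opens L}
    (h : ∀ a, f (P.gen a) = g (P.gen a)) (x : P.Opens) : f x = g x := by
  rw [eq_iSup x, map_iSup, map_iSup]
  simp only [map_finset_inf]
  exact iSup_congr fun J => Finset.inf_congr rfl fun a _ => h a

end PropTheory

/-! ### Numbers occurring in basic propositions. -/

section names

variable {A : Signature.{u}}

/-- The numbers occurring in a basic proposition, with their sorts. -/
def Gen.names : Gen A → List (A.Srt × ℕ)
  | .eq X n m => [(X, n), (X, m)]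
  | .rel R n => List.ofFn fun i => (A.dom R i, n i)

theorem Gen.subst_congr {g : Gen A} {y y' : A.Srt → ℕ → ℕ}
    (h : ∀ p ∈ g.names, y p.1 p.2 = y' p.1 p.2) : g.subst y = g.subst y' := by
  cases g with
  | eq X n m => exact congrArg₂ (Gen.eq X) (h (X, n) (by simp [names])) (h (X, m) (by simp [names]))
  | rel R n =>
    exact congrArg (Gen.rel R) (funext fun i => h (A.dom R i, n i) (List.mem_ofFn.2 ⟨i, rfl⟩))

theorem Gen.mem_names_subst {g : Gen A} (y : A.Srt → ℕ → ℕ) {X : A.Srt} {n : ℕ}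
    (h : (X, n) ∈ g.names) : (X, y X n) ∈ (g.subst y).names := by
  cases g with
  | eq Y k m =>
    simp only [names, List.mem_cons, List.not_mem_nil, or_false, Prod.mk.injEq] at h
    rcases h with ⟨rfl, rfl⟩ | ⟨rfl, rfl⟩ <;> simp [subst, names]
  | rel R m =>
    obtain ⟨i, hi⟩ := List.mem_ofFn.1 h
    obtain ⟨rfl, rfl⟩ := Prod.mk.inj hi
    exact List.mem_ofFn.2 ⟨i, rfl⟩

theorem gen_le_of_mem_names (T : Theory.{u}) {g : Gen T.sig} {X : T.sig.Srt} {n : ℕ}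
    (h : (X, n) ∈ g.names) : (P T).gen g ≤ (P T).gen (.eq X n n) := by
  cases g with
  | eq Y k m =>
    simp only [Gen.names, List.mem_cons, List.not_mem_nil, or_false, Prod.mk.injEq] at h
    rcases h with ⟨rfl, rfl⟩ | ⟨rfl, rfl⟩
    · exact gen_left T X n m
    · exact gen_right T X k n
  | rel R m =>
    obtain ⟨i, hi⟩ := List.mem_ofFn.1 h
    obtain ⟨rfl, rfl⟩ := Prod.mk.inj hi
    exact gen_rel_exist T R m i

/-- A family of functions can be made surjective without changing it on finitely many numbers. -/
theorem exists_surjFamily (y : A.Srt → ℕ → ℕ) (l : List (A.Srt × ℕ)) :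
    ∃ y' : SurjFamily A, ∀ p ∈ l, y'.1 p.1 p.2 = y p.1 p.2 := by
  obtain ⟨N, hN⟩ : ∃ N, ∀ p ∈ l, p.2 < N := by
    induction l with
    | nil => exact ⟨0, by simp⟩
    | cons p l ih =>
      obtain ⟨N, hN⟩ := ih
      refine ⟨max N (p.2 + 1), List.forall_mem_cons.2 ⟨by omega, fun q hq => ?_⟩⟩
      have := hN q hq
      omega
  -- All relevant numbers are below N. From N onwards the function is n - N, which takes every
  -- value.
  refine ⟨⟨fun X n => if n < N then y X n else n - N, fun X n => ⟨n + N, ?_⟩⟩, fun p hp => ?_⟩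
  · simp
  · simp [hN p hp]

end names

section adjoint

variable {T : Theory.{u}}

/-- The section equation: on the first copy, `isoVal y` uses the identity in place of y. -/
theorem isoHom_copyHom_false (y : SurjFamily T.sig) (u : (P T).Opens) :
    isoHom y (copyHom T false u) = u :=
  PropTheory.hom_ext (f := (isoHom y).comp (copyHom T false)) (g := FrameHom.id _) (fun g => by
    change isoHom y (copyHom T false ((P T).gen g)) = (P T).gen g
    rw [copyHom_gen, isoHom_gen, isoVal_copy]
    cases g <;> rfl) u

theorem isoHom_copyHom_true_gen (y : SurjFamily T.sig) (g : Gen T.sig) :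
    isoHom y (copyHom T true ((P T).gen g)) = (P T).gen (g.subst y.1) := by
  rw [copyHom_gen, isoHom_gen, isoVal_copy]
  rfl

/-- Elements of the second copy that are named by a list of numbers have preimages under an
isomorphism. -/
theorem le_of_preimages {x z : (P (isoTheory T)).Opens} (l : List (T.sig.Srt × ℕ))
    (hx : ∀ p ∈ l, x ≤ (P (isoTheory T)).gen (.eq (A := isoSig T.sig) (p.1, true) p.2 p.2))
    (h : ∀ (y : T.sig.Srt → ℕ → ℕ) (x' : (P (isoTheory T)).Opens), x' ≤ x →
      (∀ p ∈ l, x' ≤ (P (isoTheory T)).gen (alphaGen p.1 (y p.1 p.2) p.2)) → x' ≤ z) :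
    x ≤ z := by
  classical
  induction l generalizing x with
  | nil => exact h (fun _ n => n) x le_rfl (by simp)
  | cons q l ih =>
    have h₁ := hx q List.mem_cons_self
    -- Surjectivity of α covers x by pieces on which the number in q has a fixed preimage n.
    refine (le_inf le_rfl (h₁.trans (gen_true_le_iSup_alpha _ _))).trans ?_
    rw [inf_iSup_eq]
    refine iSup_le fun n => ih (fun p hp => inf_le_left.trans (hx p (List.mem_cons_of_mem _ hp)))
      fun y x' hx' hy => ?_
    -- The choice for q overrides y, which is only known to be correct on the tail.
    refine h (fun X m => if X = q.1 ∧ m = q.2 then n else y X m) x' (hx'.trans inf_le_left)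
      fun p hp => ?_
    by_cases hpq : p.1 = q.1 ∧ p.2 = q.2
    · obtain rfl : p = q := Prod.ext hpq.1 hpq.2
      simpa only [and_self, if_true] using hx'.trans inf_le_right
    · rw [if_neg hpq]
      rcases List.mem_cons.1 hp with rfl | hp
      · exact absurd ⟨rfl, rfl⟩ hpq
      · exact hy p hp

/-- If y picks α-preimages of the numbers of the second copy that occur in g, then transporting g
back along α gives exactly `isoVal y g`, read in the first copy. For g itself of the form (n₀, n₁) ∈
α, injectivity of α gives n₀ ∼ y n₁. -/
theorem le_copyHom_isoVal {x : (P (isoTheory T)).Opens} (y : SurjFamily T.sig)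
    {g : Gen (isoSig T.sig)} (hx : x ≤ (P (isoTheory T)).gen g)
    (h : ∀ X m, ((X, true), m) ∈ g.names →
      x ≤ (P (isoTheory T)).gen (alphaGen X (y.1 X m) m)) :
    x ≤ copyHom T false (isoVal y g) := by
  rcases g with ⟨⟨X, b⟩, n, m⟩ | ⟨⟨R, b⟩ | X, n⟩
  · cases b with
    | false =>
      refine hx.trans (le_of_eq ?_)
      exact (copyHom_gen T false (.eq X n m)).symm
    | true =>
      refine le_of_le_of_eq ?_ (copyHom_gen T false (.eq X (y.1 X n) (y.1 X m))).symm
      exact le_gen_false_of_alpha (h X n (by simp [Gen.names])) (h X m (by simp [Gen.names])) hx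
  · cases b with
    | false =>
      refine hx.trans (le_of_eq ?_)
      exact (copyHom_gen T false (.rel R n)).symm
    | true =>
      refine le_of_le_of_eq ?_
        (copyHom_gen T false (.rel R fun i => y.1 (T.sig.dom R i) (n i))).symm
      exact le_gen_rel_false_of_alpha (fun i => h _ _ (List.mem_ofFn.2 ⟨i, rfl⟩)) hx
  · refine le_of_le_of_eq ?_
      (copyHom_gen T false (.eq X (n (0 : Fin 2)) (y.1 X (n (1 : Fin 2))))).symm
    have hn : n = ![n (0 : Fin 2), n (1 : Fin 2)] := by
      funext i
      change Fin 2 at i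
      induction i using Fin.cases with
      | zero => rfl
      | succ i => rw [Subsingleton.elim i 0]; rfl
    rw [hn] at hx
    exact le_gen_false_of_alpha hx (h X _ (List.mem_ofFn.2 ⟨(1 : Fin 2), rfl⟩))
      (hx.trans (alphaGen_right T _ _ _))

/-- The left adjoint of `s^*`, as the join of the inverse images along the sections of the source
map given by families of surjections. -/
def sectionJoin (u : (P (isoTheory T)).Opens) : (P T).Opens :=
  ⨆ y : SurjFamily T.sig, isoHom y u

/-- The unit of the adjunction on basic opens. Locally, finitely many preimages under α can be
chosen; they determine y on the numbers that matter. -/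
theorem inf_gen_le_copyHom_sectionJoin (K : Finset (Gen (isoSig T.sig))) :
    K.inf (P (isoTheory T)).gen ≤ copyHom T false (sectionJoin (K.inf (P (isoTheory T)).gen)) := by
  classical
  set l : List (T.sig.Srt × ℕ) := (K.toList.flatMap Gen.names).filterMap fun p =>
    if p.1.2 = true then some (p.1.1, p.2) else none with hl
  have mem_l : ∀ X m, (X, m) ∈ l ↔ ∃ g ∈ K, ((X, true), m) ∈ g.names := by
    intro X m
    simp only [hl, List.mem_filterMap, List.mem_flatMap, Finset.mem_toList]
    constructor
    · rintro ⟨⟨⟨X', b⟩, m'⟩, ⟨g, hg, hp⟩, h⟩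
      cases b with
      | false => simp at h
      | true =>
        simp only [if_true, Option.some.injEq, Prod.mk.injEq] at h
        obtain ⟨rfl, rfl⟩ := h
        exact ⟨g, hg, hp⟩
    · rintro ⟨g, hg, hp⟩
      exact ⟨((X, true), m), ⟨g, hg, hp⟩, by simp⟩
  refine le_of_preimages l (fun p hp => ?_) fun y x' hx' hy => ?_
  · obtain ⟨g, hg, hp⟩ := (mem_l p.1 p.2).1 hp
    exact (Finset.inf_le hg).trans (gen_le_of_mem_names (isoTheory T) hp)
  -- The chosen preimages need not form surjections, but only their values on l are used.
  · obtain ⟨y', hy'⟩ := exists_surjFamily y l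
    rw [sectionJoin, map_iSup]
    refine le_iSup_of_le y' ?_
    rw [map_finset_inf, map_finset_inf]
    refine Finset.le_inf fun g hg => ?_
    change x' ≤ copyHom T false (isoHom y' ((P (isoTheory T)).gen g))
    rw [isoHom_gen]
    refine le_copyHom_isoVal y' (hx'.trans (Finset.inf_le hg)) fun X m hm => ?_
    have hXm := (mem_l X m).2 ⟨g, hg, hm⟩
    have e : y'.1 X m = y X m := hy' (X, m) hXm
    rw [e]
    exact hy (X, m) hXm

theorem sectionJoin_mono {u u' : (P (isoTheory T)).Opens} (h : u ≤ u') :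
    sectionJoin u ≤ sectionJoin u' :=
  iSup_mono fun y => OrderHomClass.mono (isoHom y) h

/-- The unit passes from finite meets to all opens because these are joins of finite meets and both
maps are monotone. The counit is the section equation. -/
theorem sectionJoin_gc : GaloisConnection (sectionJoin (T := T)) (copyHom T false) := by
  intro u x
  constructor
  · intro h
    refine le_trans ?_ (OrderHomClass.mono (copyHom T false) h)
    conv_lhs => rw [PropTheory.eq_iSup u]
    refine iSup_le fun K => (inf_gen_le_copyHom_sectionJoin K.1).trans
      (OrderHomClass.mono (copyHom T false) (sectionJoin_mono ?_))
    conv_rhs => rw [PropTheory.eq_iSup u]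
    exact le_iSup (fun K : {K : Finset (Gen (isoSig T.sig)) // OrderDual.toDual K ∈ u.1} =>
      K.1.inf (P (isoTheory T)).gen) K
  · intro h
    refine iSup_le fun y => (OrderHomClass.mono (isoHom y) h).trans ?_
    rw [isoHom_copyHom_false]

theorem sShriek_eq (u : (P (isoTheory T)).Opens) : sShriek T u = sectionJoin u := by
  refine le_antisymm (sInf_le ?_) (le_sInf fun v hv => ?_)
  · exact sectionJoin_gc.le_u_l u
  · exact sectionJoin_gc.l_le hv

theorem sShriek_gc (T : Theory.{u}) : GaloisConnection (sShriek T) (frameMap (source T)) := by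
  have : sShriek T = sectionJoin := funext sShriek_eq
  rw [this]
  exact sectionJoin_gc

/-! ### The closure operator `s_! t^*` -/

/-- The closure operator `s_! t^*`. -/
def isoClosure (T : Theory.{u}) : ClosureOperator (P T).Opens :=
  ClosureOperator.mk' (fun u => sectionJoin (copyHom T true u))
    (fun _ _ h => sectionJoin_mono (OrderHomClass.mono (copyHom T true) h))
    -- Substituting the identity family changes nothing.
    (fun u => le_iSup_of_le ⟨fun _ n => n, fun _ => Function.surjective_id⟩ (le_of_eq
      (PropTheory.hom_ext (f := FrameHom.id _) (g := (isoHom _).comp (copyHom T true)) (fun g => by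
        refine Eq.trans ?_ (isoHom_copyHom_true_gen _ g).symm
        cases g <;> rfl) u)))
    (fun u => by
      refine iSup_le fun y => ?_
      rw [sectionJoin, map_iSup, map_iSup]
      -- Two successive substitutions amount to one substitution of the composite family.
      refine iSup_le fun z => le_iSup_of_le ⟨fun X n => y.1 X (z.1 X n),
        fun X => (y.2 X).comp (z.2 X)⟩ (le_of_eq ?_)
      refine PropTheory.hom_ext (f := (isoHom y).comp ((copyHom T true).comp
        ((isoHom z).comp (copyHom T true)))) (g := (isoHom _).comp (copyHom T true)) (fun g => ?_) u
      change isoHom y (copyHom T true (isoHom z (copyHom T true ((P T).gen g)))) =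
        isoHom _ (copyHom T true ((P T).gen g))
      simp only [isoHom_copyHom_true_gen]
      cases g <;> rfl)

theorem isoClosure_apply (u : G₀ T) : isoClosure T u = sShriek T (frameMap (target T) u) :=
  (sShriek_eq _).symm

theorem isoClosure_iSup {ι : Type*} (u : ι → (P T).Opens) :
    isoClosure T (⨆ i, u i) = ⨆ i, isoClosure T (u i) := by
  change sectionJoin (copyHom T true (⨆ i, u i)) = ⨆ i, sectionJoin (copyHom T true (u i))
  rw [map_iSup, sectionJoin_gc.l_iSup]

/-- Surjectivity can be dropped from the families y, since J contains finitely many numbers and any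
family agrees on these with a surjective one. -/
theorem isoClosure_inf_gen (J : Finset (Gen T.sig)) : isoClosure T (J.inf (P T).gen) =
    ⨆ y : T.sig.Srt → ℕ → ℕ, J.inf fun g => (P T).gen (g.subst y) := by
  have h : ∀ y : SurjFamily T.sig, isoHom y (copyHom T true (J.inf (P T).gen)) =
      J.inf fun g => (P T).gen (g.subst y.1) := by
    intro y
    rw [map_finset_inf, map_finset_inf]
    exact Finset.inf_congr rfl fun g _ => isoHom_copyHom_true_gen y g
  refine le_antisymm (iSup_le fun y => ?_) (iSup_le fun y => ?_)
  · rw [h]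
    exact le_iSup (fun y : T.sig.Srt → ℕ → ℕ => J.inf fun g => (P T).gen (g.subst y)) y.1
  · obtain ⟨y', hy'⟩ := exists_surjFamily y (J.toList.flatMap Gen.names)
    refine le_iSup_of_le y' ?_
    rw [h]
    refine le_of_eq (Finset.inf_congr rfl fun g hg => congrArg _ (Gen.subst_congr fun p hp => ?_))
    exact (hy' p (List.mem_flatMap.2 ⟨g, Finset.mem_toList.2 hg, hp⟩)).symm

/-- There are no free variables to substitute for, and quantifiers do not notice surjective
substitutions. -/
theorem isoClosure_eval (φ : Formula T.sig []) :
    isoClosure T (φ.eval (P T).gen Env.nil) = φ.eval (P T).gen Env.nil := by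
  refine le_antisymm (iSup_le fun y => le_of_eq ?_) ((isoClosure T).le_closure _)
  rw [Formula.map_eval, Formula.map_eval]
  simp only [isoHom_copyHom_true_gen]
  rw [Formula.eval_subst _ y.2]
  exact congrArg (φ.eval (P T).gen) (funext fun X => funext fun v => nomatch v)

theorem isoClosure_toOpen (φ : Sentence T) : isoClosure T φ.toOpen = φ.toOpen :=
  isoClosure_eval φ

theorem copyHom_eval_le (φ : Formula T.sig []) :
    copyHom T false (φ.eval (P T).gen Env.nil) ≤ copyHom T true (φ.eval (P T).gen Env.nil) := by
  rw [Formula.map_eval, Formula.map_eval]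
  simp only [copyHom_gen]
  exact eval_copy_le φ Env.nil Env.nil (fun X v => nomatch v) le_rfl

/-- Preservation of truth along α gives one inequality; the other is the transpose, under the
adjunction, of the sentence being a fixed point. -/
theorem copyHom_toOpen (φ : Sentence T) :
    copyHom T false φ.toOpen = copyHom T true φ.toOpen :=
  le_antisymm (copyHom_eval_le φ)
    ((sectionJoin_gc _ _).1 (isoClosure_toOpen φ).le)

/-! ### Sentences and invariant opens -/

theorem Formula.eval_exs_le {Γ : List T.sig.Srt} {Δ : List T.sig.Srt}
    (φ : Formula T.sig (Δ ++ Γ)) (e : Env Γ) {z : (P T).Opens}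
    (h : ∀ e' : Env Δ, e'.exist (P T).gen ⊓ φ.eval (P T).gen (Env.append e' e) ≤ z) :
    (exs Δ φ).eval (P T).gen e ≤ z := by
  induction Δ with
  | nil => exact le_trans (le_inf le_top le_rfl) (h Env.nil)
  | cons X Δ ih =>
    refine ih _ fun e' => ?_
    rw [Formula.eval, inf_iSup_eq]
    refine iSup_le fun n => le_trans ?_ (h (e'.cons n))
    exact le_inf (le_inf (inf_le_right.trans inf_le_left) inf_le_left)
      (inf_le_right.trans inf_le_right)

/-- Soundness applied to the derivable entailment from φ to its existential closure. -/
theorem Formula.le_eval_exs {Γ : List T.sig.Srt} {Δ : List T.sig.Srt}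
    (φ : Formula T.sig (Δ ++ Γ)) (e : Env Γ) (e' : Env Δ) {z : (P T).Opens}
    (h : z ≤ e.exist (P T).gen) (h' : z ≤ e'.exist (P T).gen)
    (hφ : z ≤ φ.eval (P T).gen (Env.append e' e)) : z ≤ (exs Δ φ).eval (P T).gen e := by
  have := (exs_adj.1 (Provable.refl (T := T) (exs Δ φ))).eval_le (Env.append e' e)
  rw [Formula.eval_rename] at this
  have h₁ : (Env.append e' e).comp (fun _ v => v.inr Δ) = e :=
    funext fun X => funext fun v => Env.append_inr _ _ v
  rw [h₁] at this
  refine (le_inf ((Env.le_exist_iff _).2 fun X v => ?_) hφ).trans this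
  induction v using Var.append_cases with
  | hl v => rw [Env.append_inl]; exact h'.trans (Env.exist_le _ _ v)
  | hr v => rw [Env.append_inr]; exact h.trans (Env.exist_le _ _ v)

/-- Introduces one variable for each number that occurs. By injectivity, every assignment of these
variables has the form y ∘ e. -/
theorem exists_env {S : Type u} (l : List (S × ℕ)) : ∃ (Γ : List S) (e : Env Γ), e.Injective ∧
    ∀ p, p ∈ l ↔ ∃ v : Var Γ p.1, e _ v = p.2 := by
  induction l with
  | nil =>
    refine ⟨[], Env.nil, (fun X v => nomatch v), fun p => ⟨(fun h => nomatch h), ?_⟩⟩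
    rintro ⟨v, -⟩
    exact nomatch v
  | cons q l ih =>
    obtain ⟨Γ, e, he, h⟩ := ih
    by_cases hq : q ∈ l
    · refine ⟨Γ, e, he, fun p => ⟨fun hp => ?_, fun hp => List.mem_cons_of_mem _ ((h p).2 hp)⟩⟩
      rcases List.mem_cons.1 hp with rfl | hp
      · exact (h _).1 hq
      · exact (h _).1 hp
    · refine ⟨q.1 :: Γ, e.cons q.2, he.cons fun v hv => hq ((h q).2 ⟨v, hv⟩), fun p => ⟨fun hp => ?_,
        ?_⟩⟩
      · rcases List.mem_cons.1 hp with rfl | hp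
        · exact ⟨.zero, rfl⟩
        · obtain ⟨v, hv⟩ := (h p).1 hp
          exact ⟨.succ v, hv⟩
      · rintro ⟨v, hv⟩
        obtain ⟨X, n⟩ := p
        cases v with
        | zero => exact List.mem_cons.2 (.inl (Prod.ext rfl hv.symm))
        | succ v => exact List.mem_cons_of_mem _ ((h (X, n)).2 ⟨v, hv⟩)

/-- Numbers are replaced by the variables that name them, so that substituting y in g becomes
evaluating at y ∘ e. -/
theorem exists_formula_gen {A : Signature.{u}} {Γ : List A.Srt} (e : Env Γ) (g : Gen A)
    (h : ∀ p ∈ g.names, ∃ v : Var Γ p.1, e _ v = p.2) :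
    ∃ ψ : Formula A Γ, ∀ {L : Type u} [Order.Frame L] (I : Gen A → L) (y : A.Srt → ℕ → ℕ),
      ψ.eval I (fun X v => y X (e X v)) = I (g.subst y) := by
  cases g with
  | eq X n m =>
    obtain ⟨v, hv⟩ := h (X, n) (by simp [Gen.names])
    obtain ⟨w, hw⟩ := h (X, m) (by simp [Gen.names])
    refine ⟨.eq v w, fun I y => ?_⟩
    simp only at hv hw
    rw [Formula.eval, hv, hw]
    rfl
  | rel R n =>
    choose v hv using fun i => h (A.dom R i, n i) (List.mem_ofFn.2 ⟨i, rfl⟩)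
    refine ⟨.rel R v, fun I y => ?_⟩
    simp only at hv
    simp only [Formula.eval, hv]
    rfl

theorem exists_formula_inf {A : Signature.{u}} {Γ : List A.Srt} (e : Env Γ) (J : Finset (Gen A))
    (h : ∀ g ∈ J, ∀ p ∈ g.names, ∃ v : Var Γ p.1, e _ v = p.2) :
    ∃ ψ : Formula A Γ, ∀ {L : Type u} [Order.Frame L] (I : Gen A → L) (y : A.Srt → ℕ → ℕ),
      ψ.eval I (fun X v => y X (e X v)) = J.inf fun g => I (g.subst y) := by
  classical
  induction J using Finset.induction_on with
  | empty => exact ⟨.top, fun I y => rfl⟩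
  | insert g J _ ih =>
    obtain ⟨ψ, hψ⟩ := ih fun g hg => h g (Finset.mem_insert_of_mem hg)
    obtain ⟨χ, hχ⟩ := exists_formula_gen e g (h g (Finset.mem_insert_self _ _))
    refine ⟨.and χ ψ, fun I y => ?_⟩
    rw [Formula.eval, hψ, hχ, Finset.inf_insert]

/-- The join over all families y in `isoClosure_inf_gen` is an existential quantification over the
numbers occurring in J. -/
theorem exists_sentence_inf_gen (J : Finset (Gen T.sig)) :
    ∃ φ : Sentence T, φ.toOpen = isoClosure T (J.inf (P T).gen) := by
  obtain ⟨Γ, e, he, h⟩ := exists_env (J.toList.flatMap Gen.names)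
  have mem : ∀ {p : T.sig.Srt × ℕ}, p ∈ J.toList.flatMap Gen.names ↔ ∃ g ∈ J, p ∈ g.names := by
    simp [List.mem_flatMap]
  obtain ⟨ψ, hψ⟩ := exists_formula_inf e J fun g hg p hp => (h p).1 (mem.2 ⟨g, hg, hp⟩)
  have hr : ∀ e' : Env Γ, (ψ.rename fun _ v => v.inl []).eval (P T).gen (Env.append e' Env.nil) =
      ψ.eval (P T).gen e' := by
    intro e'
    rw [Formula.eval_rename]
    exact congrArg _ (funext fun X => funext fun v => Env.append_inl _ _ v)
  refine ⟨exs Γ (ψ.rename fun _ v => v.inl []), ?_⟩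
  rw [isoClosure_inf_gen]
  refine le_antisymm (Formula.eval_exs_le _ _ fun e' => ?_) (iSup_le fun y => ?_)
  · rw [hr]
    -- The assignment e' is extended along the injection e to all of ℕ; the default 0 is taken only
    -- at numbers outside the range of e and is irrelevant.
    refine inf_le_right.trans (le_iSup_of_le
      (fun X n => Function.extend (e X) (e' X) (fun _ => 0) n) (le_of_eq ?_))
    rw [← hψ]
    refine congrArg _ (funext fun X => funext fun v => ?_)
    exact (Function.Injective.extend_apply (fun v w hvw => he X v w hvw) _ _ v).symm
  · refine Formula.le_eval_exs _ _ (fun X v => y X (e X v)) le_top ?_ ?_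
    · refine (Env.le_exist_iff _).2 fun X v => ?_
      -- Each variable names a number in some g ∈ J, and g[y] entails that the substituted number
      -- denotes.
      obtain ⟨g, hg, hp⟩ := mem.1 ((h (X, e X v)).2 ⟨v, rfl⟩)
      exact (Finset.inf_le hg).trans (gen_le_of_mem_names T (Gen.mem_names_subst y hp))
    · rw [hr, hψ]

/-- The closure preserves joins, so a fixed point is the join of the closures of the finite meets
below it, that is, a set-indexed disjunction of sentences. -/
theorem exists_sentence {u : (P T).Opens} (hu : isoClosure T u = u) :
    ∃ φ : Sentence T, φ.toOpen = u := by
  choose φ hφ using exists_sentence_inf_gen (T := T)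
  refine ⟨Formula.sup {J : Finset (Gen T.sig) // OrderDual.toDual J ∈ u.1} fun J => φ J.1, ?_⟩
  refine Eq.trans ?_ hu
  conv_rhs => rw [PropTheory.eq_iSup u, isoClosure_iSup]
  exact iSup_congr fun J => hφ J.1

/-- A fixed point is invariant because it is the value of a sentence. The converse is adjointness
alone. -/
theorem isoClosure_eq_self_iff {u : (P T).Opens} :
    isoClosure T u = u ↔ copyHom T false u = copyHom T true u := by
  constructor
  · intro hu
    obtain ⟨φ, rfl⟩ := exists_sentence hu
    exact copyHom_toOpen φ
  · intro hu
    refine le_antisymm ((sectionJoin_gc _ _).2 hu.ge) ((isoClosure T).le_closure u)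

end adjoint

/-! ### The coequaliser -/

section coequalizer

variable (T : Theory.{u})

theorem condition_incl :
    source T ≫ locHom (EqFrame.incl (copyHom T false) (copyHom T true)) =
      target T ≫ locHom (EqFrame.incl (copyHom T false) (copyHom T true)) :=
  Quiver.Hom.unop_inj (ConcreteCategory.hom_ext _ _ fun x => x.property)

theorem frameMap_quot_condition (U : π₀ T) :
    copyHom T false (frameMap (quot T) U) = copyHom T true (frameMap (quot T) U) :=
  congrArg (fun f => frameMap f U) (coequalizer.condition (source T) (target T))

theorem exists_frameMap_quot {u : (P T).Opens} (h : copyHom T false u = copyHom T true u) :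
    ∃ U : π₀ T, frameMap (quot T) U = u :=
  ⟨frameMap (coequalizer.desc _ (condition_incl T))
      (⟨u, h⟩ : EqFrame (copyHom T false) (copyHom T true)),
    congrArg (fun f => frameMap f (⟨u, h⟩ : EqFrame (copyHom T false) (copyHom T true)))
      (coequalizer.π_desc _ (condition_incl T))⟩

/-- O(π₀) is a retract of the explicit equaliser frame, by `hm`, and the order of the latter is
inherited from O(G₀). -/
theorem frameMap_quot_le_iff {U V : π₀ T} :
    frameMap (quot T) U ≤ frameMap (quot T) V ↔ U ≤ V := by
  refine ⟨fun h => ?_, fun h => OrderHomClass.mono (frameMap (quot T)) h⟩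
  let m : Locale.of (EqFrame (copyHom T false) (copyHom T true)) ⟶ π₀ T :=
    locHom (EqFrame.lift (copyHom T false) (copyHom T true) (frameMap (quot T))
      (frameMap_quot_condition T))
  have hm : coequalizer.desc _ (condition_incl T) ≫ m = 𝟙 (π₀ T) :=
    coequalizer.hom_ext (by
      erw [coequalizer.π_desc_assoc, Category.comp_id]
      exact Quiver.Hom.unop_inj (ConcreteCategory.hom_ext _ _ fun x => rfl))
  have h₁ : ∀ U : π₀ T, frameMap (coequalizer.desc _ (condition_incl T)) (frameMap m U) = U :=
    fun U => congrArg (fun f => frameMap f U) hm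
  rw [← h₁ U, ← h₁ V]
  exact OrderHomClass.mono (frameMap (coequalizer.desc _ (condition_incl T)))
    (show frameMap m U ≤ frameMap m V from h)

/-- `O(π₀)` is the lattice of fixed points of `s_! t^*`. -/
noncomputable def quotIso : π₀ T ≃o {u : G₀ T // isoClosure T u = u} :=
  RelIso.ofSurjective
    (⟨⟨fun U => ⟨frameMap (quot T) U, isoClosure_eq_self_iff.2 (frameMap_quot_condition T U)⟩,
      fun _ _ h => le_antisymm ((frameMap_quot_le_iff T).1 (congrArg Subtype.val h).le)
        ((frameMap_quot_le_iff T).1 (congrArg Subtype.val h).ge)⟩, frameMap_quot_le_iff T⟩ :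
      π₀ T ↪o {u : G₀ T // isoClosure T u = u})
    fun u => (exists_frameMap_quot T (isoClosure_eq_self_iff.1 u.2)).imp fun _ h => Subtype.ext h

theorem quotIso_apply (U : π₀ T) : (quotIso T U : G₀ T) = frameMap (quot T) U := rfl

/-- The frame of sentences is the lattice of fixed points of `s_! t^*`. -/
noncomputable def sentenceIso : SentenceFrame T ≃o {u : G₀ T // isoClosure T u = u} :=
  RelIso.ofSurjective
    (⟨⟨fun φ => ⟨(ofAntisymmetrization (· ≤ ·) φ).toOpen, isoClosure_toOpen _⟩, fun φ ψ h => by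
      have h := congrArg Subtype.val h
      refine le_antisymm ?_ ?_
      · exact ofAntisymmetrization_le_ofAntisymmetrization_iff.1 (Sentence.le_of_toOpen_le h.le)
      · exact ofAntisymmetrization_le_ofAntisymmetrization_iff.1 (Sentence.le_of_toOpen_le h.ge)⟩,
      fun {φ ψ} => Sentence.toOpen_le_iff.trans ofAntisymmetrization_le_ofAntisymmetrization_iff⟩ :
      SentenceFrame T ↪o {u : G₀ T // isoClosure T u = u})
    fun u => by
      obtain ⟨φ, hφ⟩ := exists_sentence u.2
      refine ⟨toAntisymmetrization (· ≤ ·) φ, Subtype.ext (Eq.trans (le_antisymm ?_ ?_) hφ)⟩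
      · exact Sentence.toOpen_mono (toAntisymmetrization_le_toAntisymmetrization_iff.1
          (toAntisymmetrization_ofAntisymmetrization _ _).le)
      · exact Sentence.toOpen_mono (toAntisymmetrization_le_toAntisymmetrization_iff.1
          (toAntisymmetrization_ofAntisymmetrization _ _).ge)

/-- The frame of sentences is `O(π₀)`. -/
noncomputable def sentenceQuotIso : SentenceFrame T ≃o π₀ T :=
  (sentenceIso T).trans (quotIso T).symm

variable {T}

theorem frameMap_quot_sentenceQuotIso (φ : Sentence T) :
    frameMap (quot T) (sentenceQuotIso T (toAntisymmetrization (· ≤ ·) φ)) = φ.toOpen := by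
  rw [← quotIso_apply, sentenceQuotIso, OrderIso.trans_apply, OrderIso.apply_symm_apply]
  refine le_antisymm ?_ ?_
  · exact Sentence.toOpen_mono (toAntisymmetrization_le_toAntisymmetrization_iff.1
      (toAntisymmetrization_ofAntisymmetrization _ _).le)
  · exact Sentence.toOpen_mono (toAntisymmetrization_le_toAntisymmetrization_iff.1
      (toAntisymmetrization_ofAntisymmetrization _ _).ge)

end coequalizer

end GeometricLogic

namespace GeometricLogic

open Formula Provable

/-! ### Essential smallness of the syntactic category -/

/-- Regular formulae: the geometric formulae without disjunctions. -/
inductive RegularFormula (A : Signature.{u}) : List A.Srt → Type u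
  | top {Γ : List A.Srt} : RegularFormula A Γ
  | and {Γ : List A.Srt} (φ ψ : RegularFormula A Γ) : RegularFormula A Γ
  | eq {Γ : List A.Srt} {X : A.Srt} (x y : Var Γ X) : RegularFormula A Γ
  | rel {Γ : List A.Srt} (R : A.Rel) (x : ∀ i, Var Γ (A.dom R i)) : RegularFormula A Γ
  | ex {Γ : List A.Srt} (X : A.Srt) (φ : RegularFormula A (X :: Γ)) : RegularFormula A Γ

/-- A regular formula as a geometric formula. -/
def RegularFormula.toFormula {A : Signature.{u}} :
    {Γ : List A.Srt} → RegularFormula A Γ → Formula A Γ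
  | _, .top => .top
  | _, .and φ ψ => .and φ.toFormula ψ.toFormula
  | _, .eq x y => .eq x y
  | _, .rel R x => .rel R x
  | _, .ex X φ => .ex X φ.toFormula

/-- The disjunction of a set of regular formulae. -/
def disj {A : Signature.{u}} {Γ : List A.Srt} (S : Set (RegularFormula A Γ)) : Formula A Γ :=
  .sup S fun φ => φ.1.toFormula

variable {T : Theory.{u}} {Γ : List T.sig.Srt}

theorem disj_intro {S : Set (RegularFormula T.sig Γ)} {φ : RegularFormula T.sig Γ} (h : φ ∈ S) :
    Provable T φ.toFormula (disj S) :=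
  sup_intro (fun φ : S => φ.1.toFormula) ⟨φ, h⟩

theorem disj_elim {S : Set (RegularFormula T.sig Γ)} {ψ : Formula T.sig Γ}
    (h : ∀ φ ∈ S, Provable T φ.toFormula ψ) : Provable T (disj S) ψ :=
  sup_elim fun φ : S => h φ.1 φ.2

theorem Provable.ex_mono {X : T.sig.Srt} {φ ψ : Formula T.sig (X :: Γ)} (h : Provable T φ ψ) :
    Provable T (ex X φ) (ex X ψ) :=
  ex_elim (cut h (ex_intro (Provable.refl _)))

/-- Every geometric formula is provably equivalent to a disjunction of regular formulae. -/
theorem exists_disj (φ : Formula T.sig Γ) :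
    ∃ S : Set (RegularFormula T.sig Γ), Provable T φ (disj S) ∧ Provable T (disj S) φ := by
  have atom : ∀ {Γ : List T.sig.Srt} (φ : RegularFormula T.sig Γ),
      ∃ S : Set (RegularFormula T.sig Γ),
        Provable T φ.toFormula (disj S) ∧ Provable T (disj S) φ.toFormula := fun φ =>
    ⟨{φ}, disj_intro rfl, disj_elim fun ψ h => by rw [Set.mem_singleton_iff.1 h]; exact .refl _⟩
  induction φ with
  | top => exact atom .top
  | and φ ψ h₁ h₂ =>
    obtain ⟨S, hS, hS'⟩ := h₁
    obtain ⟨S', hS₂, hS₂'⟩ := h₂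
    -- Distributivity: all pairwise conjunctions of the disjuncts.
    refine ⟨Set.image2 .and S S', ?_, disj_elim ?_⟩
    · refine SynCat.sup_cases (cut (and_right _ _) hS₂) fun j χ h₁ h₂ => ?_
      refine SynCat.sup_cases (cut (cut h₁ (and_left _ _)) hS) fun i χ' h₃ h₄ => ?_
      exact cut (and_intro h₄ (cut h₃ h₂)) (disj_intro (φ := .and i.1 j.1)
        (Set.mem_image2_of_mem i.2 j.2))
    · rintro _ ⟨a, ha, b, hb, rfl⟩
      exact and_mono (cut (disj_intro ha) hS') (cut (disj_intro hb) hS₂')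
  | sup ι φ ih =>
    choose S hS hS' using ih
    refine ⟨⋃ i, S i, sup_elim fun i => cut (hS i) (disj_elim fun ψ h =>
      disj_intro (Set.mem_iUnion_of_mem i h)), disj_elim fun ψ h => ?_⟩
    obtain ⟨i, hi⟩ := Set.mem_iUnion.1 h
    exact cut (disj_intro hi) (cut (hS' i) (sup_intro φ i))
  | eq x y => exact atom (.eq x y)
  | rel R x => exact atom (.rel R x)
  | ex X φ ih =>
    obtain ⟨S, hS, hS'⟩ := ih
    refine ⟨RegularFormula.ex X '' S, ex_elim (cut hS (disj_elim fun ψ h => ?_)), disj_elim ?_⟩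
    · exact cut (ex_intro (φ := ψ.toFormula) (.refl _))
        (subst _ (disj_intro (Set.mem_image_of_mem (RegularFormula.ex X) h)))
    · rintro _ ⟨ψ, h, rfl⟩
      exact ex_mono (cut (disj_intro h) hS')

/-! ### Small hom-sets and a small skeleton. -/

namespace SynCat

/-- One implication suffices, since a functional relation contained in another with the same source
and target equals it. -/
theorem Func.hom_eq {B C : SynCat T} {θ θ' : Func B C} (h : Provable T θ.1 θ'.1) :
    Func.hom θ = Func.hom θ' :=
  Quotient.sound ⟨h, θ.2.le_symm θ'.2 h⟩

theorem comp_subst_id {φ ψ : Formula T.sig Γ} :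
    Provable T (compForm (B := ⟨Γ, φ⟩) (C := ⟨Γ, ψ⟩) (D := ⟨Γ, φ⟩)
      (substForm ⟨Γ, φ⟩ fun _ v => v) (substForm ⟨Γ, ψ⟩ fun _ v => v)) (idForm ⟨Γ, φ⟩) := by
  refine le_of_generic (comp_elim (generic _) fun χ' up h₁ h₂ => ?_)
  obtain ⟨h₁, e₁⟩ := substForm_at.1 h₁
  obtain ⟨-, e₂⟩ := substForm_at.1 h₂
  have e : ∀ X v, Provable T χ' _ := fun X v => eq_trans (e₂ X v) (e₁ X v)
  rw [rename_at]
  exact idForm_at.2 ⟨replace (fun X v => eq_symm (e X v)) h₁, e⟩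

/-- The identity substitution as a functional formula, for provable implications. -/
def funcOfProvable {φ ψ : Formula T.sig Γ} (h : Provable T φ ψ) :
    Func (⟨Γ, φ⟩ : SynCat T) ⟨Γ, ψ⟩ :=
  ⟨_, isFunctional_subst (B := ⟨Γ, φ⟩) (C := ⟨Γ, ψ⟩) (fun _ v => v) (by rw [rename_id]; exact h)⟩

theorem funcOfProvable_comp {φ ψ : Formula T.sig Γ} (h : Provable T φ ψ) (h' : Provable T ψ φ) :
    (funcOfProvable h).hom ≫ (funcOfProvable h').hom = 𝟙 _ :=
  Func.hom_eq (θ := ⟨_, isFunctional_comp (funcOfProvable h).2 (funcOfProvable h').2⟩)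
    (θ' := ⟨_, isFunctional_id _⟩) comp_subst_id

/-- Objects with provably equivalent formulae are isomorphic. -/
def isoOfEquiv {φ ψ : Formula T.sig Γ} (h : Provable T φ ψ) (h' : Provable T ψ φ) :
    (⟨Γ, φ⟩ : SynCat T) ≅ ⟨Γ, ψ⟩ where
  hom := (funcOfProvable h).hom
  inv := (funcOfProvable h').hom
  hom_inv_id := funcOfProvable_comp h h'
  inv_hom_id := funcOfProvable_comp h' h

/-- Geometric formulae form a type in universe `u + 1`, but regular formulae and sets of them live
in universe `u`. By `exists_disj`, such a set determines a morphism. -/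
instance (T : Theory.{u}) : LocallySmall.{u} (SynCat T) where
  hom_small B C := by
    choose S hS hS' using fun φ : Formula T.sig (C.ctx ++ B.ctx) => exists_disj φ
    refine small_of_injective (β := Set (RegularFormula T.sig (C.ctx ++ B.ctx)))
      (f := fun f : B ⟶ C => S (Quotient.out (s := funcSetoid B C) f).1) fun f g h => ?_
    simp only at h
    rw [← Quotient.out_eq (s := funcSetoid B C) f, ← Quotient.out_eq (s := funcSetoid B C) g]
    refine Func.hom_eq ?_
    have := hS (Quotient.out (s := funcSetoid B C) f).1
    rw [h] at this
    exact cut this (hS' _)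

instance (T : Theory.{u}) : EssentiallySmall.{u} (SynCat T) := by
  refine (essentiallySmall_iff _).2 ⟨?_, inferInstance⟩
  refine small_of_surjective (f := fun p : Σ Γ : List T.sig.Srt, Set (RegularFormula T.sig Γ) =>
    toSkeleton (⟨p.1, disj p.2⟩ : SynCat T)) fun X => ?_
  obtain ⟨S, hS, hS'⟩ := exists_disj ((fromSkeleton (SynCat T)).obj X).formula
  refine ⟨⟨_, S⟩, ?_⟩
  exact (congr_toSkeleton_of_iso (isoOfEquiv hS' hS)).trans (toSkeleton_fromSkeleton_obj X)

/-- Used to construct the inverse image functor of `toSheaves`. -/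
instance (T : Theory.{u}) : HasSheafify (SynCat.topology T) (Type u) :=
  hasSheafifyEssentiallySmallSite (SynCat.topology T) (Type u)

end SynCat

end GeometricLogic

namespace GeometricLogic

open Formula Provable

/-! ### Subterminal objects of the classifying topos -/

/-! ### Sheaves with at most one section. -/

section

variable {C : Type*} [Category* C] {J : GrothendieckTopology C}

/-- Arbitrarily chosen local sections are compatible by uniqueness, and hence glue. -/
theorem nonempty_of_covering {P : Cᵒᵖ ⥤ Type u} (hP : Presheaf.IsSheaf J P)
    (h : ∀ X, Subsingleton (P.obj X)) {X : C} {S : Sieve X} (hS : S ∈ J X)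
    (hX : ∀ ⦃Y : C⦄ (f : Y ⟶ X), S f → Nonempty (P.obj (.op Y))) : Nonempty (P.obj (.op X)) := by
  obtain ⟨t, -⟩ := ((isSheaf_iff_isSheaf_of_type J P).1 hP S hS)
    (fun Y f hf => (hX f hf).some) (fun _ _ _ _ _ _ _ _ _ _ => Subsingleton.elim _ _)
  exact ⟨t⟩

/-- The presheaf with at most one section, which has a section exactly on the objects with the
stable property `p`. -/
def propPresheaf (p : C → Prop) (hp : ∀ {X Y : C}, (X ⟶ Y) → p Y → p X) : Cᵒᵖ ⥤ Type u where
  obj X := ULift (PLift (p X.unop))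
  map f := ↾fun x => ⟨⟨hp f.unop x.down.down⟩⟩

theorem propPresheaf_isSheaf {p : C → Prop} {hp : ∀ {X Y : C}, (X ⟶ Y) → p Y → p X}
    (h : ∀ {X : C} {S : Sieve X}, S ∈ J X → (∀ ⦃Y : C⦄ (f : Y ⟶ X), S f → p Y) → p X) :
    Presheaf.IsSheaf J (propPresheaf.{u} p hp) := by
  refine (isSheaf_iff_isSheaf_of_type J _).2 fun X S hS x _ => ?_
  exact ⟨⟨⟨h hS fun Y f hf => (x f hf).down.down⟩⟩, fun _ _ _ => rfl, fun _ _ => rfl⟩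

/-- The sheaf with at most one section, which has a section exactly on the objects with the
stable and local property `p`. -/
def propSheaf (J : GrothendieckTopology C) (p : C → Prop)
    (hp : ∀ {X Y : C}, (X ⟶ Y) → p Y → p X)
    (h : ∀ {X : C} {S : Sieve X}, S ∈ J X → (∀ ⦃Y : C⦄ (f : Y ⟶ X), S f → p Y) → p X) :
    Sheaf J (Type u) :=
  ⟨propPresheaf p hp, propPresheaf_isSheaf h⟩

variable {p : C → Prop} {hp : ∀ {X Y : C}, (X ⟶ Y) → p Y → p X}
    {h : ∀ {X : C} {S : Sieve X}, S ∈ J X → (∀ ⦃Y : C⦄ (f : Y ⟶ X), S f → p Y) → p X}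

instance (X : Cᵒᵖ) : Subsingleton ((propSheaf.{u} J p hp h).obj.obj X) :=
  inferInstanceAs (Subsingleton (ULift.{u} (PLift (p X.unop))))

/-- Morphisms into a sheaf with at most one section. -/
noncomputable def homOfNonempty {F P : Sheaf J (Type u)} [∀ X, Subsingleton (P.obj.obj X)]
    (h : ∀ X, F.obj.obj X → Nonempty (P.obj.obj X)) : F ⟶ P :=
  ⟨{ app := fun X => ↾fun x => (h X x).some
     naturality := fun _ _ _ => by ext; exact Subsingleton.elim _ _ }⟩

theorem hom_subsingleton {F P : Sheaf J (Type u)} [∀ X, Subsingleton (P.obj.obj X)] (f g : F ⟶ P) :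
    f = g := by
  refine Sheaf.hom_ext (NatTrans.ext (funext fun X => ?_))
  ext
  exact Subsingleton.elim _ _

/-- A terminal sheaf is a retract of the sheaf with exactly one section everywhere. -/
theorem subsingleton_of_isTerminal {F : Sheaf J (Type u)} (hF : IsTerminal F) (X : Cᵒᵖ) :
    Subsingleton (F.obj.obj X) := by
  let U : Sheaf J (Type u) := propSheaf J (fun _ => True) (fun _ _ => trivial) fun _ _ => trivial
  let i : U ⟶ F := hF.from _
  let j : F ⟶ U := homOfNonempty fun _ _ => ⟨⟨⟨trivial⟩⟩⟩
  have hij : j ≫ i = 𝟙 F := hF.hom_ext _ _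
  refine ⟨fun a b => ?_⟩
  have h₁ : ∀ a, i.hom.app X (j.hom.app X a) = a := fun a =>
    congrArg (fun f : F ⟶ F => f.hom.app X a) hij
  rw [← h₁ a, ← h₁ b, Subsingleton.elim (j.hom.app X a) (j.hom.app X b)]

theorem injective_of_mono {F G : Sheaf J (Type u)} (f : F ⟶ G) [Mono f] (X : Cᵒᵖ) :
    Function.Injective (f.hom.app X) := by
  have : Mono ((sheafToPresheaf J (Type u)).map f) := inferInstance
  have := (NatTrans.mono_iff_mono_app _).1 this X
  exact (mono_iff_injective _).1 this

theorem subsingleton_of_mono {F G : Sheaf J (Type u)} (f : F ⟶ G) [Mono f]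
    (h : ∀ X, Subsingleton (G.obj.obj X)) (X : Cᵒᵖ) : Subsingleton (F.obj.obj X) :=
  (injective_of_mono f X).subsingleton

end

variable {T : Theory.{u}}

/-! ### Sentences as objects of the syntactic site. -/

namespace SynCat

/-- The only substitution on the empty context. -/
def _root_.GeometricLogic.Ren.nil {S : Type u} {Γ : List S} : Ren [] Γ := fun _ v => nomatch v

theorem _root_.GeometricLogic.Sentence.provable_rename_iff {Γ : List T.sig.Srt}
    {χ : Formula T.sig Γ} (φ : Sentence T) (r : Ren [] Γ) :
    Provable T χ (Formula.rename (Γ := []) φ r) ↔ Provable T χ (φ.weaken Γ) := by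
  have : r = fun _ v => nomatch v := funext fun X => funext fun v => nomatch v
  rw [this]
  exact Iff.rfl

/-- The object `{[] . φ}` given by a sentence. -/
abbrev ofSentence (φ : Sentence T) : SynCat T := ⟨[], φ⟩

theorem provable_of_hom {B : SynCat T} {φ : Sentence T} (f : B ⟶ ofSentence φ) :
    Provable T B.formula (φ.weaken B.ctx) := by
  induction f using Quotient.inductionOn with | _ θ
  exact (φ.provable_rename_iff _).1 (cut θ.2.total θ.2.cod)

/-- The functional formula to `{[] . φ}` given by a proof of `φ`. -/
def funcOfSentence {B : SynCat T} {φ : Sentence T} (h : Provable T B.formula (φ.weaken B.ctx)) :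
    Func B (ofSentence φ) :=
  ⟨_, isFunctional_subst (B := B) (C := ofSentence φ) Ren.nil ((φ.provable_rename_iff _).2 h)⟩

/-- The morphism to `{[] . φ}` given by a proof of `φ`. -/
def homOfProvable {B : SynCat T} {φ : Sentence T} (h : Provable T B.formula (φ.weaken B.ctx)) :
    B ⟶ ofSentence φ :=
  (funcOfSentence h).hom

theorem image_funcOfSentence {B : SynCat T} {φ : Sentence T} {Ξ : List T.sig.Srt}
    (h : Provable T B.formula (φ.weaken B.ctx)) (r : Ren B.ctx Ξ) (s : Ren [] Ξ) :
    Provable T (B.formula.rename r) ((image (funcOfSentence h)).rename s) :=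
  image_intro r ((substForm_at (B := B) (Γ := [])).2 ⟨Provable.refl _, fun _ v => nomatch v⟩)

theorem nonempty_hom_iff {B : SynCat T} {φ : Sentence T} :
    Nonempty (B ⟶ ofSentence φ) ↔ Provable T B.formula (φ.weaken B.ctx) :=
  ⟨fun ⟨f⟩ => provable_of_hom f, fun h => ⟨homOfProvable h⟩⟩

/-- With an empty target context, a functional formula is provably equivalent to the formula of its
source. -/
instance {B : SynCat T} {φ : Sentence T} : Subsingleton (B ⟶ ofSentence φ) := by
  refine ⟨fun f g => ?_⟩
  induction f using Quotient.inductionOn with | _ θ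
  induction g using Quotient.inductionOn with | _ θ'
  refine Func.hom_eq (cut θ.2.dom (cut ?_ θ'.2.total))
  exact (congrArg (Provable T · B.formula) (rename_id B.formula)).mpr (Provable.refl B.formula)

theorem nonempty_hom_iff_le {φ ψ : Sentence T} :
    Nonempty (ofSentence φ ⟶ ofSentence ψ) ↔ φ ≤ ψ := by
  rw [nonempty_hom_iff, Sentence.weaken_nil]
  exact Iff.rfl

/-- The existential closure of the formula of an object. -/
def support (B : SynCat T) : Sentence T := exs B.ctx (B.formula.rename fun _ v => v.inl [])

/-- Existential closure is left adjoint to weakening. The remaining work identifies the context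
`B.ctx ++ []` with `B.ctx` by substitutions. -/
theorem support_le_iff {B : SynCat T} {φ : Sentence T} :
    B.support ≤ φ ↔ Provable T B.formula (φ.weaken B.ctx) := by
  refine (exs_adj (T := T) (Γ := []) (Δ := B.ctx) (ψ := φ)).trans
    ((φ.provable_rename_iff _).trans ⟨fun h => ?_, fun h => ?_⟩)
  · have := subst (Ren.copair (fun _ v => v) Ren.nil : Ren (B.ctx ++ []) B.ctx) h
    rw [rename_rename, Sentence.weaken_rename] at this
    simpa only [Ren.copair_inl, rename_id] using this
  · have := subst (fun _ v => v.inl [] : Ren B.ctx (B.ctx ++ [])) h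
    rwa [Sentence.weaken_rename] at this

theorem provable_support (B : SynCat T) : Provable T B.formula (B.support.weaken B.ctx) :=
  support_le_iff.1 le_rfl

/-- A sieve containing a covering family is covering. -/
theorem mem_topology {B : SynCat T} {S : Sieve B} {I : Type u} {A : I → SynCat T}
    (θ : ∀ i, Func (A i) B) (hS : ∀ i, S (θ i).hom) (hθ : IsCovering θ) :
    S ∈ SynCat.topology T B :=
  ⟨I, A, θ, hS, hθ⟩

/-- Provability of a sentence is a local property of the object; this makes the presheaf of its
proofs a sheaf. -/
theorem provable_of_covering {B : SynCat T} {S : Sieve B} (hS : S ∈ SynCat.topology T B)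
    {φ : Sentence T} (h : ∀ ⦃A : SynCat T⦄ (f : A ⟶ B), S f →
      Provable T A.formula (φ.weaken A.ctx)) : Provable T B.formula (φ.weaken B.ctx) := by
  obtain ⟨I, A, θ, hS, hθ⟩ := hS
  refine hθ.cases (b := fun _ v => v) (by rw [rename_id]; exact Provable.refl _)
    fun i χ' up h₁ => ?_
  have h₂ := cut ((θ i).2.dom_at h₁) (subst _ (h _ (hS i)))
  rwa [Sentence.weaken_rename] at h₂ ⊢

/-- A sieve on `{[] . B.support}` containing the morphism from `B` is covering. -/
theorem mem_topology_support {B : SynCat T} {S : Sieve (ofSentence B.support)}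
    (hS : S (homOfProvable B.provable_support)) : S ∈ SynCat.topology T (ofSentence B.support) := by
  refine mem_topology (I := PUnit) (A := fun _ => B) (fun _ => funcOfSentence B.provable_support)
    (fun _ => hS) ?_
  refine (exs_adj (T := T) (Γ := []) (Δ := B.ctx)).2 ?_
  exact cut (image_funcOfSentence _ _ _) (subst _ (sup_intro
    (fun _ : PUnit => image (funcOfSentence B.provable_support)) PUnit.unit))

theorem mem_topology_sentence {φ : Sentence T} {S : Sieve (ofSentence φ)} {I : Type u}
    {ψ : I → Sentence T} (f : ∀ i, ofSentence (ψ i) ⟶ ofSentence φ) (hS : ∀ i, S (f i))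
    (h : Provable T (Γ := []) φ (.sup I ψ)) : S ∈ SynCat.topology T (ofSentence φ) := by
  refine mem_topology (fun i => funcOfSentence (provable_of_hom (f i))) (fun i => ?_) ?_
  · have : (funcOfSentence (provable_of_hom (f i))).hom = f i := Subsingleton.elim _ _
    rw [this]
    exact hS i
  · refine cut h (sup_elim fun i => cut ?_ (sup_intro _ i))
    have := image_funcOfSentence (provable_of_hom (f i)) (fun _ v => v) (fun _ v => v)
    rw [rename_id, rename_id] at this
    exact this

end SynCat

open SynCat

/-- A sentence representing an element of `O(π₀)`. -/
noncomputable def rep (U : π₀ T) : Sentence T :=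
  ofAntisymmetrization (· ≤ ·) ((sentenceQuotIso T).symm U)

/-- The element of `O(π₀)` given by a sentence. -/
noncomputable def Sentence.toQuot (φ : Sentence T) : π₀ T :=
  sentenceQuotIso T (toAntisymmetrization (· ≤ ·) φ)

theorem toQuot_rep (U : π₀ T) : (rep U).toQuot = U := by
  rw [Sentence.toQuot, rep, toAntisymmetrization_ofAntisymmetrization, OrderIso.apply_symm_apply]

theorem Sentence.toQuot_le_toQuot {φ ψ : Sentence T} : φ.toQuot ≤ ψ.toQuot ↔ φ ≤ ψ :=
  (sentenceQuotIso T).le_iff_le.trans toAntisymmetrization_le_toAntisymmetrization_iff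

theorem Sentence.le_rep_iff {φ : Sentence T} {U : π₀ T} : φ ≤ rep U ↔ φ.toQuot ≤ U := by
  rw [← Sentence.toQuot_le_toQuot, toQuot_rep]

theorem rep_le_rep {U V : π₀ T} : rep U ≤ rep V ↔ U ≤ V := by
  rw [Sentence.le_rep_iff, toQuot_rep]

/-- The object `{[] . φ}` for a sentence `φ` representing `U`. -/
noncomputable abbrev SynCat.ofQuot (U : π₀ T) : SynCat T := ofSentence (rep U)

theorem SynCat.nonempty_hom_ofQuot {B : SynCat T} {U : π₀ T} :
    Nonempty (B ⟶ ofQuot U) ↔ B.support.toQuot ≤ U := by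
  rw [nonempty_hom_iff, ← support_le_iff, Sentence.le_rep_iff]

theorem SynCat.nonempty_ofQuot_hom {U V : π₀ T} :
    Nonempty (ofQuot U ⟶ ofQuot V) ↔ U ≤ V := by
  rw [nonempty_hom_iff_le, rep_le_rep]

/-- A sieve on `{[] . U}` is covering if `U` is the join of members of the sieve. -/
theorem SynCat.mem_topology_ofQuot {U : π₀ T} {S : Sieve (ofQuot U)}
    (h : U ≤ sSup {V | ∃ f : ofQuot V ⟶ ofQuot U, S f}) : S ∈ SynCat.topology T (ofQuot U) := by
  let I := {V : π₀ T // ∃ f : ofQuot V ⟶ ofQuot U, S f}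
  refine mem_topology_sentence (I := I) (fun V => V.2.choose) (fun V => V.2.choose_spec) ?_
  let σ : Sentence T := Formula.sup I fun V => rep V.1
  change rep U ≤ σ
  rw [← Sentence.toQuot_le_toQuot, toQuot_rep]
  refine h.trans (sSup_le fun V hV => ?_)
  rw [← toQuot_rep V, Sentence.toQuot_le_toQuot]
  exact sup_intro (T := T) (Γ := []) (fun V : I => rep V.1) ⟨V, hV⟩

theorem SynCat.nonempty_hom_of_covering {B : SynCat T} {S : Sieve B}
    (hS : S ∈ SynCat.topology T B) {U : π₀ T}
    (h : ∀ ⦃A : SynCat T⦄ (f : A ⟶ B), S f → Nonempty (A ⟶ ofQuot U)) : Nonempty (B ⟶ ofQuot U) :=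
  nonempty_hom_iff.2 (provable_of_covering hS fun _ f hf => nonempty_hom_iff.1 (h f hf))

/-- The subterminal sheaf given by `U`. -/
noncomputable def subterminal (U : π₀ T) : ClassifyingTopos T :=
  propSheaf (SynCat.topology T) (fun B => Nonempty (B ⟶ ofQuot U))
    (fun f h => h.map fun g => f ≫ g) fun hS h => nonempty_hom_of_covering hS h

instance (U : π₀ T) (B : (SynCat T)ᵒᵖ) : Subsingleton ((subterminal U).obj.obj B) :=
  inferInstanceAs (Subsingleton (ULift.{u} (PLift (Nonempty (B.unop ⟶ ofQuot U)))))

theorem nonempty_subterminal_iff {U : π₀ T} {B : SynCat T} :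
    Nonempty ((subterminal U).obj.obj (.op B)) ↔ Nonempty (B ⟶ ofQuot U) :=
  ⟨fun ⟨x⟩ => x.down.down, fun h => ⟨⟨⟨h⟩⟩⟩⟩

/-- The largest element of `O(π₀)` on which a sheaf with at most one section has a section. -/
noncomputable def extent (P : ClassifyingTopos T) : π₀ T :=
  sSup {U : π₀ T | Nonempty (P.obj.obj (.op (ofQuot U)))}

/-! ### The extent of a sheaf with at most one section. -/

section

variable {P : ClassifyingTopos T}

/-- The supremum is attained: the sentences on which P is inhabited cover their disjunction. -/
theorem nonempty_ofQuot_extent (hP : ∀ B, Subsingleton (P.obj.obj B)) :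
    Nonempty (P.obj.obj (.op (ofQuot (extent P)))) := by
  let S : Sieve (ofQuot (extent P)) :=
    { arrows := fun B _ => Nonempty (P.obj.obj (.op B))
      downward_closed := fun h f => h.map (P.obj.map f.op) }
  refine nonempty_of_covering P.property hP (S := S) (mem_topology_ofQuot ?_) fun _ _ h => h
  refine sSup_le_sSup fun V hV => ?_
  exact ⟨(nonempty_ofQuot_hom.2 (le_sSup hV)).some, hV⟩

/-- The object B covers its support, so a section over B descends to a section over a sentence,
which lies below the extent. -/
theorem nonempty_iff_extent (hP : ∀ B, Subsingleton (P.obj.obj B)) {B : SynCat T} :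
    Nonempty (P.obj.obj (.op B)) ↔ Nonempty (B ⟶ ofQuot (extent P)) := by
  refine ⟨fun h => nonempty_hom_ofQuot.2 ?_, fun ⟨f⟩ => (nonempty_ofQuot_extent hP).map
    (P.obj.map f.op)⟩
  let S : Sieve (ofSentence B.support) :=
    { arrows := fun B _ => Nonempty (P.obj.obj (.op B))
      downward_closed := fun h f => h.map (P.obj.map f.op) }
  have h₁ : Nonempty (P.obj.obj (.op (ofSentence B.support))) :=
    nonempty_of_covering P.property hP (S := S) (mem_topology_support h) fun _ _ h => h
  refine le_sSup ?_
  have f : ofQuot B.support.toQuot ⟶ ofSentence B.support :=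
    (nonempty_hom_iff_le.2 (Sentence.toQuot_le_toQuot.1 (toQuot_rep _).le)).some
  exact h₁.map (P.obj.map f.op)

/-- A sheaf with at most one section is determined by its extent. -/
noncomputable def isoSubterminal (hP : ∀ B, Subsingleton (P.obj.obj B)) :
    P ≅ subterminal (extent P) where
  hom := homOfNonempty fun _ x => nonempty_subterminal_iff.2 ((nonempty_iff_extent hP).1 ⟨x⟩)
  inv := homOfNonempty fun _ x => (nonempty_iff_extent hP).2 (nonempty_subterminal_iff.1 ⟨x⟩)
  hom_inv_id := hom_subsingleton _ _
  inv_hom_id := hom_subsingleton _ _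

end

theorem nonempty_subterminal_hom_iff {U V : π₀ T} :
    Nonempty (subterminal U ⟶ subterminal V) ↔ U ≤ V := by
  constructor
  · rintro ⟨f⟩
    obtain ⟨x⟩ := nonempty_subterminal_iff.2 (⟨𝟙 (ofQuot U)⟩ : Nonempty _)
    exact nonempty_ofQuot_hom.1 (nonempty_subterminal_iff.1 ⟨f.hom.app _ x⟩)
  · intro h
    refine ⟨homOfNonempty fun B x => nonempty_subterminal_iff.2 ?_⟩
    obtain ⟨f⟩ := nonempty_subterminal_iff.1 ⟨x⟩
    exact ⟨f ≫ (nonempty_ofQuot_hom.2 h).some⟩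

instance (U : π₀ T) (X : ClassifyingTopos T) (f : subterminal U ⟶ X) : Mono f :=
  ⟨fun _ _ _ => hom_subsingleton _ _⟩

/-- The subterminal objects of the classifying topos are the elements of `O(π₀)`. -/
noncomputable def subobjectIso (T : Theory.{u}) : π₀ T ≃o Subobject (⊤_ ClassifyingTopos T) :=
  have h : ∀ {U V : π₀ T}, Subobject.mk (terminal.from (subterminal U)) ≤
      Subobject.mk (terminal.from (subterminal V)) ↔ U ≤ V := fun {U V} =>
    ⟨fun h => nonempty_subterminal_hom_iff.1 ⟨Subobject.ofMkLEMk _ _ h⟩, fun h =>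
      Subobject.mk_le_mk_of_comm (nonempty_subterminal_hom_iff.2 h).some (Subsingleton.elim _ _)⟩
  RelIso.ofSurjective
    (⟨⟨fun U => Subobject.mk (terminal.from (subterminal U)), fun _ _ e =>
      le_antisymm (h.1 e.le) (h.1 e.ge)⟩, h⟩ : π₀ T ↪o Subobject (⊤_ ClassifyingTopos T))
    fun X => by
      have hX : ∀ B, Subsingleton ((X : ClassifyingTopos T).obj.obj B) :=
        subsingleton_of_mono X.arrow (subsingleton_of_isTerminal terminalIsTerminal)
      refine ⟨extent (X : ClassifyingTopos T), ?_⟩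
      exact (Subobject.mk_eq_mk_of_comm _ X.arrow (isoSubterminal hX).symm
        (Subsingleton.elim _ _)).trans (Subobject.mk_arrow X)

theorem nonempty_subobjectIso_iff {U : π₀ T} {B : SynCat T} :
    Nonempty ((subobjectIso T U : ClassifyingTopos T).obj.obj (.op B)) ↔
      Nonempty (B ⟶ ofQuot U) := by
  have i : (subobjectIso T U : ClassifyingTopos T) ≅ subterminal U :=
    Subobject.underlyingIso (terminal.from (subterminal U))
  exact Iff.trans ⟨fun ⟨x⟩ => ⟨i.hom.hom.app _ x⟩, fun ⟨x⟩ => ⟨i.inv.hom.app _ x⟩⟩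
    nonempty_subterminal_iff

theorem nonempty_subobjectIso_toQuot_iff {φ : Sentence T} {B : SynCat T} :
    Nonempty ((subobjectIso T φ.toQuot : ClassifyingTopos T).obj.obj (.op B)) ↔
      Provable T B.formula (φ.weaken B.ctx) := by
  rw [nonempty_subobjectIso_iff, nonempty_hom_ofQuot, Sentence.toQuot_le_toQuot, support_le_iff]

end GeometricLogic

namespace GeometricLogic

open Formula Provable SynCat

variable {T : Theory.{u}}

/-! ### The localic reflection of the classifying topos -/

variable (T) in
/-- The functor from `O(π₀)` to the syntactic category. -/
noncomputable def sentenceFunctor : π₀ T ⥤ SynCat T where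
  obj U := ofQuot U
  map f := (nonempty_ofQuot_hom.2 f.le).some
  map_id _ := Subsingleton.elim _ _
  map_comp _ _ := Subsingleton.elim _ _

variable (T) in
/-- The functor from the syntactic category to `O(π₀)`, taking an object to its support. -/
noncomputable def supportFunctor : SynCat T ⥤ π₀ T where
  obj B := B.support.toQuot
  map f := homOfLE (nonempty_hom_ofQuot.1 ⟨f ≫ (nonempty_hom_ofQuot.2 le_rfl).some⟩)
  map_id _ := Subsingleton.elim _ _
  map_comp _ _ := Subsingleton.elim _ _

variable (T) in
/-- The support functor is left adjoint to the inclusion of the sentences. -/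
noncomputable def supportAdjunction : supportFunctor T ⊣ sentenceFunctor T :=
  Adjunction.mkOfHomEquiv
    { homEquiv := fun _ _ =>
        { toFun := fun f => (nonempty_hom_ofQuot.2 f.le).some
          invFun := fun f => homOfLE (nonempty_hom_ofQuot.1 ⟨f⟩)
          left_inv := fun _ => Subsingleton.elim _ _
          right_inv := fun _ => Subsingleton.elim (α := _ ⟶ ofQuot _) _ _ }
      homEquiv_naturality_left_symm := fun _ _ => Subsingleton.elim _ _
      homEquiv_naturality_right := fun _ _ => Subsingleton.elim (α := _ ⟶ ofQuot _) _ _ }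

/-- Compatibility uses the left adjoint: two morphisms from W to sentences both factor through the
support of W, where the given family is already compatible. -/
instance sentenceFunctor_isContinuous :
    (sentenceFunctor T).IsContinuous (frameTopology (π₀ T)) (SynCat.topology T) := by
  refine Functor.isContinuous_of_coverPreserving ⟨?_⟩ ⟨?_⟩
  · intro P Z U x hx Y₁ Y₂ W f₁ f₂ g₁ g₂ hg₁ hg₂ e
    let I : π₀ T := (supportFunctor T).obj W
    let i₁ : I ⟶ Y₁ := ((supportAdjunction T).homEquiv _ _).symm f₁
    let i₂ : I ⟶ Y₂ := ((supportAdjunction T).homEquiv _ _).symm f₂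
    let k : W ⟶ (sentenceFunctor T).obj I := (supportAdjunction T).unit.app W
    have h := congrArg (P.obj.map k.op) (hx i₁ i₂ hg₁ hg₂ (Subsingleton.elim _ _))
    have e₁ : f₁ = k ≫ (sentenceFunctor T).map i₁ := Subsingleton.elim (α := _ ⟶ ofQuot _) _ _
    have e₂ : f₂ = k ≫ (sentenceFunctor T).map i₂ := Subsingleton.elim (α := _ ⟶ ofQuot _) _ _
    rw [e₁, e₂, op_comp, op_comp, Functor.map_comp, Functor.map_comp]
    exact h
  · intro U S hS
    refine mem_topology_ofQuot (le_trans hS (sSup_le ?_))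
    rintro V ⟨g, hg⟩
    exact le_sSup ⟨_, Sieve.image_mem_functorPushforward _ _ hg⟩

variable (T) in
/-- The geometric morphism from the classifying topos to the sheaves on `π₀`. -/
noncomputable def toSheaves : GeometricMorphism (ClassifyingTopos T) (Sh (π₀ T)) where
  direct := (sentenceFunctor T).sheafPushforwardContinuous (Type u) (frameTopology (π₀ T))
    (SynCat.topology T)
  inverse := sheafToPresheaf (frameTopology (π₀ T)) (Type u) ⋙
    (Functor.whiskeringLeft _ _ _).obj (supportFunctor T).op ⋙
      presheafToSheaf (SynCat.topology T) (Type u)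
  -- Precomposition turns the adjunction between supports and sentences into one of presheaf
  -- categories; it is composed with sheafification and restricted to sheaves on π₀.
  adj := Adjunction.restrictFullyFaithful (iC := sheafToPresheaf (frameTopology (π₀ T)) (Type u))
    (iD := 𝟭 _)
    (L' := (Functor.whiskeringLeft _ _ _).obj (supportFunctor T).op ⋙
      presheafToSheaf (SynCat.topology T) (Type u))
    (R' := sheafToPresheaf (SynCat.topology T) (Type u) ⋙
      (Functor.whiskeringLeft _ _ _).obj (sentenceFunctor T).op)
    (((supportAdjunction T).op.whiskerLeft (Type u)).comp (sheafificationAdjunction _ _))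
    (fullyFaithfulSheafToPresheaf _ _) (Functor.FullyFaithful.id _) (Iso.refl _) (Iso.refl _)
  lex := inferInstance

/-! ### Yoneda for subterminal sheaves, and left exact functors. -/

section

variable {C : Type*} [Category* C] {J : GrothendieckTopology C} {P F : Sheaf J (Type u)}

/-- The Yoneda lemma for a sheaf `P` isomorphic to a subterminal representable presheaf. -/
noncomputable def sectionEquiv {X : C} [hX : ∀ B, Subsingleton (B ⟶ X)]
    (hP : ∀ B, Subsingleton (P.obj.obj B))
    (h : ∀ B, Nonempty (P.obj.obj (.op B)) ↔ Nonempty (B ⟶ X)) :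
    (P ⟶ F) ≃ F.obj.obj (.op X) where
  toFun f := f.hom.app _ ((h X).2 ⟨𝟙 X⟩).some
  invFun z := ⟨{
    app := fun B => ↾fun x => F.obj.map ((h B.unop).1 ⟨x⟩).some.op z
    naturality := fun B B' k => by
      ext x
      change F.obj.map _ z = F.obj.map k (F.obj.map _ z)
      rw [← Functor.map_comp_apply]
      exact congrArg (fun i : B'.unop ⟶ X => F.obj.map i.op z) (Subsingleton.elim _ _) }⟩
  left_inv f := by
    refine Sheaf.hom_ext (NatTrans.ext (funext fun B => ?_))
    ext x
    change F.obj.map _ (f.hom.app _ _) = _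
    rw [← NatTrans.naturality_apply]
    exact congrArg _ (Subsingleton.elim _ _)
  right_inv z := by
    change F.obj.map _ z = z
    have : ((h X).1 ⟨((h X).2 ⟨𝟙 X⟩).some⟩).some = 𝟙 X := Subsingleton.elim _ _
    rw [this]
    exact Functor.map_id_apply _ _ _

theorem sectionEquiv_comp {P' : Sheaf J (Type u)} {X X' : C} [∀ B, Subsingleton (B ⟶ X)]
    [∀ B, Subsingleton (B ⟶ X')] (hP : ∀ B, Subsingleton (P.obj.obj B))
    (h : ∀ B, Nonempty (P.obj.obj (.op B)) ↔ Nonempty (B ⟶ X))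
    (hP' : ∀ B, Subsingleton (P'.obj.obj B))
    (h' : ∀ B, Nonempty (P'.obj.obj (.op B)) ↔ Nonempty (B ⟶ X')) (k : P' ⟶ P) (i : X' ⟶ X)
    (f : P ⟶ F) : sectionEquiv hP' h' (k ≫ f) = F.obj.map i.op (sectionEquiv hP h f) := by
  change f.hom.app _ (k.hom.app _ _) = F.obj.map i.op (f.hom.app _ _)
  rw [← NatTrans.naturality_apply]
  exact congrArg _ (Subsingleton.elim _ _)

/-- Having at most one section means being a subobject of the terminal sheaf, and left exact
functors preserve monomorphisms and terminal objects. -/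
theorem subsingleton_map {D : Type*} [Category* D] {K : GrothendieckTopology D}
    (G : Sheaf J (Type u) ⥤ Sheaf K (Type u)) [PreservesFiniteLimits G]
    (hP : ∀ B, Subsingleton (P.obj.obj B)) (B : Dᵒᵖ) : Subsingleton ((G.obj P).obj.obj B) := by
  have : Mono (terminal.from P) := ⟨fun _ _ _ => hom_subsingleton _ _⟩
  have : Mono (G.map (terminal.from P)) := inferInstance
  exact subsingleton_of_mono (G.map (terminal.from P))
    (subsingleton_of_isTerminal (terminalIsTerminal.isTerminalObj G _)) B

end

/-! ### Opens of a locale as subterminal sheaves. -/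

section

variable {L : Locale.{u}}

/-- The subterminal sheaf on `L` given by an open. -/
def openSheaf (V : L) : Sh L :=
  propSheaf (frameTopology L) (· ≤ V) (fun f h => f.le.trans h)
    fun hS h => le_trans hS (sSup_le fun _ ⟨f, hf⟩ => h f hf)

instance (V : L) (W : (L : Type u)ᵒᵖ) : Subsingleton ((openSheaf V).obj.obj W) :=
  inferInstanceAs (Subsingleton (ULift.{u} (PLift (W.unop ≤ V))))

theorem nonempty_openSheaf_iff (V W : L) :
    Nonempty ((openSheaf V).obj.obj (.op W)) ↔ Nonempty (W ⟶ V) :=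
  ⟨fun ⟨x⟩ => ⟨homOfLE x.down.down⟩, fun ⟨f⟩ => ⟨⟨⟨f.le⟩⟩⟩⟩

/-- The morphism of subterminal sheaves given by an inclusion of opens. -/
noncomputable def openSheafMap {V W : L} (h : V ≤ W) : openSheaf V ⟶ openSheaf W :=
  homOfNonempty fun _ x => ⟨⟨⟨le_trans x.down.down h⟩⟩⟩

/-- The sheaf given by the largest open is terminal. -/
noncomputable def isTerminalOpenSheafTop : IsTerminal (openSheaf (⊤ : L)) :=
  IsTerminal.ofUniqueHom (fun _ => homOfNonempty fun _ _ => ⟨⟨⟨le_top⟩⟩⟩)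
    fun _ _ => hom_subsingleton _ _

/-- The sheaf given by an intersection is a product. -/
noncomputable def isLimitOpenSheafInf (V W : L) : IsLimit (BinaryFan.mk
    (openSheafMap (inf_le_left : V ⊓ W ≤ V)) (openSheafMap (inf_le_right : V ⊓ W ≤ W))) :=
  BinaryFan.isLimitMk
    (fun s => homOfNonempty fun B x => ⟨⟨⟨le_inf (BinaryFan.fst s |>.hom.app B x).down.down
      (BinaryFan.snd s |>.hom.app B x).down.down⟩⟩⟩)
    (fun _ => hom_subsingleton _ _) (fun _ => hom_subsingleton _ _)
    (fun _ _ _ _ => hom_subsingleton _ _)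

/-! ### Geometric morphisms from the classifying topos to sheaves on a locale. -/

namespace GeometricMorphism

variable (f : GeometricMorphism (ClassifyingTopos T) (Sh L))

theorem subsingleton_inverse (V : L) (B : (SynCat T)ᵒᵖ) :
    Subsingleton ((f.inverse.obj (openSheaf V)).obj.obj B) :=
  have := f.lex
  subsingleton_map f.inverse (fun _ => inferInstance) B

theorem subsingleton_direct (U : π₀ T) (W : (L : Type u)ᵒᵖ) :
    Subsingleton ((f.direct.obj (subterminal U)).obj.obj W) :=
  have : PreservesLimits f.direct := f.adj.rightAdjoint_preservesLimits
  subsingleton_map f.direct (fun _ => inferInstance) W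

/-- The extent of the inverse image of an open. -/
noncomputable def openExtent (V : L) : π₀ T := extent (f.inverse.obj (openSheaf V))

/-- Describes the extent from below through the inverse image, as suits finite meets, which the
inverse image preserves. -/
theorem le_openExtent_iff {V : L} {U : π₀ T} :
    U ≤ f.openExtent V ↔ Nonempty (subterminal U ⟶ f.inverse.obj (openSheaf V)) := by
  have := f.subsingleton_inverse V
  rw [← nonempty_subterminal_hom_iff]
  exact ((Iso.refl _).homCongr (isoSubterminal this)).nonempty_congr.symm

/-- Describes the extent from above through the direct image, by adjunction and Yoneda. This form
suits joins, since sections of the direct image glue. -/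
theorem openExtent_le_iff {V : L} {U : π₀ T} :
    f.openExtent V ≤ U ↔ Nonempty ((f.direct.obj (subterminal U)).obj.obj (.op V)) := by
  have := f.subsingleton_inverse V
  rw [← nonempty_subterminal_hom_iff]
  exact (((isoSubterminal this).homCongr (Iso.refl _)).symm.trans ((f.adj.homEquiv _ _).trans
    (sectionEquiv (fun _ => inferInstance) (nonempty_openSheaf_iff V)))).nonempty_congr

theorem openExtent_mono : Monotone f.openExtent := fun _ _ h =>
  f.le_openExtent_iff.2 ((f.le_openExtent_iff.1 le_rfl).map (· ≫ f.inverse.map (openSheafMap h)))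

/-- The frame homomorphism given by a geometric morphism from the classifying topos. -/
noncomputable def openExtentHom : FrameHom L (π₀ T) where
  toFun := f.openExtent
  map_top' := by
    have := f.lex
    exact top_le_iff.1 (f.le_openExtent_iff.2
      ⟨(isTerminalOpenSheafTop.isTerminalObj f.inverse _).from _⟩)
  map_inf' V W := by
    have := f.lex
    refine le_antisymm (le_inf (f.openExtent_mono inf_le_left) (f.openExtent_mono inf_le_right))
      (f.le_openExtent_iff.2 ?_)
    obtain ⟨a⟩ := f.le_openExtent_iff.1 (inf_le_left : f.openExtent V ⊓ f.openExtent W ≤ _)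
    obtain ⟨b⟩ := f.le_openExtent_iff.1 (inf_le_right : f.openExtent V ⊓ f.openExtent W ≤ _)
    exact ⟨(mapIsLimitOfPreservesOfIsLimit f.inverse _ _ (isLimitOpenSheafInf V W)).lift
      (BinaryFan.mk a b)⟩
  map_sSup' s := by
    refine le_antisymm (f.openExtent_le_iff.2 ?_)
      (sSup_le fun _ ⟨V, hV, e⟩ => e ▸ f.openExtent_mono (le_sSup hV))
    -- This sheaf has at most one section over each open and is inhabited on every member of s,
    -- hence also on their join.
    let F := f.direct.obj (subterminal (sSup (f.openExtent '' s)))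
    let S : Sieve (sSup s) :=
      { arrows := fun V _ => Nonempty (F.obj.obj (.op V))
        downward_closed := fun h f => h.map (F.obj.map f.op) }
    refine nonempty_of_covering F.property (f.subsingleton_direct _) (S := S)
      (sSup_le_sSup fun V hV => ?_) fun _ _ h => h
    exact ⟨homOfLE (le_sSup hV), f.openExtent_le_iff.1 (le_sSup ⟨V, hV, rfl⟩)⟩

/-- The locale morphism given by a geometric morphism from the classifying topos. -/
noncomputable def openExtentMap : π₀ T ⟶ L := (Frm.ofHom f.openExtentHom).op

/-- The sections of the direct image of a sheaf. -/
noncomputable def directEquiv (F : ClassifyingTopos T) (V : L) :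
    (f.direct.obj F).obj.obj (.op V) ≃ F.obj.obj (.op (ofQuot (f.openExtent V))) :=
  (sectionEquiv (fun _ => inferInstance) (nonempty_openSheaf_iff V)).symm.trans
    ((f.adj.homEquiv _ _).symm.trans (sectionEquiv (f.subsingleton_inverse V)
      fun _ => nonempty_iff_extent (f.subsingleton_inverse V)))

theorem directEquiv_map (F : ClassifyingTopos T) {V W : L} (i : V ⟶ W)
    (k : ofQuot (f.openExtent V) ⟶ ofQuot (f.openExtent W))
    (z : (f.direct.obj F).obj.obj (.op W)) :
    f.directEquiv F V ((f.direct.obj F).obj.map i.op z) = F.obj.map k.op (f.directEquiv F W z) := by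
  -- A section is replaced by the morphism that it classifies, so that restriction becomes
  -- precomposition and naturality of the adjunction applies.
  obtain ⟨z, rfl⟩ := (sectionEquiv (P := openSheaf W) (fun _ => inferInstance)
    (nonempty_openSheaf_iff W)).surjective z
  rw [← sectionEquiv_comp (P' := openSheaf V) _ _ (fun _ => inferInstance)
    (nonempty_openSheaf_iff V) (openSheafMap i.le) i z]
  simp only [directEquiv, Equiv.trans_apply, Equiv.symm_apply_apply]
  rw [f.adj.homEquiv_naturality_left_symm]
  exact sectionEquiv_comp _ _ _ _ _ k _

theorem directEquiv_naturality {F G : ClassifyingTopos T} (a : F ⟶ G) (V : L)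
    (z : (f.direct.obj F).obj.obj (.op V)) :
    f.directEquiv G V ((f.direct.map a).hom.app _ z) = a.hom.app _ (f.directEquiv F V z) := by
  obtain ⟨z, rfl⟩ := (sectionEquiv (P := openSheaf V) (fun _ => inferInstance)
    (nonempty_openSheaf_iff V)).surjective z
  have : (f.direct.map a).hom.app _ (sectionEquiv (P := openSheaf V) (fun _ => inferInstance)
      (nonempty_openSheaf_iff V) z) = sectionEquiv (fun _ => inferInstance)
      (nonempty_openSheaf_iff V) (z ≫ f.direct.map a) := rfl
  rw [this]
  simp only [directEquiv, Equiv.trans_apply, Equiv.symm_apply_apply]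
  rw [f.adj.homEquiv_naturality_right_symm]
  rfl

/-- A geometric morphism from the classifying topos factors through the localic reflection. -/
noncomputable def directIso : (toSheaves T).direct ⋙ Sh.direct f.openExtentMap ≅ f.direct :=
  (NatIso.ofComponents
    (G := (toSheaves T).direct ⋙ Sh.direct f.openExtentMap)
    (fun F => (fullyFaithfulSheafToPresheaf (frameTopology L) (Type u)).preimageIso
      (NatIso.ofComponents (F := (f.direct.obj F).obj)
        (G := (((toSheaves T).direct ⋙ Sh.direct f.openExtentMap).obj F).obj)
        (fun V => (f.directEquiv F V.unop).toIso) fun {V W} i => by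
          ext z
          exact f.directEquiv_map F i.unop _ z))
    fun a => by
      refine Sheaf.hom_ext (NatTrans.ext (funext fun V => ?_))
      ext z
      exact f.directEquiv_naturality a V.unop z).symm

end GeometricMorphism

/-- On the subterminal sheaf of U, the direct image along g has a section over V exactly if g^* V ≤
U, so the functor determines g^*. -/
theorem eq_of_directIso {g g' : π₀ T ⟶ L}
    (i : (toSheaves T).direct ⋙ Sh.direct g ≅ (toSheaves T).direct ⋙ Sh.direct g') : g = g' := by
  have key : ∀ V U, frameMap g V ≤ U ↔ frameMap g' V ≤ U := fun V U => by
    rw [← nonempty_ofQuot_hom, ← nonempty_ofQuot_hom, ← nonempty_subterminal_iff,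
      ← nonempty_subterminal_iff]
    let e := (i.app (subterminal U))
    exact ⟨fun ⟨x⟩ => ⟨e.hom.hom.app (.op V) x⟩, fun ⟨x⟩ => ⟨e.inv.hom.app (.op V) x⟩⟩
  refine Quiver.Hom.unop_inj (ConcreteCategory.hom_ext _ _ fun V => ?_)
  exact eq_of_forall_ge_iff (key V)

theorem existsUnique_locale_hom (f : GeometricMorphism (ClassifyingTopos T) (Sh L)) :
    ∃! g : π₀ T ⟶ L, Nonempty ((toSheaves T).direct ⋙ Sh.direct g ≅ f.direct) :=
  ⟨f.openExtentMap, ⟨f.directIso⟩, fun _ ⟨i⟩ => eq_of_directIso (i ≪≫ f.directIso.symm)⟩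

end

end GeometricLogic

theorem mainTheorem6 (T : Theory.{u}) :
    (∃ p : GeometricMorphism (ClassifyingTopos T) (Sh (π₀ T)),
      ∀ (L : Locale.{u}) (f : GeometricMorphism (ClassifyingTopos T) (Sh L)),
        ∃! g : π₀ T ⟶ L, Nonempty (p.direct ⋙ Sh.direct g ≅ f.direct)) ∧
    GaloisConnection (sShriek T) (frameMap (source T)) ∧
    (∃ c : ClosureOperator (G₀ T),
      (∀ u, c u = sShriek T (frameMap (target T) u)) ∧
      (∀ J : Finset (Gen T.sig), c (J.inf (P T).gen) =
        ⨆ y : T.sig.Srt → ℕ → ℕ, J.inf fun g => (P T).gen (g.subst y)) ∧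
      ∃ e : π₀ T ≃o {u : G₀ T // c u = u}, ∀ u, (e u : G₀ T) = frameMap (quot T) u) ∧
    ∃ θ : SentenceFrame T ≃o π₀ T,
      (∀ φ : Sentence T, frameMap (quot T) (θ (toAntisymmetrization (· ≤ ·) φ)) = φ.toOpen) ∧
      ∃ e : π₀ T ≃o Subobject (⊤_ ClassifyingTopos T),
        ∀ (φ : Sentence T) (B : SynCat T),
          Nonempty ((e (θ (toAntisymmetrization (· ≤ ·) φ)) : ClassifyingTopos T).obj.obj (.op B)) ↔
            Provable T B.formula (φ.weaken B.ctx) :=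
  ⟨⟨toSheaves T, fun _ f => existsUnique_locale_hom f⟩, sShriek_gc T,
    ⟨isoClosure T, isoClosure_apply, isoClosure_inf_gen, quotIso T, quotIso_apply T⟩,
    sentenceQuotIso T, frameMap_quot_sentenceQuotIso, subobjectIso T,
    fun _ _ => nonempty_subobjectIso_toQuot_iff⟩
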